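/- **Theorem (gradient estimate).** Let $n\ge k\ge 2$ and $0\le l\le k-2$. Let $(M,g')$ be a compact smooth Riemannian manifold without boundary of dimension $n$, let $I\subset\mathbb R$ be an open interval, let $\lambda\in C^2(I)$ with $\lambda>0$, $\lambda'>0$, and let $\overline M=I\times M$ carry the warped product metric $\overline g=dr^2+\lambda(r)^2g'$, with curvature tensor $\overline R$. Let $f=f(V,\nu)$ be a $C^1$ function of a point $V=(r,u)\in\overline M$ and a unit tangent vector $\nu\in T_V\overline M$, let $\varphi\in C^1(I)$ with $\varphi>0$, put $\zeta=\lambda'/\lambda$ and, for $0\le t\le 1$, $$f^t(V,\nu)=t\,f(V,\nu)+(1-t)f^0(r),\qquad f^0(r)=\varphi(r)\,\frac{\binom nk}{\binom nl}\,\big((n-1)\zeta(r)\big)^{k-l}.$$ For $r\in C^3(M;I)$ let $\Sigma=\{(r(u),u):u\in M\}$ be its radial graph, with outward unit normal $\nu$ (that is $\langle\nu,\partial_r\rangle>0$), first and second fundamental forms $g_{ij}$ and $h_{ij}=-\langle\overline\nabla_{X_j}X_i,\nu\rangle$, mean curvature $H=g^{ij}h_{ij}$, and $\eta_{ij}=Hg_{ij}-h_{ij}$;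 let $\mu(\eta)\in\mathbb R^n$ be the eigenvalues of $g^{-1}\eta$, and $\sigma_j$ the $j$-th elementary symmetric function. Suppose that $\Sigma$ is $(\eta,k)$-convex, i.e. $\sigma_j(\mu(\eta))>0$ on $\Sigma$ for $1\le j\le k$, and that it solves $$\frac{\sigma_k(\mu(\eta))}{\sigma_l(\mu(\eta))}=f^t(V,\nu(V))\quad\text{on }\Sigma$$ for some $t\in[0,1]$, and let $0<r_1\le r(u)\le r_2$ for all $u\in M$, where $[r_1,r_2]\subset I$. Assume that $$\frac{\partial}{\partial r}\big(\lambda^{k-l}f(V,\nu)\big)\le 0\quad\text{for } r_1<r<r_2$$ (with $\nu$ moved by parallel transport along the $r$-lines) and, if $t<1$, that also $\frac{d}{dr}\big(\lambda^{k-l}f^0\big)\le0$ for $r_1<r<r_2$, i.e. that $\varphi\,(\lambda')^{k-l}$ is non-increasing there. Then $$|Dr|_{g'}\le C\quad\text{on }M,$$ where $C$ depends only on $n,k,l,r_1,r_2$, on a positive lower bound and a $C^1$ bound for $\lambda$ on $[r_1,r_2]$, on a bound for $|\overline R|$ on $\{r_1\le r\le r_2\}$, on a positive lower bound for $f$ on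 $\Sigma$ (at $(V,\nu(V))$), on a bound for $\|f\|_{C^1}$ over the unit tangent vectors on $\{r_1\le r\le r_2\}$ and, if $t<1$, on a positive lower bound and a $C^1$ bound for $f^0$ on $[r_1,r_2]$. In particular $C$ does not otherwise depend on $M$, $g'$, $\lambda$, $\varphi$, $f$, $t$ or $r$. -/

import Mathlib

open scoped Manifold ContDiff

noncomputable section

namespace HessianQuotient

/-! ### Riemannian geometry in charts

`N` is a manifold without boundary modelled on a finite-dimensional space `F`. In Mathlib the
tangent space `TangentSpace J p` is by definition `F`: a tangent vector at `p` is its coordinate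
vector in the preferred chart at `p`. Tangent vectors are therefore written as elements of `F`, and
tensors at `p` are evaluated at the centre `extChartAt J p p` of the preferred chart at `p`. -/

section Charts

variable {F H N : Type*} [NormedAddCommGroup F] [NormedSpace ℝ F] [TopologicalSpace H]
  [TopologicalSpace N] [ChartedSpace H N] (J : ModelWithCorners ℝ F H)

/-- The differential at `y` of the inverse of the preferred chart at `p`: it sends the coordinate
vector `X` to the tangent vector `X^i ∂_i` at the point with coordinates `y`. -/
def chartFrame (p : N) (y : F) : F →L[ℝ] F :=
  mfderiv 𝓘(ℝ, F) J (extChartAt J p).symm y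

/-- The components `G_{ij}(y)` of a metric `G` in the preferred chart at `p`. -/
def chartMetric (G : N → F →L[ℝ] F →L[ℝ] ℝ) (p : N) (y : F) : F →L[ℝ] F →L[ℝ] ℝ :=
  (G ((extChartAt J p).symm y)).bilinearComp (chartFrame J p y) (chartFrame J p y)

/-- Christoffel symbols of the first kind:
`Z ↦ (1/2) (∂_X G(Y,Z) + ∂_Y G(X,Z) - ∂_Z G(X,Y))`. -/
def christoffelLow (G : N → F →L[ℝ] F →L[ℝ] ℝ) (p : N) (y X Y : F) : F →L[ℝ] ℝ :=
  letI D : F →L[ℝ] F →L[ℝ] F →L[ℝ] ℝ := fderiv ℝ (chartMetric J G p) y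
  (1 / 2 : ℝ) • (D X Y + D Y X - (D.flip X).flip Y)

/-- Christoffel symbols of the Levi-Civita connection of `G`: the vector `Γ(X,Y)` that satisfies
`G(Γ(X,Y), Z) = (1/2) (∂_X G(Y,Z) + ∂_Y G(X,Z) - ∂_Z G(X,Y))` for all `Z`. -/
def christoffel (G : N → F →L[ℝ] F →L[ℝ] ℝ) (p : N) (y X Y : F) : F :=
  (chartMetric J G p y).inverse (christoffelLow J G p y X Y)

/-- The Riemann curvature operator at the point `p`:
`R(X,Y)Z = ∂_X (Γ(Y,Z)) - ∂_Y (Γ(X,Z)) + Γ(X,Γ(Y,Z)) - Γ(Y,Γ(X,Z))`. -/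
def curvatureOp (G : N → F →L[ℝ] F →L[ℝ] ℝ) (p : N) (X Y Z : F) : F :=
  letI y : F := extChartAt J p p
  letI Γ : F → F → F → F := christoffel J G p
  fderiv ℝ (fun q => Γ q Y Z) y X - fderiv ℝ (fun q => Γ q X Z) y Y
    + Γ y X (Γ y Y Z) - Γ y Y (Γ y X Z)

/-- The length of a tangent vector. -/
def len (G : N → F →L[ℝ] F →L[ℝ] ℝ) (p : N) (X : F) : ℝ := √(G p X X)

variable {J}

/-- The coordinate expression `(q, ξ) ↦ f(q, ξ^i ∂_i)` of a function on the tangent bundle. -/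
def chartFun (f : TangentBundle J N → ℝ) (p : N) (z : F × F) : ℝ :=
  f ⟨(extChartAt J p).symm z.1, chartFrame J p z.1 z.2⟩

/-- The horizontal derivative `d_V f (X)` at `(p, ξ)`: the derivative of `f` along the parallel
transport of `ξ` in the direction `X`. -/
def horDeriv (G : N → F →L[ℝ] F →L[ℝ] ℝ) (f : TangentBundle J N → ℝ) (p : N) (ξ X : F) : ℝ :=
  letI y : F := extChartAt J p p
  fderiv ℝ (chartFun f p) (y, ξ) (X, -christoffel J G p y X ξ)

/-- The vertical derivative `d_ν f (Y)` at `(p, ξ)`: the derivative of `f` in the fibre. -/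
def vertDeriv (f : TangentBundle J N → ℝ) (p : N) (ξ Y : F) : ℝ :=
  fderiv ℝ (fun ζ : F => f ⟨p, ζ⟩) ξ Y

end Charts

/-! ### Hypersurfaces and elementary symmetric functions of eigenvalues -/

section Hypersurface

/-- Euclidean space, the model of an `n`-dimensional manifold. -/
abbrev Eucl (n : ℕ) := EuclideanSpace ℝ (Fin n)

/-- The standard basis vectors; in a tangent space they are the coordinate vectors `∂_i`. -/
def stdVec {n : ℕ} (i : Fin n) : Eucl n := EuclideanSpace.single i 1

/-- `σ_j` of the eigenvalues of a square matrix. -/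
def sigmaEig {n : ℕ} (j : ℕ) (A : Matrix (Fin n) (Fin n) ℝ) : ℝ :=
  (A.charpoly.roots).esymm j

variable {n : ℕ} {F H N M : Type*} [NormedAddCommGroup F] [NormedSpace ℝ F] [TopologicalSpace H]
  [TopologicalSpace N] [ChartedSpace H N] (J : ModelWithCorners ℝ F H)
  [TopologicalSpace M] [ChartedSpace (Eucl n) M]

/-- The differential of a map `X : M → N` at `u`. -/
def differential (X : M → N) (u : M) : Eucl n →L[ℝ] F :=
  mfderiv 𝓘(ℝ, Eucl n) J X u

/-- The first fundamental form `g_{ij}` of the immersion `X` at `u`, in the coordinate basis. -/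
def firstForm (G : N → F →L[ℝ] F →L[ℝ] ℝ) (X : M → N) (u : M) : Matrix (Fin n) (Fin n) ℝ :=
  Matrix.of fun i j =>
    G (X u) (differential J X u (stdVec i)) (differential J X u (stdVec j))

/-- The covariant derivative `∇_{∂_a X} (∂_b X) = ∂_a ∂_b X + Γ(∂_a X, ∂_b X)` of the ambient
Levi-Civita connection along the immersion `X` at `u`, in the direction of coordinate vectors
`a`, `b`. -/
def covDeriv (G : N → F →L[ℝ] F →L[ℝ] ℝ) (X : M → N) (u : M) (a b : Eucl n) : F :=
  letI x : Eucl n → F := writtenInExtChartAt 𝓘(ℝ, Eucl n) J u X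
  letI y : Eucl n := extChartAt 𝓘(ℝ, Eucl n) u u
  fderiv ℝ (fderiv ℝ x) y a b + christoffel J G (X u) (x y) (fderiv ℝ x y a) (fderiv ℝ x y b)

/-- The second fundamental form `h_{ij} = -⟨∇_{X_i} X_j, ν⟩` of the immersion `X` at `u` with
respect to `ν`, in the coordinate basis. -/
def secondForm (G : N → F →L[ℝ] F →L[ℝ] ℝ) (X : M → N) (u : M) (ν : F) :
    Matrix (Fin n) (Fin n) ℝ :=
  Matrix.of fun i j => -(G (X u) (covDeriv J G X u (stdVec i) (stdVec j)) ν)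

variable (n)

/-- The matrix `g⁻¹ η`, where `η = H g - h` and `H = tr (g⁻¹ h)` is the mean curvature. -/
def etaMatrix (G : N → F →L[ℝ] F →L[ℝ] ℝ) (X : M → N) (u : M) (ν : F) :
    Matrix (Fin n) (Fin n) ℝ :=
  letI g : Matrix (Fin n) (Fin n) ℝ := firstForm J G X u
  letI h : Matrix (Fin n) (Fin n) ℝ := secondForm J G X u ν
  g⁻¹ * ((g⁻¹ * h).trace • g - h)

/-- `σ_j(μ(η))`, where `μ(η)` are the eigenvalues of `g⁻¹ η`. -/
def sigmaEta (G : N → F →L[ℝ] F →L[ℝ] ℝ) (X : M → N) (j : ℕ) (u : M) (ν : F) : ℝ :=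
  sigmaEig j (etaMatrix n J G X u ν)

/-- `ν` is a unit normal vector of the immersion `X` at `u`. -/
def IsUnitNormal (G : N → F →L[ℝ] F →L[ℝ] ℝ) (X : M → N) (u : M) (ν : F) : Prop :=
  G (X u) ν ν = 1 ∧ ∀ v : Eucl n, G (X u) ν (differential J X u v) = 0

end Hypersurface

/-! ### Warped products and the curvature equation -/

section Warped

/-- The tangent spaces of `ℝ × M`: the pair `(a, w)` is the tangent vector `a ∂_r + w`. -/
abbrev Amb (n : ℕ) := ℝ × Eucl n

/-- The model with corners of `ℝ × M`. -/
abbrev prodModel (n : ℕ) := 𝓘(ℝ, ℝ).prod 𝓘(ℝ, Eucl n)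

variable {n : ℕ} {M : Type*}

/-- The warped product metric `dr² + lam(r)² g` on `I × M ⊆ ℝ × M`. It is written down on all of
`ℝ × M` and is a Riemannian metric where `lam` is positive. -/
def warpedMetric (g : M → Eucl n →L[ℝ] Eucl n →L[ℝ] ℝ) (lam : ℝ → ℝ) (x : ℝ × M) :
    Amb n →L[ℝ] Amb n →L[ℝ] ℝ :=
  letI dr : Amb n →L[ℝ] ℝ := ContinuousLinearMap.fst ℝ ℝ (Eucl n)
  letI du : Amb n →L[ℝ] Eucl n := ContinuousLinearMap.snd ℝ ℝ (Eucl n)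
  (ContinuousLinearMap.mul ℝ ℝ).bilinearComp dr dr + lam x.1 ^ 2 • (g x.2).bilinearComp du du

/-- The radial graph `u ↦ (r(u), u)`. -/
def graph (r : M → ℝ) (u : M) : ℝ × M := (r u, u)

variable [TopologicalSpace M] [ChartedSpace (Eucl n) M]

/-- The bilinear forms `⟨v, w⟩_u` of a smooth Riemannian metric on `M`. -/
def metricForm [IsManifold 𝓘(ℝ, Eucl n) ∞ M]
    (g : Bundle.ContMDiffRiemannianMetric 𝓘(ℝ, Eucl n) ∞ (Eucl n)
      (fun u : M => TangentSpace 𝓘(ℝ, Eucl n) u)) (u : M) : Eucl n →L[ℝ] Eucl n →L[ℝ] ℝ :=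
  g.inner u

/-- `ν` is the outward unit normal of the radial graph of `r` at `u`, that is the unit normal
with `⟨ν, ∂_r⟩ > 0`. -/
def IsOuterNormal (g : M → Eucl n →L[ℝ] Eucl n →L[ℝ] ℝ) (lam : ℝ → ℝ) (r : M → ℝ) (u : M)
    (ν : Amb n) : Prop :=
  IsUnitNormal n (prodModel n) (warpedMetric g lam) (graph r) u ν ∧
    0 < warpedMetric g lam (graph r u) ν (1, 0)

/-- The function `f⁰(s) = φ(s) (C_n^k / C_n^l) ((n-1) ζ(s))^{k-l}` with `ζ = lam' / lam`. -/
def baseRHS (n k l : ℕ) (lam φ : ℝ → ℝ) (s : ℝ) : ℝ :=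
  φ s * ((n.choose k : ℝ) / (n.choose l : ℝ)) * (((n : ℝ) - 1) * (deriv lam s / lam s)) ^ (k - l)

/-- The right-hand side `f^t = t f + (1-t) f⁰` of the homotopy equation. -/
def homotopyRHS (k l : ℕ) (lam φ : ℝ → ℝ) (t : ℝ)
    (f : TangentBundle (prodModel n) (ℝ × M) → ℝ) (x : ℝ × M) (ν : Amb n) : ℝ :=
  t * f ⟨x, ν⟩ + (1 - t) * baseRHS n k l lam φ x.1

/-- The radial graph of `r` is `(η, k)`-convex: `μ(η)` lies in the Garding cone `Γ_k`. -/
def IsEtaConvex (g : M → Eucl n →L[ℝ] Eucl n →L[ℝ] ℝ) (k : ℕ) (lam : ℝ → ℝ) (r : M → ℝ) : Prop :=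
  ∀ (u : M) (ν : Amb n), IsOuterNormal g lam r u ν → ∀ j, 1 ≤ j → j ≤ k →
    0 < sigmaEta n (prodModel n) (warpedMetric g lam) (graph r) j u ν

/-- The radial graph of `r` solves `σ_k(μ(η)) / σ_l(μ(η)) = f^t(V, ν(V))`. -/
def SolvesHomotopy (g : M → Eucl n →L[ℝ] Eucl n →L[ℝ] ℝ) (k l : ℕ) (lam φ : ℝ → ℝ) (t : ℝ)
    (f : TangentBundle (prodModel n) (ℝ × M) → ℝ) (r : M → ℝ) : Prop :=
  ∀ (u : M) (ν : Amb n), IsOuterNormal g lam r u ν →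
    sigmaEta n (prodModel n) (warpedMetric g lam) (graph r) k u ν
        / sigmaEta n (prodModel n) (warpedMetric g lam) (graph r) l u ν
      = homotopyRHS k l lam φ t f (graph r u) ν

/-- `f` is `C¹` near the unit tangent bundle of `I × M`. -/
def IsC1OnUnit [IsManifold 𝓘(ℝ, Eucl n) ∞ M] (g : M → Eucl n →L[ℝ] Eucl n →L[ℝ] ℝ)
    (lam : ℝ → ℝ) (I : Set ℝ) (f : TangentBundle (prodModel n) (ℝ × M) → ℝ) : Prop :=
  ∀ (x : ℝ × M) (ν : Amb n), x.1 ∈ I → warpedMetric g lam x ν ν = 1 →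
    ContMDiffAt (prodModel n).tangent 𝓘(ℝ, ℝ) 1 f ⟨x, ν⟩

/-- `‖f‖_{C¹} ≤ K` on the unit tangent vectors over the annulus `r₁ ≤ r ≤ r₂`: the function, its
horizontal derivatives and its derivatives along the unit spheres are bounded by `K`. -/
def C1NormLE (g : M → Eucl n →L[ℝ] Eucl n →L[ℝ] ℝ) (lam : ℝ → ℝ) (r₁ r₂ K : ℝ)
    (f : TangentBundle (prodModel n) (ℝ × M) → ℝ) : Prop :=
  ∀ (x : ℝ × M) (ν : Amb n), x.1 ∈ Set.Icc r₁ r₂ → warpedMetric g lam x ν ν = 1 →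
    |f ⟨x, ν⟩| ≤ K ∧
    (∀ X, |horDeriv (warpedMetric g lam) f x ν X| ≤ K * len (warpedMetric g lam) x X) ∧
    (∀ Y, warpedMetric g lam x ν Y = 0 →
      |vertDeriv f x ν Y| ≤ K * len (warpedMetric g lam) x Y)

/-- `∂/∂r (lam^{k-l} f(V, ν)) ≤ 0` for `r₁ < r < r₂`. The unit vector `ν` is kept fixed in the
orthonormal frame `∂_r, lam⁻¹ e_i`, which is parallel along the `r`-lines: `ν = a ∂_r + lam⁻¹ w`
with `a² + |w|² = 1`. -/
def RadialMonotone (g : M → Eucl n →L[ℝ] Eucl n →L[ℝ] ℝ) (k l : ℕ) (lam : ℝ → ℝ) (r₁ r₂ : ℝ)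
    (f : TangentBundle (prodModel n) (ℝ × M) → ℝ) : Prop :=
  ∀ s ∈ Set.Ioo r₁ r₂, ∀ (u : M) (a : ℝ) (w : Eucl n), a ^ 2 + g u w w = 1 →
    deriv (fun ρ => lam ρ ^ (k - l) * f ⟨(ρ, u), ((a, (lam ρ)⁻¹ • w) : Amb n)⟩) s ≤ 0

/-- The curvature tensor of the warped product is bounded by `B` on `r₁ ≤ r ≤ r₂`. -/
def CurvatureLE (g : M → Eucl n →L[ℝ] Eucl n →L[ℝ] ℝ) (lam : ℝ → ℝ) (r₁ r₂ B : ℝ) : Prop :=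
  ∀ (x : ℝ × M), x.1 ∈ Set.Icc r₁ r₂ → ∀ X Y Z W : Amb n,
    |warpedMetric g lam x (curvatureOp (prodModel n) (warpedMetric g lam) x X Y Z) W| ≤
      B * len (warpedMetric g lam) x X * len (warpedMetric g lam) x Y
        * len (warpedMetric g lam) x Z * len (warpedMetric g lam) x W

end Warped

end HessianQuotient

end

open scoped Manifold ContDiff

noncomputable section

namespace HessianQuotient

/-! ### Newton's inequalities and the Garding cone -/

section Newton

open Polynomial

/-! Put φ = ψ ∘ r with ψ' = 1/λ, so that dr = λ dφ, and let p = |∇φ|², w = 1 + p, v = √w. The graph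
has first form λ²P and second form (λ/v)(λ'P − ∇²φ), where P = g' + dφ ⊗ dφ. Hence g⁻¹η is 1/(λv)
times tr b − b with b = λ' − P⁻¹∇²φ, and the equation says that σ_k/σ_l of tr b − b equals s^{k−l}
f^t with s = λv (`sigmaEta_graph`, `sigmaEig_graphEta_eq`).

For a constant α, the function (1/2) log w − αφ has a maximum on the compact M. If ∇φ vanishes
there, then log v ≤ α osc ψ ≤ α(r₂ − r₁)/λ₀ everywhere, with λ₀ a lower bound of λ, and |Dr| = λ|∇φ|
is bounded. It remains to find an α, depending on the data alone, for which a maximum with ∇φ ≠ 0 is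
impossible.

At such a maximum the first order condition reads ∇²φ(·, ∇φ) = αw dφ. In a P-orthonormal basis e_i
that diagonalises ∇²φ, each e_i with dφ(e_i) ≠ 0 therefore has the eigenvalue α, and b_i = λ' − α ≤
0 once α ≥ λ'. Let G_i ≥ 0 be σ_l² times the derivative of σ_k/σ_l in μ_i = tr b − b_i, and S = ∑
G_i. In terms of b the linearised equation has the weights Φ_i = S − G_i. If b_i ≤ 0, then μ_i is
not the strict minimum; since G decreases in μ, this forces Φ_i ≥ S/2 (`sum_quotGrad_le`). So the
operator is uniformly elliptic, relative to S, exactly in the directions that ∇φ sees.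

The second order condition is contracted with Φ. The Ricci identity turns its third derivatives into
derivatives along ∇φ, and the equation differentiated along ∇φ removes them. The square of the
Hessian contributes at least α²S/2 (`key_inequality`), while all other terms cost at most C(1 + α)S.
Indeed, the ambient curvature bound controls both the curvature of g' from the needed side and λ''.
For f^t, the lift of ∇φ to the graph is λw ∂_r − λv ν: the part quadratic in v meets the
monotonicity of λ^{k−l} f and has a good sign, and the rest is O(v) (`along_grad_le`). This rest is
absorbed because Newton's inequalities and the equation give S ≥ c s^{k−l−1} σ_l². The outcome α² ≤
C(1 + α) fails for large α (`bound_at_max`, `testCoeff_spec`). Monotonicity is available only for r₁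
< r < r₂, but where r equals r₁ or r₂ it is extremal and ∇φ = 0 anyway. -/

theorem coeff_prod_X_sub_C_laguerre (s : Multiset ℝ) :
    2 * (Multiset.card s : ℝ) * ((s.map fun a => X - C a).prod.coeff 0
        * (s.map fun a => X - C a).prod.coeff 2)
      ≤ ((Multiset.card s : ℝ) - 1) * (s.map fun a => X - C a).prod.coeff 1 ^ 2 := by
  induction s using Multiset.induction with
  | empty => simp [coeff_one]
  | cons a s ih =>
    simp only [Multiset.map_cons, Multiset.prod_cons, Multiset.card_cons]
    set P := (s.map fun a => X - C a).prod
    set d : ℝ := (Multiset.card s : ℝ)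
    have h0 : ((X - C a) * P).coeff 0 = -a * P.coeff 0 := by simp [sub_mul]
    have h1 : ((X - C a) * P).coeff 1 = P.coeff 0 - a * P.coeff 1 := by
      simp [sub_mul, coeff_X_mul]
    have h2 : ((X - C a) * P).coeff 2 = P.coeff 1 - a * P.coeff 2 := by
      simp [sub_mul, coeff_X_mul]
    rw [h0, h1, h2]
    rcases s.empty_or_exists_mem with rfl | ⟨b, hb⟩
    · have : P = 1 := by simp [P]
      simp [this, coeff_one]
    · have hd : 0 < d := by
        simpa [d] using Multiset.card_pos_iff_exists_mem.2 ⟨b, hb⟩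
      push_cast
      set q0 := P.coeff 0
      set q1 := P.coeff 1
      set q2 := P.coeff 2
      -- Multiplied by d, the defect of (X − a)P is a perfect square plus a nonnegative multiple of
      -- the defect of P.
      have key : 0 ≤ (d * q0 + a * q1) ^ 2 + a ^ 2 * (d + 1) *
          ((d - 1) * q1 ^ 2 - 2 * d * (q0 * q2)) := by
        have := mul_nonneg (mul_nonneg (sq_nonneg a) (by positivity : 0 ≤ d + 1)) (sub_nonneg.2 ih)
        have := sq_nonneg (d * q0 + a * q1)
        linarith
      have : 0 ≤ d * (((d + 1) - 1) * (q0 - a * q1) ^ 2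
          - 2 * (d + 1) * (-a * q0 * (q1 - a * q2))) := by
        refine key.trans_eq ?_
        ring
      have := nonneg_of_mul_nonneg_right this hd
      linarith

/-- Both sides are quadratic in the coefficients, so the leading coefficient scales out of the monic
case. -/
theorem splits_laguerre {P : ℝ[X]} (hP : P.Splits) :
    2 * (P.natDegree : ℝ) * (P.coeff 0 * P.coeff 2) ≤ ((P.natDegree : ℝ) - 1) * P.coeff 1 ^ 2 := by
  have h := hP.eq_prod_roots
  have hc := splits_iff_card_roots.1 hP
  have := coeff_prod_X_sub_C_laguerre P.roots
  rw [hc] at this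
  set Q := (P.roots.map fun a => X - C a).prod
  have hi : ∀ i, P.coeff i = P.leadingCoeff * Q.coeff i := fun i => by
    conv_lhs => rw [h]
    rw [coeff_C_mul]
  rw [hi, hi, hi]
  have := mul_le_mul_of_nonneg_left this (sq_nonneg P.leadingCoeff)
  linarith

/-- Rolle's theorem: counted with multiplicity, differentiation costs at most one real root, and
unless P is constant it lowers the degree as well. -/
theorem splits_derivative {P : ℝ[X]} (hP : P.Splits) : (derivative P).Splits := by
  rw [splits_iff_card_roots] at hP ⊢
  have h1 := card_roots_le_derivative P
  have h2 := card_roots' (derivative P)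
  have h3 := natDegree_derivative_le P
  by_cases h : P.natDegree = 0
  · have : (derivative P).natDegree = 0 := by omega
    omega
  · omega

theorem splits_iterate_derivative {P : ℝ[X]} (hP : P.Splits) (m : ℕ) :
    (derivative^[m] P).Splits := by
  induction m with
  | zero => simpa
  | succ m ih => rw [Function.iterate_succ_apply']; exact splits_derivative ih

/-- Newton's inequality for the elementary symmetric functions of real numbers. -/
theorem newton_esymm (s : Multiset ℝ) {j m : ℕ} (h : Multiset.card s = m + (j + 2)) :
    ((j : ℝ) + 2) * (m + 2) * (s.esymm j * s.esymm (j + 2))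
      ≤ ((j : ℝ) + 1) * (m + 1) * s.esymm (j + 1) ^ 2 := by
  set P : ℝ[X] := (s.map fun a => X + C a).prod with hP
  have hsp : P.Splits := by
    have : P = ((s.map Neg.neg).map fun a => X - C a).prod := by
      simp [hP, Multiset.map_map, sub_eq_add_neg]
    rw [this]
    refine Splits.multisetProd ?_
    intro f hf
    obtain ⟨a, -, rfl⟩ := Multiset.mem_map.1 hf
    exact Splits.X_sub_C a
  have hdeg : P.natDegree = m + (j + 2) := by
    rw [hP, natDegree_multiset_prod_of_monic _ (fun f hf => ?_)]
    · simp [Multiset.map_map, h]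
    · obtain ⟨a, -, rfl⟩ := Multiset.mem_map.1 hf
      exact monic_X_add_C a
  have hco : ∀ i, i ≤ m + (j + 2) → P.coeff i = s.esymm (m + (j + 2) - i) := by
    intro i hi
    rw [hP, Multiset.prod_X_add_C_coeff s (by omega), h]
  -- The three lowest coefficients of the m-th derivative are m! σ_{j+2}, (m+1)! σ_{j+1} and
  -- ((m+2)!/2) σ_j.
  have hQ := splits_laguerre (splits_iterate_derivative hsp m)
  have hQd : (derivative^[m] P).natDegree = j + 2 := by
    refine le_antisymm ((natDegree_iterate_derivative P m).trans (by omega)) ?_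
    refine le_natDegree_of_ne_zero ?_
    rw [coeff_iterate_derivative, hco _ (by omega), show m + (j + 2) - (j + 2 + m) = 0 by omega]
    simp [Multiset.esymm, Nat.descFactorial_eq_zero_iff_lt]
  rw [hQd, coeff_iterate_derivative, coeff_iterate_derivative, coeff_iterate_derivative,
    hco _ (by omega), hco _ (by omega), hco _ (by omega)] at hQ
  have e0 : m + (j + 2) - (0 + m) = j + 2 := by omega
  have e1 : m + (j + 2) - (1 + m) = j + 1 := by omega
  have e2 : m + (j + 2) - (2 + m) = j := by omega
  rw [e0, e1, e2] at hQ
  have f0 : (0 + m).descFactorial m = m.factorial := by simp [Nat.descFactorial_self]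
  have f1 : (1 + m).descFactorial m = (m + 1) * m.factorial := by
    have := Nat.factorial_mul_descFactorial (n := 1 + m) (k := m) (by omega)
    rw [show 1 + m - m = 1 by omega, Nat.factorial_one, one_mul, add_comm 1 m] at this
    rw [add_comm 1 m, this, Nat.factorial_succ]
  have f2 : 2 * (2 + m).descFactorial m = (m + 2) * ((m + 1) * m.factorial) := by
    have := Nat.factorial_mul_descFactorial (n := 2 + m) (k := m) (by omega)
    rw [show 2 + m - m = 2 by omega] at this
    rw [Nat.factorial_two, add_comm 2 m, Nat.factorial_succ, Nat.factorial_succ] at this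
    rw [add_comm 2 m, this]
  rw [f0, f1] at hQ
  have f2' : ((2 + m).descFactorial m : ℝ) = (m + 2) * ((m + 1) * m.factorial) / 2 := by
    rw [eq_div_iff two_ne_zero]; exact_mod_cast (by linarith [f2])
  simp only [nsmul_eq_mul] at hQ
  rw [f2'] at hQ
  push_cast at hQ
  have hf : (0 : ℝ) < m.factorial := by exact_mod_cast m.factorial_pos
  have hm : (0 : ℝ) < (m : ℝ) + 1 := by positivity
  have : 0 ≤ ((m.factorial : ℝ) ^ 2 * (m + 1)) * (((j : ℝ) + 1) * (m + 1) * s.esymm (j + 1) ^ 2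
      - ((j : ℝ) + 2) * (m + 2) * (s.esymm j * s.esymm (j + 2))) := by
    nlinarith [hQ]
  have := nonneg_of_mul_nonneg_right this (by positivity)
  linarith

theorem esymm_eq_zero_of_card_lt (s : Multiset ℝ) {j : ℕ} (h : Multiset.card s < j) :
    s.esymm j = 0 := by
  simp [Multiset.esymm, Multiset.powersetCard_eq_empty _ h]

/-- Newton's inequality with the constants discarded. No sign of the numbers is assumed: a negative
left side is harmless. -/
theorem esymm_mul_esymm_le_sq (s : Multiset ℝ) (j : ℕ) :
    s.esymm j * s.esymm (j + 2) ≤ s.esymm (j + 1) ^ 2 := by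
  rcases lt_or_ge (Multiset.card s) (j + 2) with h | h
  · rw [esymm_eq_zero_of_card_lt s h, mul_zero]; positivity
  · obtain ⟨m, hm⟩ := Nat.exists_eq_add_of_le' h
    have := newton_esymm s hm
    by_contra! hc
    have h0 := sq_nonneg (s.esymm (j + 1))
    have h1 : ((j : ℝ) + 1) * (m + 1) * s.esymm (j + 1) ^ 2
        ≤ ((j : ℝ) + 2) * (m + 2) * s.esymm (j + 1) ^ 2 := by gcongr <;> norm_num
    have h2 : ((j : ℝ) + 2) * (m + 2) * s.esymm (j + 1) ^ 2
        < ((j : ℝ) + 2) * (m + 2) * (s.esymm j * s.esymm (j + 2)) := by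
      gcongr
    linarith

theorem esymm_zero' (s : Multiset ℝ) : s.esymm 0 = 1 := by simp [Multiset.esymm]

theorem esymm_cons_succ (a : ℝ) (s : Multiset ℝ) (j : ℕ) :
    (a ::ₘ s).esymm (j + 1) = s.esymm (j + 1) + a * s.esymm j := by
  simp [Multiset.esymm, Multiset.powersetCard_cons, Multiset.map_map,
    Multiset.sum_map_mul_left]

end Newton

/-! ### The Gårding cone and the derivatives of σ_k / σ_l -/

section Garding

/-- The Garding cone `Γ_k`. -/
def InGarding (k : ℕ) (s : Multiset ℝ) : Prop := ∀ j, 1 ≤ j → j ≤ k → 0 < s.esymm j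

theorem InGarding.pos {k : ℕ} {s : Multiset ℝ} (h : InGarding k s) {j : ℕ} (hj : j ≤ k) :
    0 < s.esymm j := by
  rcases Nat.eq_zero_or_pos j with rfl | h0
  · simp [esymm_zero']
  · exact h j h0 hj

/-- Let x, y, z be σ_j, σ_{j+1}, σ_{j+2} of t, with x > 0 and y ≤ 0. Multiplying z + ay > 0 by x and
y + ax > 0 by −y and adding eliminates a and leaves zx > y², against Newton's inequality. -/
theorem InGarding.of_cons {k : ℕ} {a : ℝ} {t : Multiset ℝ} (h : InGarding (k + 1) (a ::ₘ t)) :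
    InGarding k t := by
  have key : ∀ j, j ≤ k → 0 < t.esymm j := by
    intro j
    induction j with
    | zero => intro _; simp [esymm_zero']
    | succ j ih =>
      intro hj
      have h0 := ih (by omega)
      have h1 := h.pos (j := j + 1) (by omega)
      have h2 := h.pos (j := j + 2) (by omega)
      rw [esymm_cons_succ] at h1 h2
      by_contra! hc
      have hN := esymm_mul_esymm_le_sq t j
      set x := t.esymm j
      set y := t.esymm (j + 1)
      set z := t.esymm (j + 2)
      have h3 : 0 < (z + a * y) * x := mul_pos h2 h0
      have h4 : 0 ≤ (y + a * x) * (-y) := mul_nonneg h1.le (by linarith)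
      nlinarith
  exact fun j _ hj => key j hj

/-- The derivative of `σ_j` in the direction of a variable, in terms of the other variables. -/
def esymmDeriv (t : Multiset ℝ) : ℕ → ℝ
  | 0 => 0
  | j + 1 => t.esymm j

theorem esymm_cons (a : ℝ) (t : Multiset ℝ) (j : ℕ) :
    (a ::ₘ t).esymm j = t.esymm j + a * esymmDeriv t j := by
  cases j with
  | zero => simp [esymm_zero', esymmDeriv]
  | succ j => exact esymm_cons_succ a t j

/-- The ratios σ_{q+1}/σ_q decrease by Newton's inequality. The last function σ_{i+1} may have any
sign; this matters for a list from which one variable has been removed, since it lies only in the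
next larger cone. -/
theorem esymm_log_concave {s : Multiset ℝ} {i j : ℕ} (hji : j ≤ i)
    (h : ∀ q ≤ i, 0 < s.esymm q) :
    s.esymm (i + 1) * s.esymm j ≤ s.esymm i * s.esymm (j + 1) := by
  induction i, hji using Nat.le_induction with
  | base => rw [mul_comm]
  | succ i hji ih =>
    have ih := ih fun q hq => h q (by omega)
    have h1 := h i (by omega)
    have h2 := h (i + 1) le_rfl
    have h3 := h j (by omega)
    have hN := esymm_mul_esymm_le_sq s i
    refine le_of_mul_le_mul_left ?_ h1
    calc s.esymm i * (s.esymm (i + 1 + 1) * s.esymm j)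
        = (s.esymm i * s.esymm (i + 2)) * s.esymm j := by ring
      _ ≤ s.esymm (i + 1) ^ 2 * s.esymm j := by gcongr
      _ = s.esymm (i + 1) * (s.esymm (i + 1) * s.esymm j) := by ring
      _ ≤ s.esymm (i + 1) * (s.esymm i * s.esymm (j + 1)) := by gcongr
      _ = _ := by ring

/-- Monotonicity of the quotient `σ_k / σ_l` in the Garding cone. -/
theorem InGarding.quotient_mono {k l : ℕ} {a : ℝ} {t : Multiset ℝ} (h : InGarding k (a ::ₘ t))
    (hlk : l < k) :
    (a ::ₘ t).esymm k * esymmDeriv t l ≤ esymmDeriv t k * (a ::ₘ t).esymm l := by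
  obtain ⟨k, rfl⟩ : ∃ k', k = k' + 1 := ⟨k - 1, by omega⟩
  have ht := h.of_cons
  -- The terms that contain a cancel, and log-concavity for t remains.
  rw [esymm_cons, esymm_cons]
  cases l with
  | zero =>
    simp only [esymmDeriv, esymm_zero']
    linarith [ht.pos le_rfl]
  | succ l =>
    have := esymm_log_concave (s := t) (i := k) (j := l) (by omega) fun q hq => ht.pos hq
    simp only [esymmDeriv]
    linarith

/-- The numerator of the derivative of `σ_k / σ_l` in the direction of a variable. -/
def quotNum (k l : ℕ) (s t : Multiset ℝ) : ℝ :=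
  esymmDeriv t k * s.esymm l - s.esymm k * esymmDeriv t l

/-- The two derivatives differ by (b − a)(σ_{k−2}(t) σ_l(s) − σ_k(s) σ_{l−2}(t)), where s is the
full list. The sign of the bracket follows from `InGarding.quotient_mono`, used for s and for `b ::ₘ
t`, after cancelling σ_{l−1}(b ::ₘ t). No concavity of the quotient is involved. -/
theorem InGarding.quotNum_anti {k l : ℕ} {a b : ℝ} {t : Multiset ℝ}
    (h : InGarding k (a ::ₘ b ::ₘ t)) (hlk : l < k) (hk : 2 ≤ k) (hab : a ≤ b) :
    quotNum k l (a ::ₘ b ::ₘ t) (a ::ₘ t) ≤ quotNum k l (a ::ₘ b ::ₘ t) (b ::ₘ t) := by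
  obtain ⟨k, rfl⟩ : ∃ k', k = k' + 2 := ⟨k - 2, by omega⟩
  have h1 : InGarding (k + 1) (b ::ₘ t) := h.of_cons
  have h2 : InGarding k t := h1.of_cons
  have hd : ∀ j, esymmDeriv (b ::ₘ t) (j + 2) - esymmDeriv (a ::ₘ t) (j + 2)
      = (b - a) * t.esymm j := by
    intro j
    simp only [esymmDeriv, esymm_cons_succ]
    ring
  set s := a ::ₘ b ::ₘ t with hs
  suffices hq : 0 ≤ (b - a) * t.esymm k * s.esymm l
      - s.esymm (k + 2) * (esymmDeriv (b ::ₘ t) l - esymmDeriv (a ::ₘ t) l) by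
    rw [← hd k] at hq
    simp only [quotNum]
    linarith
  have hX := h2.pos (le_refl k)
  have hZ := h.pos (le_refl (k + 2))
  have hz := h.pos (le_of_lt hlk)
  rcases l with _ | _ | l
  · simp only [esymmDeriv, sub_zero, mul_zero]
    have : 0 ≤ b - a := by linarith
    positivity
  · simp only [esymmDeriv, zero_add, esymm_zero', sub_self, mul_zero, sub_zero]
    have : 0 ≤ b - a := by linarith
    positivity
  · rw [hd l]
    have hx := h2.pos (j := l) (by omega)
    have hy := h1.pos (j := l + 1) (by omega)
    have q1 := h.quotient_mono hlk
    have q2 := h1.quotient_mono (l := l + 1) (by omega)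
    simp only [esymmDeriv] at q1 q2
    have : s.esymm (k + 2) * t.esymm l ≤ t.esymm k * s.esymm (l + 2) := by
      refine le_of_mul_le_mul_left ?_ hy
      calc (b ::ₘ t).esymm (l + 1) * (s.esymm (k + 2) * t.esymm l)
          = (s.esymm (k + 2) * (b ::ₘ t).esymm (l + 1)) * t.esymm l := by ring
        _ ≤ ((b ::ₘ t).esymm (k + 1) * s.esymm (l + 2)) * t.esymm l := by gcongr
        _ = ((b ::ₘ t).esymm (k + 1) * t.esymm l) * s.esymm (l + 2) := by ring
        _ ≤ (t.esymm k * (b ::ₘ t).esymm (l + 1)) * s.esymm (l + 2) := by gcongr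
        _ = _ := by ring
    have := mul_le_mul_of_nonneg_left this (sub_nonneg.2 hab)
    simp only [add_assoc, Nat.reduceAdd] at *
    linarith

/-- Log-concavity of σ_j divided by its binomial coefficient, denominators cleared. The exact
constants are indispensable in `le_sum_quotGrad`. -/
theorem esymm_newton_chain {s : Multiset ℝ} {n i j : ℕ} (hn : Multiset.card s = n) (hji : j ≤ i)
    (hin : i < n) (h : ∀ q ≤ i, 0 < s.esymm q) :
    ((i : ℝ) + 1) * (n - j) * (s.esymm (i + 1) * s.esymm j)
      ≤ (j + 1) * (n - i) * (s.esymm i * s.esymm (j + 1)) := by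
  induction i, hji using Nat.le_induction with
  | base => linarith
  | succ i hji ih =>
    have ih := ih (by omega) fun q hq => h q (by omega)
    have h1 := h i (by omega)
    have h2 := h (i + 1) le_rfl
    have h3 := h j (by omega)
    obtain ⟨m, rfl⟩ : ∃ m, n = m + (i + 2) := ⟨n - (i + 2), by omega⟩
    have hN := newton_esymm s hn
    push_cast at ih ⊢
    have e1 : (m : ℝ) + (i + 2) - i = m + 2 := by ring
    have e2 : (m : ℝ) + (i + 2) - (i + 1) = m + 1 := by ring
    have e3 : (0 : ℝ) ≤ (m : ℝ) + (i + 2) - j := by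
      have : (j : ℝ) ≤ i := by exact_mod_cast hji
      have : (0 : ℝ) ≤ m := by positivity
      linarith
    rw [e1] at ih
    rw [e2]
    set c : ℝ := (m : ℝ) + (i + 2) - j
    have hm : (0 : ℝ) < (m : ℝ) + 2 := by positivity
    refine le_of_mul_le_mul_left ?_ (mul_pos hm h1)
    calc (((m : ℝ) + 2) * s.esymm i) * (((i : ℝ) + 1 + 1) * c * (s.esymm (i + 1 + 1) * s.esymm j))
        = (((i : ℝ) + 2) * (m + 2) * (s.esymm i * s.esymm (i + 2))) * (c * s.esymm j) := by ring
      _ ≤ (((i : ℝ) + 1) * (m + 1) * s.esymm (i + 1) ^ 2) * (c * s.esymm j) := by gcongr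
      _ = (((i : ℝ) + 1) * c * (s.esymm (i + 1) * s.esymm j)) * ((m + 1) * s.esymm (i + 1)) := by
          ring
      _ ≤ ((j + 1) * (m + 2) * (s.esymm i * s.esymm (j + 1))) * ((m + 1) * s.esymm (i + 1)) := by
          gcongr
      _ = _ := by ring

/-- The ratio σ_{k+1}/σ_k is at most each of the d + 1 ratios σ_{q+1}/σ_q with k − d ≤ q ≤ k, and
the product of these telescopes to σ_{k+1}/σ_{k−d}. -/
theorem InGarding.pow_ratio_le {s : Multiset ℝ} {k : ℕ} (h : InGarding (k + 1) s) (d : ℕ)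
    (hd : d ≤ k) :
    s.esymm (k + 1) ^ (d + 1) * s.esymm (k - d) ≤ s.esymm (k + 1) * s.esymm k ^ (d + 1) := by
  induction d with
  | zero => simp
  | succ d ih =>
    have ih := ih (by omega)
    have hlc := esymm_log_concave (s := s) (i := k) (j := k - (d + 1)) (by omega)
      fun q hq => h.pos (by omega)
    rw [show k - (d + 1) + 1 = k - d by omega] at hlc
    have h1 := h.pos (le_refl (k + 1))
    have h2 := h.pos (j := k) (by omega)
    calc s.esymm (k + 1) ^ (d + 1 + 1) * s.esymm (k - (d + 1))
        = s.esymm (k + 1) ^ (d + 1) * (s.esymm (k + 1) * s.esymm (k - (d + 1))) := by ring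
      _ ≤ s.esymm (k + 1) ^ (d + 1) * (s.esymm k * s.esymm (k - d)) := by gcongr
      _ = (s.esymm (k + 1) ^ (d + 1) * s.esymm (k - d)) * s.esymm k := by ring
      _ ≤ (s.esymm (k + 1) * s.esymm k ^ (d + 1)) * s.esymm k := by gcongr
      _ = _ := by ring

variable {n : ℕ}

/-- The values of `μ` as a multiset. -/
def vals (μ : Fin n → ℝ) : Multiset ℝ := Finset.univ.val.map μ

/-- The values of `μ` away from the index `i`. -/
def valsErase (μ : Fin n → ℝ) (i : Fin n) : Multiset ℝ := (Finset.univ.erase i).val.map μ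

theorem vals_eq_cons (μ : Fin n → ℝ) (i : Fin n) : vals μ = μ i ::ₘ valsErase μ i := by
  rw [vals, valsErase, ← Multiset.map_cons, ← Finset.insert_val_of_notMem (by simp),
    Finset.insert_erase (Finset.mem_univ i)]

theorem card_vals (μ : Fin n → ℝ) : Multiset.card (vals μ) = n := by simp [vals]

theorem card_valsErase (μ : Fin n → ℝ) (i : Fin n) : Multiset.card (valsErase μ i) = n - 1 := by
  simp [valsErase]

theorem valsErase_eq_cons (μ : Fin n → ℝ) {i j : Fin n} (h : j ≠ i) :
    valsErase μ i = μ j ::ₘ ((Finset.univ.erase i).erase j).val.map μ := by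
  rw [valsErase, ← Multiset.map_cons, ← Finset.insert_val_of_notMem (by simp),
    Finset.insert_erase (by simp [h])]

/-- The derivative of ∏ (X + μ_i) is the sum of the products with one factor removed; coefficients
are compared. For j ≥ n both sides vanish. -/
theorem sum_esymm_valsErase (μ : Fin n → ℝ) (j : ℕ) :
    ∑ i, (valsErase μ i).esymm j = ((n : ℝ) - j) * (vals μ).esymm j := by
  rcases lt_or_ge j n with hj | hj
  · have hP := Polynomial.derivative_prod_finset (s := Finset.univ)
      (f := fun i : Fin n => (Polynomial.X + Polynomial.C (μ i) : Polynomial ℝ))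
    simp only [Polynomial.derivative_add, Polynomial.derivative_X, Polynomial.derivative_C,
      add_zero, mul_one] at hP
    have hc := congrArg (fun p => p.coeff (n - 1 - j)) hP
    simp only [Polynomial.coeff_derivative, Polynomial.finset_sum_coeff] at hc
    have h1 : ∀ i, (∏ x ∈ Finset.univ.erase i,
        (Polynomial.X + Polynomial.C (μ x) : Polynomial ℝ)).coeff (n - 1 - j)
        = (valsErase μ i).esymm j := by
      intro i
      have := Multiset.prod_X_add_C_coeff (valsErase μ i) (k := n - 1 - j)
        (by rw [card_valsErase]; omega)
      rw [card_valsErase, show n - 1 - (n - 1 - j) = j by omega] at this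
      rw [← this, valsErase, Multiset.map_map]
      rfl
    have h2 : (∏ x, (Polynomial.X + Polynomial.C (μ x) : Polynomial ℝ)).coeff (n - 1 - j + 1)
        = (vals μ).esymm j := by
      have := Multiset.prod_X_add_C_coeff (vals μ) (k := n - 1 - j + 1)
        (by rw [card_vals]; omega)
      rw [card_vals, show n - (n - 1 - j + 1) = j by omega] at this
      rw [← this, vals, Multiset.map_map]
      rfl
    simp only [h1, h2] at hc
    rw [← hc, mul_comm]
    congr 1
    have : n - 1 - j + 1 = n - j := by omega
    have h3 : ((n - 1 - j : ℕ) : ℝ) + 1 = ((n - j : ℕ) : ℝ) := by rw [← this]; push_cast; ring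
    rw [h3, Nat.cast_sub hj.le]
  · have : ∀ i, (valsErase μ i).esymm j = 0 := fun i =>
      esymm_eq_zero_of_card_lt _ (by rw [card_valsErase]; have := i.2; omega)
    simp only [this, Finset.sum_const_zero]
    rcases hj.eq_or_lt with rfl | hj
    · simp
    · rw [esymm_eq_zero_of_card_lt _ (by rw [card_vals]; exact hj), mul_zero]

theorem sum_esymmDeriv (μ : Fin n → ℝ) (j : ℕ) :
    ∑ i, esymmDeriv (valsErase μ i) (j + 1) = ((n : ℝ) - j) * (vals μ).esymm j :=
  sum_esymm_valsErase μ j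

/-- Euler's identity for a homogeneous polynomial of degree j. -/
theorem sum_mul_esymmDeriv (μ : Fin n → ℝ) (j : ℕ) :
    ∑ i, μ i * esymmDeriv (valsErase μ i) j = j * (vals μ).esymm j := by
  have h : ∀ i, μ i * esymmDeriv (valsErase μ i) j
      = (vals μ).esymm j - (valsErase μ i).esymm j := by
    intro i
    rw [vals_eq_cons μ i, esymm_cons]
    ring
  simp only [h, Finset.sum_sub_distrib, sum_esymm_valsErase]
  simp
  ring

/-- The numerator of `∂_i (σ_k / σ_l)` at `μ`. -/
def quotGrad (k l : ℕ) (μ : Fin n → ℝ) (i : Fin n) : ℝ := quotNum k l (vals μ) (valsErase μ i)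

variable {k l : ℕ} {μ : Fin n → ℝ}

theorem quotGrad_nonneg (h : InGarding k (vals μ)) (hlk : l < k) (i : Fin n) :
    0 ≤ quotGrad k l μ i := by
  rw [vals_eq_cons μ i] at h
  have := h.quotient_mono hlk
  rw [quotGrad, vals_eq_cons μ i, quotNum]
  linarith

theorem quotGrad_anti (h : InGarding k (vals μ)) (hlk : l < k) (hk : 2 ≤ k) {i j : Fin n}
    (hij : μ i ≤ μ j) : quotGrad k l μ j ≤ quotGrad k l μ i := by
  rcases eq_or_ne i j with rfl | hne
  · rfl
  have e1 := vals_eq_cons μ i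
  rw [valsErase_eq_cons μ hne.symm] at e1
  have e2 : valsErase μ j = μ i ::ₘ ((Finset.univ.erase i).erase j).val.map μ := by
    rw [valsErase_eq_cons μ hne, Finset.erase_right_comm]
  rw [e1] at h
  have := h.quotNum_anti hlk hk hij
  rw [quotGrad, quotGrad, e1, e2, valsErase_eq_cons μ hne.symm]
  exact this

theorem sum_mul_quotGrad (k l : ℕ) (μ : Fin n → ℝ) :
    ∑ i, μ i * quotGrad k l μ i = ((k : ℝ) - l) * ((vals μ).esymm k * (vals μ).esymm l) := by
  have : ∀ i, μ i * quotGrad k l μ i = (μ i * esymmDeriv (valsErase μ i) k) * (vals μ).esymm l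
      - (vals μ).esymm k * (μ i * esymmDeriv (valsErase μ i) l) := by
    intro i; rw [quotGrad, quotNum]; ring
  simp only [this, Finset.sum_sub_distrib, ← Finset.sum_mul, ← Finset.mul_sum, sum_mul_esymmDeriv]
  ring

/-- The subtracted term σ_{k+1} ∑ ∂_i σ_l uses up at most the fraction l/(k+1) of (n − k) σ_k σ_l,
by Newton's inequalities with exact constants, so a definite multiple of σ_k σ_l survives. -/
theorem le_sum_quotGrad (h : InGarding (k + 1) (vals μ)) (hlk : l ≤ k) (hkn : k < n) :
    (vals μ).esymm k * (vals μ).esymm l ≤ (k + 1) * ∑ i, quotGrad (k + 1) l μ i := by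
  have hsum : ∑ i, quotGrad (k + 1) l μ i
      = (((n : ℝ) - k) * (vals μ).esymm k) * (vals μ).esymm l
        - (vals μ).esymm (k + 1) * ∑ i, esymmDeriv (valsErase μ i) l := by
    simp only [quotGrad, quotNum, Finset.sum_sub_distrib, ← Finset.sum_mul, ← Finset.mul_sum,
      sum_esymmDeriv]
  have hk := h.pos (j := k) (by omega)
  have hl := h.pos (j := l) (by omega)
  have hnk : (1 : ℝ) ≤ (n : ℝ) - k := by
    have : ((k + 1 : ℕ) : ℝ) ≤ n := by exact_mod_cast hkn
    push_cast at this; linarith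
  have hp := mul_pos hk hl
  rw [hsum]
  cases l with
  | zero =>
    simp only [esymmDeriv, Finset.sum_const_zero, mul_zero, sub_zero]
    have : (0 : ℝ) ≤ k := by positivity
    nlinarith [mul_le_mul_of_nonneg_right hnk hp.le, mul_nonneg this hp.le]
  | succ l =>
    rw [sum_esymmDeriv]
    have hN := esymm_newton_chain (card_vals μ) (i := k) (j := l) (by omega) hkn
      fun q hq => h.pos (by omega)
    have hlk' : (l : ℝ) + 1 ≤ k := by exact_mod_cast hlk
    set P := (vals μ).esymm k * (vals μ).esymm (l + 1)
    have h1 : P ≤ ((n : ℝ) - k) * P * ((k + 1) - (l + 1)) := by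
      have : 1 ≤ ((n : ℝ) - k) * ((k + 1) - (l + 1)) := by nlinarith
      nlinarith
    calc P ≤ ((n : ℝ) - k) * P * ((k + 1) - (l + 1)) := h1
      _ = (k + 1) * (((n : ℝ) - k) * P) - (l + 1) * (n - k) * P := by ring
      _ ≤ (k + 1) * (((n : ℝ) - k) * P)
          - ((k : ℝ) + 1) * (n - l) * ((vals μ).esymm (k + 1) * (vals μ).esymm l) := by linarith
      _ = _ := by simp only [P]; ring

/-- If μ_i were the strict minimum, then nμ_i ≤ ∑ μ_j = (n − 1)∑ b_j, while b_i ≤ 0 gives μ_i ≥ ∑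
b_j > 0. So some other μ_j is at most μ_i, its derivative is at least that of μ_i, and the latter is
at most half of the sum. This is the gain from working with η instead of h. -/
theorem sum_quotGrad_le (h : InGarding k (vals μ)) (hlk : l < k) (hk : 2 ≤ k) {b : Fin n → ℝ}
    (hb : ∀ i, μ i = ∑ j, b j - b i) {i : Fin n} (hi : b i ≤ 0) :
    ∑ j, quotGrad k l μ j ≤ 2 * (∑ j, quotGrad k l μ j - quotGrad k l μ i) := by
  obtain ⟨j, hji, hj⟩ : ∃ j, j ≠ i ∧ μ j ≤ μ i := by
    by_contra! hc
    have hs : ∑ j, μ j = ((n : ℝ) - 1) * ∑ j, b j := by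
      simp only [hb, Finset.sum_sub_distrib]
      simp; ring
    have h1 : (vals μ).esymm 1 = ∑ j, μ j := by
      have := sum_mul_esymmDeriv μ 1
      simpa [esymmDeriv, esymm_zero'] using this.symm
    have h2 := h.pos (j := 1) (by omega)
    rw [h1] at h2
    have h3 : ∑ j : Fin n, μ i ≤ ∑ j, μ j := Finset.sum_le_sum fun j _ => by
      rcases eq_or_ne j i with rfl | hne
      · rfl
      · exact (hc j hne).le
    simp only [Finset.sum_const, Finset.card_univ, Fintype.card_fin, nsmul_eq_mul] at h3
    have hn : (1 : ℝ) ≤ n := by exact_mod_cast (by have := i.2; omega : 1 ≤ n)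
    rw [hs] at h2 h3
    have hH : 0 < ∑ j, b j := by
      by_contra! hH
      nlinarith
    rw [hb i] at h3
    nlinarith
  have h1 := quotGrad_anti h hlk hk hj
  have h2 : quotGrad k l μ j ≤ ∑ j, quotGrad k l μ j - quotGrad k l μ i := by
    rw [← Finset.sum_erase_eq_sub (Finset.mem_univ i)]
    exact Finset.single_le_sum (f := fun j => quotGrad k l μ j)
      (fun q _ => quotGrad_nonneg h hlk q) (by simp [hji])
  linarith

/-- By `InGarding.pow_ratio_le` the power (σ_{k+1}/σ_k)^{k+1−l} is at most σ_{k+1}/σ_l = s^{k+1−l}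
f, and f ≤ K ≤ K^{k+1−l} since K ≥ 1. Hence σ_{k+1} ≤ sKσ_k, and inserting the equation for σ_{k+1}
bounds σ_k from below by σ_l. -/
theorem esymm_pred_lower_bound (h : InGarding (k + 1) (vals μ)) (hlk : l ≤ k) {s f m K : ℝ}
    (hs : 0 < s) (hf : m ≤ f) (hfK : f ≤ K) (hK : 1 ≤ K)
    (heq : (vals μ).esymm (k + 1) = s ^ (k + 1 - l) * f * (vals μ).esymm l) :
    s ^ (k - l) * m * (vals μ).esymm l ≤ K * (vals μ).esymm k := by
  have h1 := h.pos (le_refl (k + 1))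
  have h2 := h.pos (j := k) (by omega)
  have h3 := h.pos (j := l) (by omega)
  have hr := h.pow_ratio_le (k - l) (by omega)
  rw [show k - (k - l) = l by omega, show k - l + 1 = k + 1 - l by omega] at hr
  set a := (vals μ).esymm (k + 1)
  set b := (vals μ).esymm k
  set c := (vals μ).esymm l
  have hq : a ^ (k + 1 - l) ≤ (s * K * b) ^ (k + 1 - l) := by
    refine le_of_mul_le_mul_right (hr.trans ?_) h3
    rw [heq]
    have : f ≤ K ^ (k + 1 - l) := hfK.trans (le_self_pow₀ hK (by omega))
    calc s ^ (k + 1 - l) * f * c * b ^ (k + 1 - l)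
        ≤ s ^ (k + 1 - l) * K ^ (k + 1 - l) * c * b ^ (k + 1 - l) := by gcongr
      _ = _ := by rw [mul_pow, mul_pow]; ring
  have hab : a ≤ s * K * b := le_of_pow_le_pow_left₀ (by omega) (by positivity) hq
  rw [heq, show k + 1 - l = (k - l) + 1 by omega, pow_succ] at hab
  refine le_of_mul_le_mul_left ?_ hs
  calc s * (s ^ (k - l) * m * c) = s ^ (k - l) * s * m * c := by ring
    _ ≤ s ^ (k - l) * s * f * c := by gcongr
    _ ≤ s * K * b := hab
    _ = _ := by ring

end Garding

/-! ### Eigenvalues of tr b − b and their derivatives along curves of matrices -/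

section MatrixLemmas

open Matrix

variable {n : ℕ}

/-- Diagonalise P orthogonally and divide by the square roots of its eigenvalues; then diagonalise
the transformed S orthogonally, which leaves the identity unchanged. -/
theorem exists_simultaneous_diagonal {P S : Matrix (Fin n) (Fin n) ℝ} (hP : P.PosDef)
    (hS : Sᵀ = S) : ∃ (Q : Matrix (Fin n) (Fin n) ℝ) (d : Fin n → ℝ),
      Qᵀ * P * Q = 1 ∧ Qᵀ * S * Q = diagonal d := by
  have hU := hP.isHermitian.spectral_theorem
  rw [Unitary.conjStarAlgAut_apply] at hU
  set U : Matrix (Fin n) (Fin n) ℝ := (hP.isHermitian.eigenvectorUnitary).1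
  have hUU : star U * U = 1 := Unitary.coe_star_mul_self _
  set e := hP.isHermitian.eigenvalues
  have he : ∀ i, 0 < e i := hP.eigenvalues_pos
  have hstar : ∀ A : Matrix (Fin n) (Fin n) ℝ, star A = Aᵀ := fun A => by
    rw [star_eq_conjTranspose, conjTranspose_eq_transpose_of_trivial]
  rw [hstar] at hUU
  have hPU : P = U * diagonal e * Uᵀ := by
    rw [← hstar]; exact hU
  set W := U * diagonal fun i => (√(e i))⁻¹ with hW
  have hWP : Wᵀ * P * W = 1 := by
    have : Wᵀ * P * W = diagonal (fun i => (√(e i))⁻¹) * ((Uᵀ * U) * diagonal e * (Uᵀ * U)) *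
        diagonal (fun i => (√(e i))⁻¹) := by
      rw [hPU, hW, transpose_mul, diagonal_transpose]
      simp only [Matrix.mul_assoc]
    rw [this, hUU, Matrix.one_mul, Matrix.mul_one, diagonal_mul_diagonal, diagonal_mul_diagonal,
      ← diagonal_one]
    congr 1
    ext i
    have := Real.mul_self_sqrt (he i).le
    have h0 := Real.sqrt_pos.2 (he i)
    field_simp
    simp [pow_two, this]
  have hS' : (Wᵀ * S * W).IsHermitian := by
    rw [IsHermitian, conjTranspose_eq_transpose_of_trivial]
    simp only [transpose_mul, transpose_transpose, hS, Matrix.mul_assoc]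
  have hV := hS'.spectral_theorem
  rw [Unitary.conjStarAlgAut_apply] at hV
  set V : Matrix (Fin n) (Fin n) ℝ := (hS'.eigenvectorUnitary).1
  have hVV : star V * V = 1 := Unitary.coe_star_mul_self _
  rw [hstar] at hVV
  set d := hS'.eigenvalues
  have hVS : Wᵀ * S * W = V * diagonal d * Vᵀ := by
    have := hV; rw [hstar] at this; exact this
  refine ⟨W * V, d, ?_, ?_⟩
  · rw [transpose_mul]
    calc Vᵀ * Wᵀ * P * (W * V) = Vᵀ * (Wᵀ * P * W) * V := by simp only [Matrix.mul_assoc]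
      _ = 1 := by rw [hWP, Matrix.mul_one, hVV]
  · rw [transpose_mul]
    calc Vᵀ * Wᵀ * S * (W * V) = Vᵀ * (Wᵀ * S * W) * V := by simp only [Matrix.mul_assoc]
      _ = (Vᵀ * V) * diagonal d * (Vᵀ * V) := by
        rw [hVS]; simp only [Matrix.mul_assoc]
      _ = _ := by rw [hVV, Matrix.one_mul, Matrix.mul_one]

/-- A permutation other than the identity moves at least two indices, so an off-diagonal zero is
left after one factor has been differentiated. -/
theorem hasDerivAt_det_of_diagonal {A : ℝ → Matrix (Fin n) (Fin n) ℝ}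
    {A' : Matrix (Fin n) (Fin n) ℝ} {d : Fin n → ℝ} {x : ℝ} (hd : A x = diagonal d)
    (hA : ∀ i j, HasDerivAt (fun t => A t i j) (A' i j) x) :
    HasDerivAt (fun t => (A t).det) (∑ i, A' i i * ∏ j ∈ Finset.univ.erase i, d j) x := by
  have h1 : HasDerivAt (fun t => (A t).det) (∑ σ : Equiv.Perm (Fin n),
      ((Equiv.Perm.sign σ : ℤ) : ℝ) *
        ∑ i, (∏ j ∈ Finset.univ.erase i, A x (σ j) j) * A' (σ i) i) x := by
    simp only [det_apply']
    refine HasDerivAt.fun_sum fun σ _ => HasDerivAt.const_mul _ ?_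
    have := HasDerivAt.fun_finsetProd (u := Finset.univ) (f := fun i t => A t (σ i) i)
      (f' := fun i => A' (σ i) i) (x := x) fun i _ => hA (σ i) i
    simpa using this
  refine h1.congr_deriv ?_
  rw [Finset.sum_eq_single 1]
  · simp [hd, mul_comm]
  · intro σ _ hσ
    rw [Finset.sum_eq_zero, mul_zero]
    intro i _
    obtain ⟨j, hji, hj⟩ : ∃ j, j ≠ i ∧ σ j ≠ j := by
      by_contra! hc
      refine hσ (Equiv.ext fun j => ?_)
      by_cases hj : j = i
      · subst hj
        by_contra hne
        have := hc (σ j) hne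
        exact hne (σ.injective this)
      · exact hc j hj
    rw [Finset.prod_eq_zero (i := j) (by simp [hji]) (by simp [hd, hj]), zero_mul]
  · simp

-- A polynomial of degree at most n is determined by its values at 0, …, n. By Lagrange
-- interpolation each coefficient is a fixed linear combination of the values det(s − A), and these
-- can be differentiated.
open Polynomial in
theorem hasDerivAt_charpoly_coeff_of_diagonal {A : ℝ → Matrix (Fin n) (Fin n) ℝ}
    {A' : Matrix (Fin n) (Fin n) ℝ} {d : Fin n → ℝ} {x : ℝ} (hd : A x = diagonal d)
    (hA : ∀ i j, HasDerivAt (fun t => A t i j) (A' i j) x) (m : ℕ) :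
    HasDerivAt (fun t => (A t).charpoly.coeff m)
      (∑ i, -(A' i i) * (∏ j ∈ Finset.univ.erase i, (X - C (d j))).coeff m) x := by
  have hinj : Set.InjOn (fun i : ℕ => (i : ℝ)) (Finset.range (n + 1)) :=
    fun a _ b _ h => Nat.cast_injective h
  have hrep : ∀ p : ℝ[X], p.degree < n + 1 → p.coeff m = ∑ i ∈ Finset.range (n + 1),
      p.eval (i : ℝ) * (Lagrange.basis (Finset.range (n + 1)) (fun i : ℕ => (i : ℝ)) i).coeff m := by
    intro p hp
    conv_lhs => rw [Lagrange.eq_interpolate hinj (f := p) (by simpa using hp),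
      Lagrange.interpolate_apply]
    simp [finsetSum_coeff]
  have hdet : ∀ s : ℝ, HasDerivAt (fun t => (A t).charpoly.eval s)
      (∑ i, -(A' i i) * ∏ j ∈ Finset.univ.erase i, (s - d j)) x := by
    intro s
    simp only [eval_charpoly]
    refine hasDerivAt_det_of_diagonal (A := fun t => scalar (Fin n) s - A t) (A' := -A')
      (d := fun i => s - d i) ?_ ?_
    · rw [hd, scalar_apply, diagonal_sub]
    · intro i j
      simpa using (hA i j).const_sub (scalar (Fin n) s i j)
  have hlt : ∀ t, (A t).charpoly.degree < n + 1 := fun t => by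
    rw [charpoly_degree_eq_dim, Fintype.card_fin]; exact_mod_cast Nat.lt_succ_self n
  have hfun : (fun t => (A t).charpoly.coeff m) = fun t => ∑ i ∈ Finset.range (n + 1),
      (A t).charpoly.eval (i : ℝ) *
        (Lagrange.basis (Finset.range (n + 1)) (fun i : ℕ => (i : ℝ)) i).coeff m :=
    funext fun t => hrep _ (hlt t)
  rw [hfun]
  have h2 : HasDerivAt (fun t => ∑ i ∈ Finset.range (n + 1),
      (A t).charpoly.eval (i : ℝ) *
        (Lagrange.basis (Finset.range (n + 1)) (fun i : ℕ => (i : ℝ)) i).coeff m) _ x :=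
    HasDerivAt.fun_sum fun i _ => (hdet i).mul_const _
  refine h2.congr_deriv ?_
  have hq : ∀ i : Fin n, (∏ j ∈ Finset.univ.erase i, (X - C (d j)) : ℝ[X]).degree < (n : WithBot ℕ) + 1 := by
    intro i
    rw [degree_prod]
    simp only [degree_X_sub_C, Finset.sum_const, Finset.card_erase_of_mem (Finset.mem_univ i),
      Finset.card_univ, Fintype.card_fin, nsmul_eq_mul, mul_one]
    exact_mod_cast (by omega : n - 1 < n + 1)
  simp only [hrep _ (hq _), Finset.sum_mul, Finset.mul_sum, eval_prod, eval_sub, eval_X, eval_C]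
  rw [Finset.sum_comm]
  exact Finset.sum_congr rfl fun i _ => Finset.sum_congr rfl fun j _ => by ring

theorem sigmaEig_diagonal (j : ℕ) (d : Fin n → ℝ) :
    sigmaEig j (diagonal d) = (vals d).esymm j := by
  rw [sigmaEig, charpoly_diagonal, Polynomial.roots_prod]
  · simp [vals]
  · simp [Finset.prod_ne_zero_iff, Polynomial.X_sub_C_ne_zero]

theorem charpoly_conj {Q R A : Matrix (Fin n) (Fin n) ℝ} (h : R * Q = 1) :
    (Q * A * R).charpoly = A.charpoly := by
  rw [Matrix.mul_assoc, charpoly_mul_comm, Matrix.mul_assoc, h, Matrix.mul_one]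

theorem sigmaEig_conj {Q R A : Matrix (Fin n) (Fin n) ℝ} (h : R * Q = 1) (j : ℕ) :
    sigmaEig j (Q * A * R) = sigmaEig j A := by
  rw [sigmaEig, charpoly_conj h, sigmaEig]

/-- `σ_j` as a coefficient of the characteristic polynomial. -/
def sigmaCoeff (j : ℕ) (A : Matrix (Fin n) (Fin n) ℝ) : ℝ := (-1) ^ j * A.charpoly.coeff (n - j)

/-- Real roots account for all eigenvalues only if the characteristic polynomial splits. Vieta's
formula then trades the roots for a coefficient, which is differentiable even where eigenvalues
collide. -/
theorem sigmaEig_eq_sigmaCoeff {A : Matrix (Fin n) (Fin n) ℝ} (hA : A.charpoly.Splits) {j : ℕ}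
    (hj : j ≤ n) : sigmaEig j A = sigmaCoeff j A := by
  have hdeg : A.charpoly.natDegree = n := by
    rw [charpoly_natDegree_eq_dim, Fintype.card_fin]
  rw [sigmaCoeff, Polynomial.coeff_eq_esymm_roots_of_splits hA (by rw [hdeg]; omega), hdeg,
    A.charpoly_monic.leadingCoeff, show n - (n - j) = j by omega, sigmaEig, one_mul, ← mul_assoc,
    ← pow_add, Even.neg_one_pow (by simp), one_mul]

theorem hasDerivAt_sigmaCoeff_of_diagonal {A : ℝ → Matrix (Fin n) (Fin n) ℝ}
    {A' : Matrix (Fin n) (Fin n) ℝ} {d : Fin n → ℝ} {x : ℝ} (hd : A x = diagonal d)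
    (hA : ∀ i j, HasDerivAt (fun t => A t i j) (A' i j) x) {j : ℕ} (hj : j ≤ n) :
    HasDerivAt (fun t => sigmaCoeff j (A t))
      (∑ i, A' i i * esymmDeriv (valsErase d i) j) x := by
  refine ((hasDerivAt_charpoly_coeff_of_diagonal hd hA (n - j)).const_mul ((-1) ^ j)).congr_deriv ?_
  rw [Finset.mul_sum]
  refine Finset.sum_congr rfl fun i _ => ?_
  have hn : 0 < n := i.pos
  have hm : (∏ j ∈ Finset.univ.erase i, (Polynomial.X - Polynomial.C (d j)))
      = ((valsErase d i).map fun a => Polynomial.X - Polynomial.C a).prod := by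
    rw [valsErase, Multiset.map_map]; rfl
  rw [hm]
  cases j with
  | zero =>
    rw [Polynomial.coeff_eq_zero_of_natDegree_lt]
    · simp [esymmDeriv]
    · rw [Polynomial.natDegree_multiset_prod_X_sub_C_eq_card, card_valsErase]; omega
  | succ j =>
    rw [Multiset.prod_X_sub_C_coeff _ (by rw [card_valsErase]; omega), card_valsErase,
      show n - 1 - (n - (j + 1)) = j by omega, esymmDeriv, pow_succ]
    have : ((-1 : ℝ) ^ j) * (-1) ^ j = 1 := by rw [← pow_add, Even.neg_one_pow (by simp)]
    linear_combination (A' i i * (valsErase d i).esymm j) * this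

/-- The matrix `ℓ - P⁻¹ S`. -/
def shapeMat (P S : Matrix (Fin n) (Fin n) ℝ) (c : ℝ) : Matrix (Fin n) (Fin n) ℝ :=
  c • 1 - P⁻¹ * S

/-- The matrix `tr b - b` with `b = ℓ - P⁻¹ S`. -/
def etaMat (P S : Matrix (Fin n) (Fin n) ℝ) (c : ℝ) : Matrix (Fin n) (Fin n) ℝ :=
  (shapeMat P S c).trace • 1 - shapeMat P S c

/-- P⁻¹S need not be symmetric, but a basis that is orthonormal for P and diagonalises S also
diagonalises P⁻¹S and every affine expression in it. -/
theorem exists_etaMat_diagonal {P S : Matrix (Fin n) (Fin n) ℝ} (hP : P.PosDef)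
    (hS : Sᵀ = S) (c : ℝ) : ∃ (Q R : Matrix (Fin n) (Fin n) ℝ) (d : Fin n → ℝ), R * Q = 1 ∧
      etaMat P S c = Q * diagonal d * R := by
  obtain ⟨Q, d, h1, h2⟩ := exists_simultaneous_diagonal hP hS
  have hR : (Qᵀ * P) * Q = 1 := h1
  have hQR : Q * (Qᵀ * P) = 1 := mul_eq_one_comm.1 hR
  have hinv : P⁻¹ = Q * Qᵀ := inv_eq_left_inv (by rw [Matrix.mul_assoc, hQR])
  have hPS : P⁻¹ * S = Q * diagonal d * (Qᵀ * P) := by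
    rw [← h2, hinv]
    calc Q * Qᵀ * S = Q * Qᵀ * S * (Q * (Qᵀ * P)) := by rw [hQR, Matrix.mul_one]
      _ = _ := by simp only [Matrix.mul_assoc]
  have hone : ∀ a : ℝ, a • (1 : Matrix (Fin n) (Fin n) ℝ)
      = Q * diagonal (fun _ => a) * (Qᵀ * P) := by
    intro a
    have : diagonal (fun _ : Fin n => a) = a • (1 : Matrix (Fin n) (Fin n) ℝ) := by
      rw [smul_one_eq_diagonal]
    rw [this, Matrix.mul_smul, Matrix.smul_mul, Matrix.mul_one, hQR]
  refine ⟨Q, Qᵀ * P, fun i => (shapeMat P S c).trace - (c - d i), hR, ?_⟩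
  rw [etaMat]
  conv_lhs => enter [2]; rw [shapeMat, hPS]
  rw [hone c, hone, ← Matrix.sub_mul, ← Matrix.mul_sub, ← Matrix.sub_mul, ← Matrix.mul_sub,
    diagonal_sub, diagonal_sub]

theorem splits_charpoly_etaMat {P S : Matrix (Fin n) (Fin n) ℝ} (hP : P.PosDef)
    (hS : Sᵀ = S) (c : ℝ) : (etaMat P S c).charpoly.Splits := by
  obtain ⟨Q, R, d, h1, h2⟩ := exists_etaMat_diagonal hP hS c
  rw [h2, charpoly_conj h1, charpoly_diagonal]
  exact Polynomial.Splits.prod fun i _ => Polynomial.Splits.X_sub_C _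

theorem sigmaEig_smul_etaMat {P S : Matrix (Fin n) (Fin n) ℝ} (hP : P.PosDef)
    (hS : Sᵀ = S) (c a : ℝ) (j : ℕ) :
    sigmaEig j (a • etaMat P S c) = a ^ j * sigmaEig j (etaMat P S c) := by
  obtain ⟨Q, R, d, h1, h2⟩ := exists_etaMat_diagonal hP hS c
  have h3 : a • etaMat P S c = Q * diagonal (a • d) * R := by
    rw [h2, diagonal_smul, Matrix.mul_smul, Matrix.smul_mul]
  rw [h3, h2, sigmaEig_conj h1, sigmaEig_conj h1, sigmaEig_diagonal, sigmaEig_diagonal]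
  have := Multiset.pow_smul_esymm a j (vals d)
  rw [smul_eq_mul] at this
  rw [this]
  simp [vals, Function.comp_def]

/-- The matrix depends on g and h only through g⁻¹h. A congruence of the two forms acts on it as a
similarity, and the two scale factors enter through their quotient. -/
theorem eta_conj {P S R g h : Matrix (Fin n) (Fin n) ℝ} {c c₁ c₂ : ℝ} (hP : P.PosDef)
    (hR : IsUnit R.det) (hc₁ : c₁ ≠ 0) (hg : Rᵀ * g * R = c₁ • P)
    (hh : Rᵀ * h * R = c₂ • (c • P - S)) :
    g⁻¹ * ((g⁻¹ * h).trace • g - h) = R * ((c₂ / c₁) • etaMat P S c) * R⁻¹ := by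
  have hPu : IsUnit P.det := hP.det_pos.ne'.isUnit
  have hRR : R * R⁻¹ = 1 := mul_nonsing_inv R hR
  have hRR' : R⁻¹ * R = 1 := nonsing_inv_mul R hR
  have hPP : P⁻¹ * P = 1 := nonsing_inv_mul P hPu
  have hginv : (R * (c₁⁻¹ • P⁻¹) * Rᵀ) * g = 1 := by
    calc (R * (c₁⁻¹ • P⁻¹) * Rᵀ) * g = R * (c₁⁻¹ • P⁻¹) * (Rᵀ * g * R) * R⁻¹ := by
          simp only [Matrix.mul_assoc, hRR, Matrix.mul_one]
      _ = 1 := by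
        rw [hg, Matrix.mul_assoc R, Matrix.smul_mul, Matrix.mul_smul P⁻¹, hPP, smul_smul,
          inv_mul_cancel₀ hc₁, one_smul, Matrix.mul_one, hRR]
  have hgi : g⁻¹ = R * (c₁⁻¹ • P⁻¹) * Rᵀ := inv_eq_left_inv hginv
  have hgh : g⁻¹ * h = R * ((c₂ / c₁) • shapeMat P S c) * R⁻¹ := by
    calc g⁻¹ * h = R * (c₁⁻¹ • P⁻¹) * (Rᵀ * h * R) * R⁻¹ := by
          rw [hgi]; simp only [Matrix.mul_assoc, hRR, Matrix.mul_one]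
      _ = _ := by
        have h1 : P⁻¹ * (c₂ • (c • P - S)) = c₂ • (c • 1 - P⁻¹ * S) := by
          rw [Matrix.mul_smul, Matrix.mul_sub, Matrix.mul_smul, hPP]
        rw [hh, shapeMat, Matrix.mul_assoc R, Matrix.smul_mul, h1, smul_smul, div_eq_inv_mul]
  have htr : (g⁻¹ * h).trace = (c₂ / c₁) * (shapeMat P S c).trace := by
    rw [hgh, Matrix.mul_assoc, trace_mul_comm, Matrix.mul_assoc, hRR', Matrix.mul_one, trace_smul,
      smul_eq_mul]
  have hgg : g⁻¹ * g = 1 := by rw [hgi, hginv]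
  rw [Matrix.mul_sub, Matrix.mul_smul, hgg, htr, hgh, etaMat, smul_sub, Matrix.mul_sub,
    Matrix.sub_mul]
  congr 1
  rw [smul_smul, Matrix.mul_smul, Matrix.mul_one, Matrix.smul_mul, hRR]

theorem differentiableAt_det {A : ℝ → Matrix (Fin n) (Fin n) ℝ} {x : ℝ}
    (hA : ∀ i j, DifferentiableAt ℝ (fun t => A t i j) x) :
    DifferentiableAt ℝ (fun t => (A t).det) x := by
  simp only [det_apply']
  exact DifferentiableAt.fun_sum fun σ _ => DifferentiableAt.const_mul
    (DifferentiableAt.fun_finsetProd fun i _ => hA (σ i) i) _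

/-- Cramer's rule gives differentiability; the value comes from differentiating P P⁻¹ = 1. -/
theorem hasDerivAt_inv_of_one {P : ℝ → Matrix (Fin n) (Fin n) ℝ} {P' : Matrix (Fin n) (Fin n) ℝ}
    {x : ℝ} (h1 : P x = 1) (hP : ∀ i j, HasDerivAt (fun t => P t i j) (P' i j) x) (i j : Fin n) :
    HasDerivAt (fun t => (P t)⁻¹ i j) (-(P' i j)) x := by
  have hdet := differentiableAt_det fun i j => (hP i j).differentiableAt
  have hdet1 : (P x).det = 1 := by rw [h1, det_one]
  have hW : ∀ i j, DifferentiableAt ℝ (fun t => (P t)⁻¹ i j) x := by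
    intro i j
    simp only [inv_def, Matrix.smul_apply, Ring.inverse_eq_inv', smul_eq_mul]
    refine (hdet.inv (by rw [hdet1]; exact one_ne_zero)).mul ?_
    simp only [adjugate_apply]
    refine differentiableAt_det fun a b => ?_
    by_cases ha : a = j
    · subst ha; simp
    · simpa [updateRow_apply, ha] using (hP a b).differentiableAt
  have hev : ∀ᶠ t in nhds x, P t * (P t)⁻¹ = 1 := by
    have : ∀ᶠ t in nhds x, (P t).det ≠ 0 :=
      hdet.continuousAt.eventually_ne (by rw [hdet1]; exact one_ne_zero)
    filter_upwards [this] with t ht using mul_nonsing_inv _ ht.isUnit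
  have hsum : HasDerivAt (fun t => ∑ k, P t i k * (P t)⁻¹ k j)
      (∑ k, (P' i k * (P x)⁻¹ k j + P x i k * deriv (fun t => (P t)⁻¹ k j) x)) x :=
    HasDerivAt.fun_sum fun k _ => (hP i k).mul (hW k j).hasDerivAt
  have hconst : HasDerivAt (fun t => ∑ k, P t i k * (P t)⁻¹ k j) 0 x := by
    refine (hasDerivAt_const x ((1 : Matrix (Fin n) (Fin n) ℝ) i j)).congr_of_eventuallyEq ?_
    filter_upwards [hev] with t ht
    rw [← ht, mul_apply]
  have := hsum.unique hconst
  simp only [h1, inv_one, Finset.sum_add_distrib, one_apply, mul_ite, mul_one, mul_zero, ite_mul,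
    one_mul, zero_mul, Finset.sum_ite_eq, Finset.sum_ite_eq', Finset.mem_univ, if_true] at this
  have h2 : deriv (fun t => (P t)⁻¹ i j) x = -(P' i j) := by linarith
  rw [← h2]
  exact (hW i j).hasDerivAt

theorem hasDerivAt_inv_mul {P S : ℝ → Matrix (Fin n) (Fin n) ℝ} {P' S' : Matrix (Fin n) (Fin n) ℝ}
    {x : ℝ} (h1 : P x = 1) (hP : ∀ i j, HasDerivAt (fun t => P t i j) (P' i j) x)
    (hS : ∀ i j, HasDerivAt (fun t => S t i j) (S' i j) x) (i j : Fin n) :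
    HasDerivAt (fun t => ((P t)⁻¹ * S t) i j) ((S' - P' * S x) i j) x := by
  have hsum : HasDerivAt (fun t => ∑ k, (P t)⁻¹ i k * S t k j)
      (∑ k, (-(P' i k) * S x k j + (P x)⁻¹ i k * S' k j)) x :=
    HasDerivAt.fun_sum fun k _ => (hasDerivAt_inv_of_one h1 hP i k).mul (hS k j)
  simp only [mul_apply]
  refine hsum.congr_deriv ?_
  simp [h1, Finset.sum_add_distrib, one_apply, mul_apply]
  ring

theorem etaMat_one_diagonal {a : Fin n → ℝ} {c : ℝ} {μ : Fin n → ℝ}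
    (hμ : ∀ i, μ i = ∑ q, (c - a q) - (c - a i)) :
    etaMat 1 (diagonal a) c = diagonal μ := by
  have hshape : shapeMat 1 (diagonal a) c = diagonal fun i => c - a i := by
    rw [shapeMat, inv_one, Matrix.one_mul, smul_one_eq_diagonal, diagonal_sub]
  rw [etaMat, hshape, trace_diagonal, smul_one_eq_diagonal, diagonal_sub]
  congr 1
  ext i
  rw [hμ]

/-- The derivative of `σ_j` of `etaMat` along a curve of pairs of symmetric matrices that starts
at the pair of the identity and a diagonal matrix. -/
theorem hasDerivAt_sigmaEig_etaMat {P S : ℝ → Matrix (Fin n) (Fin n) ℝ} {c : ℝ → ℝ}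
    {P' S' : Matrix (Fin n) (Fin n) ℝ} {c' x : ℝ} {a : Fin n → ℝ} (h1 : P x = 1)
    (h2 : S x = diagonal a) (hpos : ∀ᶠ t in nhds x, (P t).PosDef)
    (hsymm : ∀ᶠ t in nhds x, (S t)ᵀ = S t)
    (hP : ∀ i j, HasDerivAt (fun t => P t i j) (P' i j) x)
    (hS : ∀ i j, HasDerivAt (fun t => S t i j) (S' i j) x) (hc : HasDerivAt c c' x)
    {b' : Fin n → ℝ} (hb' : ∀ i, b' i = c' - S' i i + P' i i * a i) {μ : Fin n → ℝ}
    (hμ : ∀ i, μ i = ∑ q, (c x - a q) - (c x - a i)) {j : ℕ} (hj : j ≤ n) :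
    HasDerivAt (fun t => sigmaEig j (etaMat (P t) (S t) (c t)))
      (∑ i, (∑ q, b' q - b' i) * esymmDeriv (valsErase μ i) j) x := by
  have hb : ∀ i j, HasDerivAt (fun t => shapeMat (P t) (S t) (c t) i j)
      ((c' • (1 : Matrix (Fin n) (Fin n) ℝ) - (S' - P' * S x)) i j) x := by
    intro i j
    exact (hc.mul_const ((1 : Matrix (Fin n) (Fin n) ℝ) i j)).sub
      (hasDerivAt_inv_mul h1 hP hS i j)
  have hbi : ∀ i, (c' • (1 : Matrix (Fin n) (Fin n) ℝ) - (S' - P' * S x)) i i = b' i := by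
    intro i
    simp [hb', h2, mul_diagonal]
    ring
  have htr : HasDerivAt (fun t => (shapeMat (P t) (S t) (c t)).trace) (∑ q, b' q) x := by
    simp only [trace, diag_apply, ← hbi]
    exact HasDerivAt.fun_sum fun q _ => hb q q
  have hE : ∀ i j, HasDerivAt (fun t => etaMat (P t) (S t) (c t) i j)
      (((∑ q, b' q) • (1 : Matrix (Fin n) (Fin n) ℝ)
        - (c' • (1 : Matrix (Fin n) (Fin n) ℝ) - (S' - P' * S x))) i j) x := by
    intro i j
    exact (htr.mul_const ((1 : Matrix (Fin n) (Fin n) ℝ) i j)).sub (hb i j)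
  have hdiag : etaMat (P x) (S x) (c x) = diagonal μ := by
    rw [h1, h2, etaMat_one_diagonal hμ]
  refine ((hasDerivAt_sigmaCoeff_of_diagonal
    (A := fun t => etaMat (P t) (S t) (c t)) hdiag hE hj).congr_of_eventuallyEq ?_).congr_deriv ?_
  -- Diagonal form holds only at x, but positivity of P and symmetry of S keep all eigenvalues real
  -- nearby, so σ_j stays a coefficient there.
  · filter_upwards [hpos, hsymm] with t ht1 ht2
    exact sigmaEig_eq_sigmaCoeff (splits_charpoly_etaMat ht1 ht2 _) hj
  · refine Finset.sum_congr rfl fun i _ => ?_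
    rw [Matrix.sub_apply, hbi]
    simp

end MatrixLemmas

/-! ### Levi-Civita connection, Hessian and Ricci identity on an open set of a vector space -/

section LocalGeometry

set_option maxSynthPendingDepth 3

open Filter Topology ContinuousLinearMap

variable {F : Type*} [NormedAddCommGroup F] [NormedSpace ℝ F]

/-- The Christoffel symbols of the first kind as a function of the derivative of the metric. -/
def lowCLM (D : F →L[ℝ] F →L[ℝ] F →L[ℝ] ℝ) : F →L[ℝ] F →L[ℝ] F →L[ℝ] ℝ :=
  (1 / 2 : ℝ) • (D + D.flip
    - (flipₗᵢ ℝ F F ℝ : (F →L[ℝ] F →L[ℝ] ℝ) →L[ℝ] F →L[ℝ] F →L[ℝ] ℝ).comp D.flip)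

theorem lowCLM_apply (D : F →L[ℝ] F →L[ℝ] F →L[ℝ] ℝ) (X Y Z : F) :
    lowCLM D X Y Z = (1 / 2) * (D X Y Z + D Y X Z - D Z X Y) := by
  simp [lowCLM]

/-- The Christoffel symbols of a metric on an open set of a vector space. -/
def gammaCLM (g : F → F →L[ℝ] F →L[ℝ] ℝ) (y : F) : F →L[ℝ] F →L[ℝ] F :=
  (compL ℝ F (F →L[ℝ] ℝ) F (g y).inverse).comp (lowCLM (fderiv ℝ g y))

theorem christoffel_eq_gammaCLM {H N : Type*} [TopologicalSpace H]
    [TopologicalSpace N] [ChartedSpace H N] (J : ModelWithCorners ℝ F H)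
    (G : N → F →L[ℝ] F →L[ℝ] ℝ) (p : N) (y X Y : F) :
    christoffel J G p y X Y = gammaCLM (chartMetric J G p) y X Y := rfl

/-- The curvature operator of a metric on an open set of a vector space. -/
def riemCurv (g : F → F →L[ℝ] F →L[ℝ] ℝ) (y X Y Z : F) : F :=
  fderiv ℝ (gammaCLM g) y X Y Z - fderiv ℝ (gammaCLM g) y Y X Z
    + gammaCLM g y X (gammaCLM g y Y Z) - gammaCLM g y Y (gammaCLM g y X Z)

/-- The Hessian of a function with respect to a metric on an open set of a vector space. -/
def hess (g : F → F →L[ℝ] F →L[ℝ] ℝ) (φ : F → ℝ) (y : F) : F →L[ℝ] F →L[ℝ] ℝ :=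
  fderiv ℝ (fderiv ℝ φ) y - (compL ℝ F F ℝ (fderiv ℝ φ y)).comp (gammaCLM g y)

theorem hess_apply (g : F → F →L[ℝ] F →L[ℝ] ℝ) (φ : F → ℝ) (y X Y : F) :
    hess g φ y X Y = fderiv ℝ (fderiv ℝ φ) y X Y - fderiv ℝ φ y (gammaCLM g y X Y) := rfl

/-- The gradient of a function. -/
def grad (g : F → F →L[ℝ] F →L[ℝ] ℝ) (φ : F → ℝ) (y : F) : F := (g y).inverse (fderiv ℝ φ y)

/-- The field `g` of bilinear forms is of class `C²` at `y` and an inner product at `y`. -/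
structure RiemAt (g : F → F →L[ℝ] F →L[ℝ] ℝ) (y : F) : Prop where
  contDiff : ContDiffAt ℝ 2 g y
  symm : ∀ X Y, g y X Y = g y Y X
  pos : ∀ X, X ≠ 0 → 0 < g y X X

variable {g : F → F →L[ℝ] F →L[ℝ] ℝ} {φ : F → ℝ} {y : F}

theorem RiemAt.ext_left (h : RiemAt g y) {X Y : F} (hXY : ∀ Z, g y X Z = g y Y Z) : X = Y := by
  by_contra hne
  have h0 : g y (X - Y) (X - Y) = 0 := by
    rw [map_sub (g y) X Y, sub_apply, hXY, sub_self]
  exact (h.pos (X - Y) (sub_ne_zero.2 hne)).ne' h0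

theorem RiemAt.nonneg (h : RiemAt g y) (X : F) : 0 ≤ g y X X := by
  rcases eq_or_ne X 0 with rfl | hX
  · simp
  · exact (h.pos X hX).le

theorem RiemAt.cauchy_schwarz (h : RiemAt g y) (X Y : F) :
    g y X Y ^ 2 ≤ g y X X * g y Y Y := by
  rcases eq_or_ne X 0 with rfl | hX
  · simp
  have hp := h.pos X hX
  have h0 := h.nonneg (g y X X • Y - g y X Y • X)
  simp only [map_sub, map_smul, sub_apply, smul_apply, smul_eq_mul, h.symm Y X] at h0
  have : 0 ≤ g y X X * (g y X X * g y Y Y - g y X Y ^ 2) := by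
    refine h0.trans_eq ?_; ring
  have := nonneg_of_mul_nonneg_right this hp
  linarith

theorem RiemAt.differentiableAt (h : RiemAt g y) : DifferentiableAt ℝ g y :=
  h.contDiff.differentiableAt two_ne_zero

theorem hasFDerivAt_apply₂ {E : Type*} [NormedAddCommGroup E] [NormedSpace ℝ E]
    {B : E → F →L[ℝ] F →L[ℝ] ℝ} {x : E} (hB : DifferentiableAt ℝ B x) (X Y : F) :
    HasFDerivAt (fun z => B z X Y) (((fderiv ℝ B x).flip X).flip Y) x := by
  have := (hB.hasFDerivAt.clm_apply (hasFDerivAt_const X x)).clm_apply (hasFDerivAt_const Y x)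
  refine this.congr_fderiv ?_
  ext Z
  simp

theorem fderiv_apply_symm {E : Type*} [NormedAddCommGroup E] [NormedSpace ℝ E]
    {B : E → F →L[ℝ] F →L[ℝ] ℝ} {x : E} (hB : DifferentiableAt ℝ B x)
    (hs : ∀ᶠ z in 𝓝 x, ∀ X Y, B z X Y = B z Y X) (Z : E) (X Y : F) :
    fderiv ℝ B x Z X Y = fderiv ℝ B x Z Y X := by
  have h1 := hasFDerivAt_apply₂ hB X Y
  have h2 := (hasFDerivAt_apply₂ hB Y X).congr_of_eventuallyEq
    (hs.mono fun z hz => hz X Y)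
  have := congrArg (fun L => L Z) (h1.unique h2)
  simpa using this

theorem fderiv_fderiv_symm (hφ : ContDiffAt ℝ 2 φ y) (X Y : F) :
    fderiv ℝ (fderiv ℝ φ) y X Y = fderiv ℝ (fderiv ℝ φ) y Y X :=
  (hφ.isSymmSndFDerivAt (by simp)).eq X Y

variable [FiniteDimensional ℝ F]

theorem RiemAt.isInvertible (h : RiemAt g y) : (g y).IsInvertible := by
  have hinj : Function.Injective (g y) := by
    intro X Y hXY
    exact h.ext_left fun Z => by rw [hXY]
  have hd : Module.finrank ℝ F = Module.finrank ℝ (F →L[ℝ] ℝ) := by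
    have h1 : Module.finrank ℝ (F →L[ℝ] ℝ) = Module.finrank ℝ (F →ₗ[ℝ] ℝ) :=
      (LinearMap.toContinuousLinearMap (𝕜 := ℝ) (E := F) (F' := ℝ)).symm.finrank_eq
    rw [h1]
    exact (Subspace.dual_finrank_eq (K := ℝ) (V := F)).symm
  let e : F ≃ₗ[ℝ] (F →L[ℝ] ℝ) :=
    LinearEquiv.ofInjectiveOfFinrankEq (g y : F →ₗ[ℝ] F →L[ℝ] ℝ) hinj hd
  refine ⟨e.toContinuousLinearEquiv, ?_⟩
  ext X Y
  rfl

theorem RiemAt.apply_inverse (h : RiemAt g y) (w : F →L[ℝ] ℝ) (Z : F) :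
    g y ((g y).inverse w) Z = w Z := by
  rw [← ContinuousLinearMap.comp_apply, h.isInvertible.self_comp_inverse]
  simp

theorem RiemAt.gamma_apply (h : RiemAt g y) (X Y Z : F) :
    g y (gammaCLM g y X Y) Z
      = (1 / 2) * (fderiv ℝ g y X Y Z + fderiv ℝ g y Y X Z - fderiv ℝ g y Z X Y) := by
  rw [← lowCLM_apply]
  exact h.apply_inverse _ _

theorem RiemAt.fderiv_symm (h : ∀ᶠ z in 𝓝 y, RiemAt g z) (Z X Y : F) :
    fderiv ℝ g y Z X Y = fderiv ℝ g y Z Y X :=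
  fderiv_apply_symm h.self_of_nhds.differentiableAt (h.mono fun _ hz => hz.symm) Z X Y

theorem RiemAt.gamma_symm (h : ∀ᶠ z in 𝓝 y, RiemAt g z) (X Y : F) :
    gammaCLM g y X Y = gammaCLM g y Y X := by
  refine h.self_of_nhds.ext_left fun Z => ?_
  rw [h.self_of_nhds.gamma_apply, h.self_of_nhds.gamma_apply, RiemAt.fderiv_symm h Z X Y]
  ring

/-- Metric compatibility of the Levi-Civita connection. -/
theorem RiemAt.fderiv_eq (h : ∀ᶠ z in 𝓝 y, RiemAt g z) (Z X Y : F) :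
    fderiv ℝ g y Z X Y = g y (gammaCLM g y Z X) Y + g y X (gammaCLM g y Z Y) := by
  have h0 := h.self_of_nhds
  rw [h0.symm X, h0.gamma_apply, h0.gamma_apply, RiemAt.fderiv_symm h X Z Y,
    RiemAt.fderiv_symm h Y Z X, RiemAt.fderiv_symm h Z Y X]
  ring

theorem RiemAt.gamma_unique (h : RiemAt g y) {X Y W : F}
    (hW : ∀ Z, g y W Z = (1 / 2) * (fderiv ℝ g y X Y Z + fderiv ℝ g y Y X Z - fderiv ℝ g y Z X Y)) :
    gammaCLM g y X Y = W :=
  h.ext_left fun Z => by rw [h.gamma_apply, hW]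

theorem RiemAt.contDiffAt_inverse (h : RiemAt g y) : ContDiffAt ℝ 2 (fun z => (g z).inverse) y := by
  have : ContDiffAt ℝ 2 (ContinuousLinearMap.inverse) (g y) :=
    h.isInvertible.contDiffAt_map_inverse
  exact this.comp y h.contDiff

theorem RiemAt.contDiffAt_gamma (h : RiemAt g y) : ContDiffAt ℝ 1 (gammaCLM g) y := by
  have hi : ContDiffAt ℝ 1 (fun z => (g z).inverse) y := h.contDiffAt_inverse.of_le one_le_two
  have hD : ContDiffAt ℝ 1 (fderiv ℝ g) y := h.contDiff.fderiv_right (by norm_num)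
  have hl : ContDiffAt ℝ 1 (fun z => lowCLM (fderiv ℝ g z)) y := by
    unfold lowCLM
    have hf : ContDiffAt ℝ 1 (fun z => (fderiv ℝ g z).flip) y :=
      (flipₗᵢ ℝ F F (F →L[ℝ] ℝ)).contDiff.contDiffAt.comp y hD
    exact ((hD.add hf).sub (contDiffAt_const.clm_comp hf)).const_smul _
  exact ((compL ℝ F (F →L[ℝ] ℝ) F).contDiff.contDiffAt.comp y hi).clm_comp hl

theorem RiemAt.contDiffAt_grad (h : RiemAt g y) (hφ : ContDiffAt ℝ 3 φ y) :
    ContDiffAt ℝ 2 (grad g φ) y :=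
  h.contDiffAt_inverse.clm_apply (hφ.fderiv_right (by norm_num))

theorem RiemAt.contDiffAt_hess (h : RiemAt g y) (hφ : ContDiffAt ℝ 3 φ y) :
    ContDiffAt ℝ 1 (hess g φ) y := by
  have h1 : ContDiffAt ℝ 2 (fderiv ℝ φ) y := hφ.fderiv_right (by norm_num)
  have h2 : ContDiffAt ℝ 1 (fderiv ℝ (fderiv ℝ φ)) y := h1.fderiv_right (by norm_num)
  exact h2.sub (((compL ℝ F F ℝ).contDiff.contDiffAt.comp y (h1.of_le one_le_two)).clm_comp
    h.contDiffAt_gamma)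

theorem RiemAt.apply_grad (h : RiemAt g y) (Z : F) : g y (grad g φ y) Z = fderiv ℝ φ y Z :=
  h.apply_inverse _ _

theorem hess_symm (h : ∀ᶠ z in 𝓝 y, RiemAt g z) (hφ : ContDiffAt ℝ 2 φ y) (X Y : F) :
    hess g φ y X Y = hess g φ y Y X := by
  rw [hess_apply, hess_apply, fderiv_fderiv_symm hφ X Y, RiemAt.gamma_symm h X Y]

/-- The covariant derivative of the gradient is the Hessian. -/
theorem apply_fderiv_grad (h : ∀ᶠ z in 𝓝 y, RiemAt g z) (hφ : ContDiffAt ℝ 3 φ y) (X Z : F) :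
    g y (fderiv ℝ (grad g φ) y X + gammaCLM g y X (grad g φ y)) Z = hess g φ y X Z := by
  have h0 := h.self_of_nhds
  have hN : HasFDerivAt (grad g φ) (fderiv ℝ (grad g φ) y) y :=
    ((h0.contDiffAt_grad hφ).differentiableAt two_ne_zero).hasFDerivAt
  have h1 := (h0.differentiableAt.hasFDerivAt.clm_apply hN).clm_apply (hasFDerivAt_const Z y)
  have hφ2 : HasFDerivAt (fderiv ℝ φ) (fderiv ℝ (fderiv ℝ φ) y) y :=
    ((hφ.fderiv_right (m := 2) (by norm_num)).differentiableAt two_ne_zero).hasFDerivAt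
  have h2 := (hφ2.clm_apply (hasFDerivAt_const Z y)).congr_of_eventuallyEq
    (h.mono fun z hz => hz.apply_grad (φ := φ) Z)
  have h3 := congrArg (fun L => L X) (h1.unique h2)
  simp at h3
  rw [RiemAt.fderiv_eq h, h0.apply_grad] at h3
  rw [map_add, add_apply, hess_apply]
  linarith

/-- The squared length of the gradient. -/
def gradSq (g : F → F →L[ℝ] F →L[ℝ] ℝ) (φ : F → ℝ) (y : F) : ℝ := fderiv ℝ φ y (grad g φ y)

theorem RiemAt.gradSq_eq (h : RiemAt g y) : gradSq g φ y = g y (grad g φ y) (grad g φ y) :=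
  (h.apply_grad _).symm

theorem RiemAt.contDiffAt_gradSq (h : RiemAt g y) (hφ : ContDiffAt ℝ 3 φ y) :
    ContDiffAt ℝ 2 (gradSq g φ) y :=
  (hφ.fderiv_right (by norm_num)).clm_apply (h.contDiffAt_grad hφ)

theorem fderiv_gradSq (h : ∀ᶠ z in 𝓝 y, RiemAt g z) (hφ : ContDiffAt ℝ 3 φ y) (X : F) :
    fderiv ℝ (gradSq g φ) y X = 2 * hess g φ y X (grad g φ y) := by
  have h0 := h.self_of_nhds
  have hN : HasFDerivAt (grad g φ) (fderiv ℝ (grad g φ) y) y :=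
    ((h0.contDiffAt_grad hφ).differentiableAt two_ne_zero).hasFDerivAt
  have hφ2 : HasFDerivAt (fderiv ℝ φ) (fderiv ℝ (fderiv ℝ φ) y) y :=
    ((hφ.fderiv_right (m := 2) (by norm_num)).differentiableAt two_ne_zero).hasFDerivAt
  have h1 : HasFDerivAt (gradSq g φ) _ y := hφ2.clm_apply hN
  rw [h1.fderiv]
  have h2 := apply_fderiv_grad h hφ X (grad g φ y)
  rw [h0.symm, h0.apply_grad, map_add, hess_apply] at h2
  rw [hess_apply]
  simp
  linarith

theorem fderiv_hess_apply (h : RiemAt g y) (hφ : ContDiffAt ℝ 3 φ y) (W X Z : F) :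
    fderiv ℝ (hess g φ) y W X Z = fderiv ℝ (fderiv ℝ (fderiv ℝ φ)) y W X Z
      - fderiv ℝ (fderiv ℝ φ) y W (gammaCLM g y X Z)
      - fderiv ℝ φ y (fderiv ℝ (gammaCLM g) y W X Z) := by
  have h1 : ContDiffAt ℝ 2 (fderiv ℝ φ) y := hφ.fderiv_right (by norm_num)
  have h2 : ContDiffAt ℝ 1 (fderiv ℝ (fderiv ℝ φ)) y := h1.fderiv_right (by norm_num)
  have hΓ : HasFDerivAt (gammaCLM g) (fderiv ℝ (gammaCLM g) y) y :=
    (h.contDiffAt_gamma.differentiableAt one_ne_zero).hasFDerivAt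
  have hΓ2 := (hΓ.clm_apply (hasFDerivAt_const X y)).clm_apply (hasFDerivAt_const Z y)
  have hd1 : HasFDerivAt (fderiv ℝ φ) (fderiv ℝ (fderiv ℝ φ) y) y :=
    (h1.differentiableAt two_ne_zero).hasFDerivAt
  have hd2 := hasFDerivAt_apply₂ (h2.differentiableAt one_ne_zero) X Z
  have hL := hasFDerivAt_apply₂ ((h.contDiffAt_hess hφ).differentiableAt one_ne_zero) X Z
  have hR : HasFDerivAt (fun z => hess g φ z X Z) _ y := hd2.sub (hd1.clm_apply hΓ2)
  have := congrArg (fun L => L W) (hL.unique hR)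
  simp at this
  rw [this]
  ring

theorem fderiv_fderiv_fderiv_symm (hφ : ContDiffAt ℝ 3 φ y) (W X Z : F) :
    fderiv ℝ (fderiv ℝ (fderiv ℝ φ)) y W X Z = fderiv ℝ (fderiv ℝ (fderiv ℝ φ)) y Z X W := by
  have h1 : ContDiffAt ℝ 2 (fderiv ℝ φ) y := hφ.fderiv_right (by norm_num)
  have h2 : ContDiffAt ℝ 1 (fderiv ℝ (fderiv ℝ φ)) y := h1.fderiv_right (by norm_num)
  have hev : ∀ᶠ z in 𝓝 y, ∀ X Y,
      fderiv ℝ (fderiv ℝ φ) z X Y = fderiv ℝ (fderiv ℝ φ) z Y X := by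
    filter_upwards [(hφ.of_le (m := 2) (by norm_num)).eventually (by simp)] with z hz
    exact fderiv_fderiv_symm hz
  have hs := fderiv_apply_symm (h2.differentiableAt one_ne_zero) hev
  rw [hs W X Z, hs Z X W]
  have := (h1.isSymmSndFDerivAt (by simp)).eq W Z
  rw [this]

/-- The Ricci identity. -/
theorem fderiv_hess_comm (h : ∀ᶠ z in 𝓝 y, RiemAt g z) (hφ : ContDiffAt ℝ 3 φ y) (X W Z : F) :
    fderiv ℝ (hess g φ) y W X Z = fderiv ℝ (hess g φ) y Z X W
      - fderiv ℝ φ y (riemCurv g y W Z X)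
      - hess g φ y W (gammaCLM g y X Z) + hess g φ y Z (gammaCLM g y X W) := by
  have h0 := h.self_of_nhds
  have hΓs : ∀ᶠ z in 𝓝 y, ∀ X Y, gammaCLM g z X Y = gammaCLM g z Y X :=
    h.eventually_nhds.mono fun z hz => RiemAt.gamma_symm hz
  have hΓd : ∀ V X Y, fderiv ℝ (gammaCLM g) y V X Y = fderiv ℝ (gammaCLM g) y V Y X := by
    intro V X Y
    have hΓ : HasFDerivAt (gammaCLM g) (fderiv ℝ (gammaCLM g) y) y :=
      (h0.contDiffAt_gamma.differentiableAt one_ne_zero).hasFDerivAt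
    have e1 := (hΓ.clm_apply (hasFDerivAt_const X y)).clm_apply (hasFDerivAt_const Y y)
    have e2 := ((hΓ.clm_apply (hasFDerivAt_const Y y)).clm_apply
      (hasFDerivAt_const X y)).congr_of_eventuallyEq (hΓs.mono fun z hz => hz X Y)
    have := congrArg (fun L => L V) (e1.unique e2)
    simpa using this
  -- The third partial derivatives of φ cancel by symmetry; the derivatives of the Christoffel
  -- symbols and their products assemble into the curvature.
  rw [fderiv_hess_apply h0 hφ, fderiv_hess_apply h0 hφ, fderiv_fderiv_fderiv_symm hφ W X Z,
    riemCurv, hess_apply, hess_apply, hΓd W X Z, hΓd Z X W, hΓs.self_of_nhds X Z,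
    hΓs.self_of_nhds X W]
  simp only [map_sub, map_add]
  ring

theorem fderiv_fderiv_gradSq (h : ∀ᶠ z in 𝓝 y, RiemAt g z) (hφ : ContDiffAt ℝ 3 φ y) (X : F) :
    fderiv ℝ (fderiv ℝ (gradSq g φ)) y X X
      = 2 * (fderiv ℝ (hess g φ) y X X (grad g φ y)
        + hess g φ y X (fderiv ℝ (grad g φ) y X)) := by
  have h0 := h.self_of_nhds
  have hev : ∀ᶠ z in 𝓝 y, fderiv ℝ (gradSq g φ) z X = 2 * hess g φ z X (grad g φ z) := by
    filter_upwards [h.eventually_nhds, hφ.eventually (by simp)] with z hz hz'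
    exact fderiv_gradSq hz hz' X
  have hN : HasFDerivAt (grad g φ) (fderiv ℝ (grad g φ) y) y :=
    ((h0.contDiffAt_grad hφ).differentiableAt two_ne_zero).hasFDerivAt
  have hH : HasFDerivAt (hess g φ) (fderiv ℝ (hess g φ) y) y :=
    ((h0.contDiffAt_hess hφ).differentiableAt one_ne_zero).hasFDerivAt
  have hp : HasFDerivAt (fderiv ℝ (gradSq g φ)) (fderiv ℝ (fderiv ℝ (gradSq g φ)) y) y :=
    (((h0.contDiffAt_gradSq hφ).fderiv_right (m := 1) (by norm_num)).differentiableAt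
      one_ne_zero).hasFDerivAt
  have e1 := hp.clm_apply (hasFDerivAt_const X y)
  have e2 := (((hH.clm_apply (hasFDerivAt_const X y)).clm_apply hN).const_mul
    2).congr_of_eventuallyEq hev
  have := congrArg (fun L => L X) (e1.unique e2)
  simp at this
  rw [this]
  ring

end LocalGeometry

/-! ### First and second order conditions at the maximum of the test function -/

section SecondOrder

set_option maxSynthPendingDepth 3

open Filter Topology ContinuousLinearMap

variable {F : Type*} [NormedAddCommGroup F] [NormedSpace ℝ F]

/-- With a positive second derivative the point would be a local minimum too, so the function would
be locally constant. -/
theorem deriv_deriv_nonpos_of_isLocalMax {f : ℝ → ℝ} {x : ℝ} (h : IsLocalMax f x)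
    (hc : ContinuousAt f x) : deriv (deriv f) x ≤ 0 := by
  by_contra! hpos
  have hmin := isLocalMin_of_deriv_deriv_pos hpos h.deriv_eq_zero hc
  have hconst : f =ᶠ[𝓝 x] fun _ => f x := by
    filter_upwards [h, hmin] with z h1 h2 using le_antisymm h1 h2
  have : deriv (deriv f) x = 0 := by
    have h1 : deriv f =ᶠ[𝓝 x] fun _ => 0 := by
      filter_upwards [hconst.deriv] with z hz
      rw [hz, deriv_const]
    rw [h1.deriv_eq, deriv_const]
  linarith

theorem fderiv_fderiv_nonpos_of_isLocalMax {Q : F → ℝ} {x : F} (h : IsLocalMax Q x)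
    (hQ : ContDiffAt ℝ 2 Q x) (X : F) : fderiv ℝ (fderiv ℝ Q) x X X ≤ 0 := by
  have hline : ∀ t : ℝ, HasDerivAt (fun t : ℝ => x + t • X) X t := fun t => by
    simpa using ((hasDerivAt_id t).smul_const X).const_add x
  have hcont : Tendsto (fun t : ℝ => x + t • X) (𝓝 0) (𝓝 x) := by
    have := (hline 0).continuousAt.tendsto
    simpa using this
  have hx0 : x + (0 : ℝ) • X = x := by simp
  have hmax : IsLocalMax (fun t : ℝ => Q (x + t • X)) 0 := by
    have := hcont.eventually h
    simpa [IsLocalMax, IsMaxFilter] using this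
  have hev : deriv (fun t : ℝ => Q (x + t • X)) =ᶠ[𝓝 0] fun t => fderiv ℝ Q (x + t • X) X := by
    filter_upwards [hcont.eventually (hQ.eventually (by simp))] with t ht
    have hd : HasFDerivAt Q (fderiv ℝ Q (x + t • X)) (x + t • X) :=
      (ht.differentiableAt two_ne_zero).hasFDerivAt
    exact (hd.comp_hasDerivAt t (hline t)).deriv
  have h2 := deriv_deriv_nonpos_of_isLocalMax hmax
    (ContinuousAt.comp (f := fun t : ℝ => x + t • X) (g := Q) (by rw [hx0]; exact hQ.continuousAt)
      (hline 0).continuousAt)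
  rw [hev.deriv_eq] at h2
  have hdd : HasFDerivAt (fderiv ℝ Q) (fderiv ℝ (fderiv ℝ Q) x) (x + (0 : ℝ) • X) := by
    rw [hx0]
    exact ((hQ.fderiv_right (m := 1) (by norm_num)).differentiableAt one_ne_zero).hasFDerivAt
  have h4 : HasDerivAt (fun t : ℝ => fderiv ℝ Q (x + t • X)) (fderiv ℝ (fderiv ℝ Q) x X) 0 :=
    HasFDerivAt.comp_hasDerivAt (f := fun t : ℝ => x + t • X) (0 : ℝ) hdd (hline 0)
  have h3 := (h4.clm_apply (hasDerivAt_const (0 : ℝ) X)).deriv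
  simp only [map_zero, add_zero] at h3
  exact h3 ▸ h2

variable [FiniteDimensional ℝ F] {g : F → F →L[ℝ] F →L[ℝ] ℝ} {φ : F → ℝ} {x : F}

/-- First and second order conditions at a maximum point of `(1/2) log (1 + |∇φ|²) - α φ`. -/
theorem conditions_of_isLocalMax {α : ℝ} (h : ∀ᶠ z in 𝓝 x, RiemAt g z)
    (hφ : ContDiffAt ℝ 3 φ x)
    (hmax : IsLocalMax (fun y => (1 / 2) * Real.log (1 + gradSq g φ y) - α * φ y) x) :
    (∀ X, hess g φ x X (grad g φ x) = α * (1 + gradSq g φ x) * fderiv ℝ φ x X) ∧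
    ∀ X, (fderiv ℝ (hess g φ) x (grad g φ x) X X - 2 * hess g φ x X (gammaCLM g x X (grad g φ x))
        + hess g φ x X (fderiv ℝ (grad g φ) x X + gammaCLM g x X (grad g φ x))
        - fderiv ℝ φ x (riemCurv g x X (grad g φ x) X)) / (1 + gradSq g φ x)
      - 2 * α ^ 2 * fderiv ℝ φ x X ^ 2 - α * hess g φ x X X ≤ 0 := by
  have h0 := h.self_of_nhds
  have hpos : ∀ᶠ z in 𝓝 x, 0 < 1 + gradSq g φ z := by
    filter_upwards [h] with z hz
    have := hz.nonneg (grad g φ z)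
    rw [← hz.gradSq_eq] at this
    linarith
  have hev := (h.and (hφ.eventually (by simp))).and hpos
  set Q : F → ℝ := fun y => (1 / 2) * Real.log (1 + gradSq g φ y) - α * φ y with hQdef
  have hQ2 : ContDiffAt ℝ 2 Q x :=
    (contDiffAt_const.mul ((contDiffAt_const.add (h0.contDiffAt_gradSq hφ)).log
      hpos.self_of_nhds.ne')).sub (contDiffAt_const.mul (hφ.of_le (by norm_num)))
  have hp : ∀ z, RiemAt g z → ContDiffAt ℝ 3 φ z →
      HasFDerivAt (gradSq g φ) (fderiv ℝ (gradSq g φ) z) z := fun z hz hz' =>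
    ((hz.contDiffAt_gradSq hz').differentiableAt two_ne_zero).hasFDerivAt
  have hφd : ∀ z, ContDiffAt ℝ 3 φ z → HasFDerivAt φ (fderiv ℝ φ z) z := fun z hz =>
    (hz.differentiableAt three_ne_zero).hasFDerivAt
  have hDQ : ∀ᶠ z in 𝓝 x, fderiv ℝ Q z = ((1 / 2) * (1 + gradSq g φ z)⁻¹) •
      fderiv ℝ (gradSq g φ) z - α • fderiv ℝ φ z := by
    filter_upwards [hev] with z hz
    have := ((((hp z hz.1.1 hz.1.2).const_add 1).log hz.2.ne').const_mul (1 / 2)).sub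
      ((hφd z hz.1.2).const_mul α)
    rw [← smul_smul]
    exact this.fderiv
  have hv := hpos.self_of_nhds
  set w := 1 + gradSq g φ x with hw
  have hcrit : ∀ X, fderiv ℝ (gradSq g φ) x X = 2 * α * w * fderiv ℝ φ x X := by
    intro X
    have h1 := hDQ.self_of_nhds
    rw [hmax.fderiv_eq_zero] at h1
    have h2 := congrArg (fun L => L X) h1
    simp [← hw] at h2
    field_simp at h2
    linarith
  have hfirst : ∀ X, hess g φ x X (grad g φ x) = α * w * fderiv ℝ φ x X := by
    intro X
    have := hcrit X
    rw [fderiv_gradSq h hφ] at this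
    linarith
  refine ⟨hfirst, fun X => ?_⟩
  have hsecond := fderiv_fderiv_nonpos_of_isLocalMax hmax hQ2 X
  have hDp : HasFDerivAt (fderiv ℝ (gradSq g φ)) (fderiv ℝ (fderiv ℝ (gradSq g φ)) x) x :=
    (((h0.contDiffAt_gradSq hφ).fderiv_right (m := 1) (by norm_num)).differentiableAt
      one_ne_zero).hasFDerivAt
  have hDφ : HasFDerivAt (fderiv ℝ φ) (fderiv ℝ (fderiv ℝ φ) x) x :=
    ((hφ.fderiv_right (m := 2) (by norm_num)).differentiableAt two_ne_zero).hasFDerivAt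
  have hinv : HasFDerivAt (fun z => (1 / 2) * (1 + gradSq g φ z)⁻¹)
      ((1 / 2 : ℝ) • (-(w ^ 2)⁻¹ • fderiv ℝ (gradSq g φ) x)) x :=
    (((hasDerivAt_inv hv.ne').comp_hasFDerivAt x ((hp x h0 hφ).const_add 1)).const_mul (1 / 2))
  have hDD := ((hinv.smul hDp).sub (hDφ.const_smul α)).congr_of_eventuallyEq hDQ
  rw [hDD.fderiv] at hsecond
  simp [← hw] at hsecond
  rw [fderiv_fderiv_gradSq h hφ, hcrit, fderiv_hess_comm h hφ X X (grad g φ x)] at hsecond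
  -- Criticality evaluates ∇²φ(∇φ, Γ(X,X)) as αw dφ(Γ(X,X)); after division by w this completes −α
  -- D²φ(X,X) to −α ∇²φ(X,X).
  have hg := hess_symm h (hφ.of_le (by norm_num)) (grad g φ x) (gammaCLM g x X X)
  rw [hfirst (gammaCLM g x X X)] at hg
  rw [hg] at hsecond
  have hX : hess g φ x X X = fderiv ℝ (fderiv ℝ φ) x X X - fderiv ℝ φ x (gammaCLM g x X X) := rfl
  rw [hX, map_add]
  rw [← sub_nonpos] at hsecond
  refine le_of_eq_of_le ?_ hsecond
  have hv' := hv.ne'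
  field_simp
  ring

end SecondOrder

/-! ### Christoffel symbols and curvature of a warped product -/

section WarpedLocal

set_option maxSynthPendingDepth 3

open Filter Topology ContinuousLinearMap

variable {F : Type*} [NormedAddCommGroup F] [NormedSpace ℝ F]

/-- The warped product metric `ds² + lam(s)² g` on an open set of `ℝ × F`. -/
def warp (g : F → F →L[ℝ] F →L[ℝ] ℝ) (lam : ℝ → ℝ) (z : ℝ × F) :
    (ℝ × F) →L[ℝ] (ℝ × F) →L[ℝ] ℝ :=
  (ContinuousLinearMap.mul ℝ ℝ).bilinearComp (fst ℝ ℝ F) (fst ℝ ℝ F)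
    + lam z.1 ^ 2 • (g z.2).bilinearComp (snd ℝ ℝ F) (snd ℝ ℝ F)

theorem warp_apply (g : F → F →L[ℝ] F →L[ℝ] ℝ) (lam : ℝ → ℝ) (z X Y : ℝ × F) :
    warp g lam z X Y = X.1 * Y.1 + lam z.1 ^ 2 * g z.2 X.2 Y.2 := by
  simp [warp]

variable {g : F → F →L[ℝ] F →L[ℝ] ℝ} {lam : ℝ → ℝ}

theorem RiemAt.warp {z : ℝ × F} (h : RiemAt g z.2) (hlam : ContDiffAt ℝ 2 lam z.1)
    (hpos : 0 < lam z.1) : RiemAt (warp g lam) z := by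
  refine ⟨?_, fun X Y => ?_, fun X hX => ?_⟩
  · have h1 : ContDiffAt ℝ 2 (fun z : ℝ × F => lam z.1 ^ 2) z :=
      (hlam.comp z contDiffAt_fst).pow 2
    have h2 : ContDiffAt ℝ 2 (fun z : ℝ × F => g z.2) z := h.contDiff.comp z contDiffAt_snd
    have h3 : ContDiffAt ℝ 2 (fun z : ℝ × F =>
        (g z.2).bilinearComp (snd ℝ ℝ F) (snd ℝ ℝ F)) z := by
      have e : (fun z : ℝ × F => (g z.2).bilinearComp (snd ℝ ℝ F) (snd ℝ ℝ F))
          = fun z : ℝ × F => (((compL ℝ (ℝ × F) F ℝ).flip (snd ℝ ℝ F)).comp (g z.2)).comp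
            (snd ℝ ℝ F) := by
        ext1 z; ext X Y <;> simp
      rw [e]
      exact (contDiffAt_const.clm_comp h2).clm_comp contDiffAt_const
    exact contDiffAt_const.add (h1.smul h3)
  · rw [warp_apply, warp_apply, h.symm]; ring
  · rw [warp_apply]
    by_cases h2 : X.2 = 0
    · have h1 : X.1 ≠ 0 := fun h1 => hX (Prod.ext h1 h2)
      rw [h2]
      have := mul_self_pos.2 h1
      simpa using this
    · have := h.pos X.2 h2
      have := mul_self_nonneg X.1
      positivity

theorem fderiv_warp_apply {z : ℝ × F} (hz : RiemAt g z.2) (hlam : ContDiffAt ℝ 2 lam z.1)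
    (hpos : 0 < lam z.1) (Z X Y : ℝ × F) :
    fderiv ℝ (warp g lam) z Z X Y = 2 * lam z.1 * deriv lam z.1 * Z.1 * g z.2 X.2 Y.2
      + lam z.1 ^ 2 * fderiv ℝ g z.2 Z.2 X.2 Y.2 := by
  have h1 := hasFDerivAt_apply₂ (hz.warp hlam hpos).differentiableAt X Y
  have hl : HasFDerivAt (fun z : ℝ × F => lam z.1 ^ 2)
      ((2 * lam z.1 * deriv lam z.1) • fst ℝ ℝ F) z := by
    have h0 := (hlam.differentiableAt two_ne_zero).hasDerivAt.pow 2
    have := h0.comp_hasFDerivAt z (hasFDerivAt_fst (𝕜 := ℝ) (p := z))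
    refine this.congr_fderiv ?_
    ext <;> simp
  have hg : HasFDerivAt (fun z : ℝ × F => g z.2 X.2 Y.2)
      ((((fderiv ℝ g z.2).flip X.2).flip Y.2).comp (snd ℝ ℝ F)) z :=
    (hasFDerivAt_apply₂ hz.differentiableAt X.2 Y.2).comp z hasFDerivAt_snd
  have h2 : HasFDerivAt (fun z => warp g lam z X Y) _ z :=
    ((hl.mul hg).const_add (X.1 * Y.1)).congr_of_eventuallyEq
      (Eventually.of_forall fun z => warp_apply g lam z X Y)
  have := congrArg (fun L => L Z) (h1.unique h2)
  simp at this
  rw [this]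
  ring

theorem contDiffAt_deriv {f : ℝ → ℝ} {s : ℝ} (h : ContDiffAt ℝ 2 f s) :
    ContDiffAt ℝ 1 (deriv f) s :=
  (h.fderiv_right (m := 1) (by norm_num)).clm_apply contDiffAt_const

theorem eventually_riemAt_warp {z : ℝ × F} (h : ∀ᶠ y in 𝓝 z.2, RiemAt g y)
    (hlam : ContDiffAt ℝ 2 lam z.1) (hpos : 0 < lam z.1) :
    ∀ᶠ w in 𝓝 z, (∀ᶠ y in 𝓝 w.2, RiemAt g y) ∧ ContDiffAt ℝ 2 lam w.1 ∧ 0 < lam w.1 := by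
  have h1 : ∀ᶠ w : ℝ × F in 𝓝 z, ∀ᶠ y in 𝓝 w.2, RiemAt g y :=
    (continuous_snd.tendsto z).eventually h.eventually_nhds
  have h2 : ∀ᶠ w : ℝ × F in 𝓝 z, ContDiffAt ℝ 2 lam w.1 :=
    (continuous_fst.tendsto z).eventually (hlam.eventually (by simp))
  have h3 : ∀ᶠ w : ℝ × F in 𝓝 z, 0 < lam w.1 :=
    (continuous_fst.tendsto z).eventually (hlam.continuousAt.eventually (lt_mem_nhds hpos))
  filter_upwards [h1, h2, h3] with w a b c using ⟨a, b, c⟩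

variable [FiniteDimensional ℝ F]

theorem gamma_warp {z : ℝ × F} (h : ∀ᶠ y in 𝓝 z.2, RiemAt g y) (hlam : ContDiffAt ℝ 2 lam z.1)
    (hpos : 0 < lam z.1) (X Y : ℝ × F) :
    gammaCLM (warp g lam) z X Y = (-(lam z.1 * deriv lam z.1 * g z.2 X.2 Y.2),
      gammaCLM g z.2 X.2 Y.2 + (deriv lam z.1 / lam z.1) • (X.1 • Y.2 + Y.1 • X.2)) := by
  have hz := h.self_of_nhds
  refine (hz.warp hlam hpos).gamma_unique fun Z => ?_
  have hne := hpos.ne'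
  rw [fderiv_warp_apply hz hlam hpos, fderiv_warp_apply hz hlam hpos,
    fderiv_warp_apply hz hlam hpos, warp_apply]
  have := hz.gamma_apply X.2 Y.2 Z.2
  simp only [map_add, map_smul, add_apply, smul_apply, smul_eq_mul]
  rw [this]
  field_simp
  ring

theorem fderiv_gamma_apply {G : Type*} [NormedAddCommGroup G] [NormedSpace ℝ G]
    [FiniteDimensional ℝ G] {k : G → G →L[ℝ] G →L[ℝ] ℝ} {z : G} (h : RiemAt k z) (X Y : G) :
    HasFDerivAt (fun w => gammaCLM k w X Y) (((fderiv ℝ (gammaCLM k) z).flip X).flip Y) z := by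
  have := ((h.contDiffAt_gamma.differentiableAt one_ne_zero).hasFDerivAt.clm_apply
    (hasFDerivAt_const X z)).clm_apply (hasFDerivAt_const Y z)
  refine this.congr_fderiv ?_
  ext Z
  simp

/-- The derivative of the Christoffel symbols of a warped product in a horizontal direction, on
horizontal vectors. -/
theorem fderiv_gamma_warp_horizontal {z : ℝ × F} (h : ∀ᶠ y in 𝓝 z.2, RiemAt g y)
    (hlam : ContDiffAt ℝ 2 lam z.1) (hpos : 0 < lam z.1) (V X Y : F) :
    (fderiv ℝ (gammaCLM (warp g lam)) z (0, V) (0, X) (0, Y)).2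
      = fderiv ℝ (gammaCLM g) z.2 V X Y := by
  have h0 := h.self_of_nhds
  have h1 := (fderiv_gamma_apply (h0.warp hlam hpos) (0, X) (0, Y)).snd
  have h2 : HasFDerivAt (fun w : ℝ × F => gammaCLM g w.2 X Y) _ z :=
    (fderiv_gamma_apply h0 X Y).comp z hasFDerivAt_snd
  have h3 := h2.congr_of_eventuallyEq (f₁ := fun w => (gammaCLM (warp g lam) w (0, X) (0, Y)).2) (by
    filter_upwards [eventually_riemAt_warp h hlam hpos] with w hw
    rw [gamma_warp hw.1 hw.2.1 hw.2.2]
    simp)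
  simpa using congrArg (fun L => L (0, V)) (h1.unique h3)

/-- The horizontal part of the curvature of a warped product. -/
theorem riemCurv_warp_horizontal {z : ℝ × F} (h : ∀ᶠ y in 𝓝 z.2, RiemAt g y)
    (hlam : ContDiffAt ℝ 2 lam z.1) (hpos : 0 < lam z.1) (X Y Z : F) :
    (riemCurv (warp g lam) z (0, X) (0, Y) (0, Z)).2 = riemCurv g z.2 X Y Z
      - (deriv lam z.1 ^ 2) • (g z.2 Y Z • X - g z.2 X Z • Y) := by
  have hne := hpos.ne'
  simp only [riemCurv, Prod.snd_add, Prod.snd_sub, fderiv_gamma_warp_horizontal h hlam hpos,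
    gamma_warp h hlam hpos]
  simp only [zero_smul, add_zero, smul_zero, zero_add, smul_sub, smul_smul]
  have e : ∀ a : ℝ, deriv lam z.1 / lam z.1 * -(lam z.1 * deriv lam z.1 * a)
      = -(deriv lam z.1 ^ 2 * a) := by
    intro a; field_simp
  rw [e, e]
  module

/-- The radial part of the curvature of a warped product. -/
theorem riemCurv_warp_radial {z : ℝ × F} (h : ∀ᶠ y in 𝓝 z.2, RiemAt g y)
    (hlam : ContDiffAt ℝ 2 lam z.1) (hpos : 0 < lam z.1) (X : F) :
    (riemCurv (warp g lam) z (0, X) (1, 0) (1, 0)).2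
      = -(deriv (deriv lam) z.1 / lam z.1) • X := by
  have hne := hpos.ne'
  have h0 := h.self_of_nhds
  have hd : HasDerivAt lam (deriv lam z.1) z.1 := (hlam.differentiableAt two_ne_zero).hasDerivAt
  have hdd : HasDerivAt (deriv lam) (deriv (deriv lam) z.1) z.1 :=
    ((contDiffAt_deriv hlam).differentiableAt one_ne_zero).hasDerivAt
  have e1 : (fderiv ℝ (gammaCLM (warp g lam)) z (0, X) (1, 0) (1, 0)).2 = 0 := by
    have h1 := (fderiv_gamma_apply (h0.warp hlam hpos) ((1 : ℝ), (0 : F)) ((1 : ℝ), (0 : F))).snd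
    have h3 := (hasFDerivAt_const (𝕜 := ℝ) (0 : F) z).congr_of_eventuallyEq
      (f₁ := fun w => (gammaCLM (warp g lam) w (1, 0) (1, 0)).2) (by
        filter_upwards [eventually_riemAt_warp h hlam hpos] with w hw
        rw [gamma_warp hw.1 hw.2.1 hw.2.2]
        simp)
    simpa using congrArg (fun L => L (0, X)) (h1.unique h3)
  have e2 : (fderiv ℝ (gammaCLM (warp g lam)) z (1, 0) (0, X) (1, 0)).2
      = ((deriv (deriv lam) z.1 * lam z.1 - deriv lam z.1 * deriv lam z.1) / lam z.1 ^ 2) • X := by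
    have h1 := (fderiv_gamma_apply (h0.warp hlam hpos) (0, X) (1, 0)).snd
    have h2 : HasFDerivAt (fun w : ℝ × F => (deriv lam w.1 / lam w.1) • X) _ z :=
      ((hdd.div hd hne).comp_hasFDerivAt z (hasFDerivAt_fst (𝕜 := ℝ) (p := z))).smul_const X
    have h3 := h2.congr_of_eventuallyEq
      (f₁ := fun w => (gammaCLM (warp g lam) w (0, X) (1, 0)).2) (by
        filter_upwards [eventually_riemAt_warp h hlam hpos] with w hw
        rw [gamma_warp hw.1 hw.2.1 hw.2.2]
        simp)
    simpa using congrArg (fun L => L (1, 0)) (h1.unique h3)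
  simp only [riemCurv, Prod.snd_add, Prod.snd_sub, e1, e2, gamma_warp h hlam hpos]
  simp only [map_zero, _root_.zero_apply, smul_zero, zero_add, add_zero, smul_smul,
    zero_smul, mul_zero, neg_zero]
  rw [zero_sub, ← neg_smul, ← sub_smul]
  congr 1
  field_simp
  ring

end WarpedLocal

/-! ### Change of coordinates for Christoffel symbols and Hessians -/

section Pullback

set_option maxSynthPendingDepth 3

open Filter Topology ContinuousLinearMap

variable {F : Type*} [NormedAddCommGroup F] [NormedSpace ℝ F] [FiniteDimensional ℝ F]
  {g g' : F → F →L[ℝ] F →L[ℝ] ℝ} {θ : F → F} {x : F}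

/-- The transformation law of the Christoffel symbols. -/
theorem gamma_pullback (hθ : ContDiffAt ℝ 2 θ x) (hg : ∀ᶠ y in 𝓝 x, RiemAt g y)
    (hg' : ∀ᶠ y in 𝓝 (θ x), RiemAt g' y)
    (hpull : ∀ᶠ y in 𝓝 x, ∀ X Y, g y X Y = g' (θ y) (fderiv ℝ θ y X) (fderiv ℝ θ y Y))
    (hsurj : Function.Surjective (fderiv ℝ θ x)) (X Y : F) :
    fderiv ℝ θ x (gammaCLM g x X Y)
      = gammaCLM g' (θ x) (fderiv ℝ θ x X) (fderiv ℝ θ x Y) + fderiv ℝ (fderiv ℝ θ) x X Y := by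
  have h0 := hg.self_of_nhds
  have h0' := hg'.self_of_nhds
  have hθ1 : HasFDerivAt θ (fderiv ℝ θ x) x := (hθ.differentiableAt two_ne_zero).hasFDerivAt
  have hθ2 : HasFDerivAt (fderiv ℝ θ) (fderiv ℝ (fderiv ℝ θ) x) x :=
    ((hθ.fderiv_right (m := 1) (by norm_num)).differentiableAt one_ne_zero).hasFDerivAt
  have hs : ∀ X Y, fderiv ℝ (fderiv ℝ θ) x X Y = fderiv ℝ (fderiv ℝ θ) x Y X :=
    fun X Y => (hθ.isSymmSndFDerivAt (by simp)).eq X Y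
  have hD : ∀ Z X Y, fderiv ℝ g x Z X Y
      = fderiv ℝ g' (θ x) (fderiv ℝ θ x Z) (fderiv ℝ θ x X) (fderiv ℝ θ x Y)
        + g' (θ x) (fderiv ℝ (fderiv ℝ θ) x Z X) (fderiv ℝ θ x Y)
        + g' (θ x) (fderiv ℝ θ x X) (fderiv ℝ (fderiv ℝ θ) x Z Y) := by
    intro Z X Y
    have h1 := hasFDerivAt_apply₂ h0.differentiableAt X Y
    have h2 := ((h0'.differentiableAt.hasFDerivAt.comp x hθ1).clm_apply
      (hθ2.clm_apply (hasFDerivAt_const X x))).clm_apply (hθ2.clm_apply (hasFDerivAt_const Y x))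
    have h3 := h2.congr_of_eventuallyEq (f₁ := fun y => g y X Y) (hpull.mono fun y hy => hy X Y)
    have := congrArg (fun L => L Z) (h1.unique h3)
    simp at this
    rw [this]
    ring
  refine h0'.ext_left fun W => ?_
  obtain ⟨Z, rfl⟩ := hsurj W
  -- In the Koszul combination the second derivatives of θ, being symmetric, cancel in pairs except
  -- for the one in the direction (X, Y).
  rw [← hpull.self_of_nhds, h0.gamma_apply, hD, hD, hD, map_add, add_apply, h0'.gamma_apply,
    hs Y X, hs Z X, hs Z Y, h0'.symm (fderiv ℝ θ x Y) (fderiv ℝ (fderiv ℝ θ) x X Z)]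
  ring

/-- The Hessian is invariant under changes of coordinates. -/
theorem hess_pullback {φ φ' : F → ℝ} (hθ : ContDiffAt ℝ 2 θ x) (hg : ∀ᶠ y in 𝓝 x, RiemAt g y)
    (hg' : ∀ᶠ y in 𝓝 (θ x), RiemAt g' y)
    (hpull : ∀ᶠ y in 𝓝 x, ∀ X Y, g y X Y = g' (θ y) (fderiv ℝ θ y X) (fderiv ℝ θ y Y))
    (hsurj : Function.Surjective (fderiv ℝ θ x)) (hφ' : ContDiffAt ℝ 2 φ' (θ x))
    (hφ : ∀ᶠ y in 𝓝 x, φ y = φ' (θ y)) (X Y : F) :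
    hess g φ x X Y = hess g' φ' (θ x) (fderiv ℝ θ x X) (fderiv ℝ θ x Y) := by
  have hD : ∀ᶠ y in 𝓝 x, fderiv ℝ φ y = (fderiv ℝ φ' (θ y)).comp (fderiv ℝ θ y) := by
    filter_upwards [hφ.eventually_nhds, hθ.eventually (by simp),
      hθ.continuousAt.eventually (hφ'.eventually (by simp))] with y h1 h2 h3
    rw [EventuallyEq.fderiv_eq (f₁ := φ) (f := φ' ∘ θ) h1]
    exact fderiv_comp y (h3.differentiableAt two_ne_zero) (h2.differentiableAt two_ne_zero)
  have hθ1 : HasFDerivAt θ (fderiv ℝ θ x) x := (hθ.differentiableAt two_ne_zero).hasFDerivAt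
  have hθ2 : HasFDerivAt (fderiv ℝ θ) (fderiv ℝ (fderiv ℝ θ) x) x :=
    ((hθ.fderiv_right (m := 1) (by norm_num)).differentiableAt one_ne_zero).hasFDerivAt
  have hφ2 : HasFDerivAt (fderiv ℝ φ') (fderiv ℝ (fderiv ℝ φ') (θ x)) (θ x) :=
    ((hφ'.fderiv_right (m := 1) (by norm_num)).differentiableAt one_ne_zero).hasFDerivAt
  have h1 := ((hφ2.comp x hθ1).clm_comp hθ2).congr_of_eventuallyEq hD
  rw [hess_apply, hess_apply, h1.fderiv, hD.self_of_nhds, ContinuousLinearMap.comp_apply,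
    gamma_pullback hθ hg hg' hpull hsurj, map_add]
  simp
  ring

end Pullback

/-! ### The algebraic inequality at the maximum point -/

section KeyInequality

/-- The inequality at a maximum point, in an eigenbasis of the second fundamental form. -/
theorem key_inequality {n k l : ℕ} (hlk : l + 2 ≤ k) (hkn : k ≤ n) {a d T ρ b' μ : Fin n → ℝ}
    {α lam lam₁ c' p w v s f f' ψ' B₁ B₂ K K₁ m : ℝ} (hp : 0 < p) (hw : w = 1 + p) (hv : 0 < v)
    (hvw : v ^ 2 = w) (hlam : 0 < lam) (hs : s = lam * v) (hα : 0 < α) (hαl : lam₁ ≤ α)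
    (hB₁ : 0 ≤ B₁) (hB₂ : 0 ≤ B₂) (hK : 0 ≤ K) (hm : 0 < m) (hmf : m ≤ f) (hfK : f ≤ K₁)
    (hK₁ : 1 ≤ K₁) (hμ : ∀ i, μ i = ∑ q, (lam₁ - a q) - (lam₁ - a i))
    (hG : InGarding k (vals μ))
    (heq : (vals μ).esymm k = s ^ (k - l) * f * (vals μ).esymm l)
    (hder : ∑ i, (∑ q, b' q - b' i) * esymmDeriv (valsErase μ i) k
      = ψ' * (vals μ).esymm l
        + s ^ (k - l) * f * ∑ i, (∑ q, b' q - b' i) * esymmDeriv (valsErase μ i) l)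
    (hψ' : ψ' = ((k : ℝ) - l) * (s ^ (k - l) * f) * (lam₁ + α) * p + s ^ (k - l) * f')
    (hf' : ((k : ℝ) - l) * lam₁ * p * f + f' ≤ K * v * (lam + α))
    (hQ : ∀ i, (T i + a i ^ 2 * (1 + w * d i ^ 2) - ρ i) / w - 2 * α ^ 2 * d i ^ 2 - α * a i ≤ 0)
    (hb' : ∀ i, b' i = c' + 2 * α ^ 2 * w * d i ^ 2 - T i)
    (had : ∀ i, a i * d i = α * d i) (hd : ∑ i, d i ^ 2 = p / w)
    (hρ : ∀ i, ρ i ≤ B₁ * p) (hc' : -(B₂ * p) ≤ c') :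
    α ^ 2 / 2 ≤ ((n : ℝ) - 1) * (α * lam₁ + B₁ + B₂) + k * K₁ / m * (lam * K * (lam + α)) := by
  have hw0 : 0 < w := by linarith
  have hs0 : 0 < s := by rw [hs]; positivity
  have hlk' : l < k := by omega
  have hkl : (0 : ℝ) ≤ (k : ℝ) - l := by
    have : (l : ℝ) ≤ k := by exact_mod_cast hlk'.le
    linarith
  have hσl : 0 < (vals μ).esymm l := hG.pos hlk'.le
  set σk := (vals μ).esymm k
  set σl := (vals μ).esymm l
  -- G is σ_l² times the gradient of σ_k/σ_l in μ. Since μ = tr b − b, the weight of a variation of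
  -- b_i is Φ_i = S − G_i.
  set G := quotGrad k l μ with hGdef
  set S := ∑ i, G i with hSdef
  set Φ : Fin n → ℝ := fun i => S - G i with hΦ
  have hG0 : ∀ i, 0 ≤ G i := fun i => quotGrad_nonneg hG hlk' i
  have hΦ0 : ∀ i, 0 ≤ Φ i := fun i =>
    sub_nonneg.2 (Finset.single_le_sum (f := G) (fun q _ => hG0 q) (Finset.mem_univ i))
  have hΦsum : ∑ i, Φ i = ((n : ℝ) - 1) * S := by
    simp only [hΦ, Finset.sum_sub_distrib, ← hSdef]
    simp; ring
  have hexch : ∀ b : Fin n → ℝ, ∑ i, (∑ q, b q - b i) * G i = ∑ i, Φ i * b i := by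
    intro b
    simp only [hΦ, sub_mul, Finset.sum_sub_distrib, ← Finset.mul_sum, ← hSdef]
    rw [mul_comm]
    congr 1
    exact Finset.sum_congr rfl fun i _ => mul_comm _ _
  -- The differentiated equation. In the combination that defines G the derivative of σ_l drops out,
  -- and only that of the right-hand side is left.
  have hS2 : ∑ i, Φ i * b' i = ψ' * σl ^ 2 := by
    rw [← hexch]
    have : ∀ i, (∑ q, b' q - b' i) * G i
        = ((∑ q, b' q - b' i) * esymmDeriv (valsErase μ i) k) * σl
          - σk * ((∑ q, b' q - b' i) * esymmDeriv (valsErase μ i) l) := by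
      intro i; simp only [hGdef, quotGrad, quotNum]; ring
    simp only [this, Finset.sum_sub_distrib, ← Finset.sum_mul, ← Finset.mul_sum]
    rw [hder, heq]
    ring
  -- Euler's identity for σ_k/σ_l, homogeneous of degree k − l, read with b_i = λ' − a_i.
  have hS3 : ∑ i, Φ i * a i
      = lam₁ * (((n : ℝ) - 1) * S) - ((k : ℝ) - l) * (s ^ (k - l) * f) * σl ^ 2 := by
    have h1 : ∑ i, Φ i * (lam₁ - a i) = ((k : ℝ) - l) * (s ^ (k - l) * f) * σl ^ 2 := by
      rw [← hexch fun i => lam₁ - a i]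
      simp only [← hμ]
      rw [sum_mul_quotGrad]
      change _ * (σk * σl) = _
      rw [heq]; ring
    simp only [mul_sub, Finset.sum_sub_distrib, ← Finset.sum_mul, hΦsum] at h1
    linarith
  have hS4 : ∀ i, a i = α → S / 2 ≤ Φ i := by
    intro i hi
    have := sum_quotGrad_le hG hlk' (by omega) hμ (i := i) (by rw [hi]; linarith)
    change S ≤ 2 * (S - G i) at this
    simp only [hΦ]; linarith
  have had' : ∀ i, d i ≠ 0 → a i = α := fun i hi => mul_right_cancel₀ hi (had i)
  obtain ⟨i₀, hi₀⟩ : ∃ i, d i ≠ 0 := by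
    by_contra! hc
    simp only [hc] at hd
    have : 0 < p / w := by positivity
    simp at hd
    rw [← hd] at this
    exact this.false
  have hS0 : 0 ≤ S := Finset.sum_nonneg fun i _ => hG0 i
  -- The dominant term. One index with d ≠ 0 yields α²S/(2w), and the sum of d_i² over all indices
  -- yields α²pS/(2w); since w = 1 + p, they add up to α²S/2.
  have hS5 : α ^ 2 / 2 * S ≤ ∑ i, Φ i * (a i ^ 2 * (1 + w * d i ^ 2) / w) := by
    have e1 : ∀ i, Φ i * (a i ^ 2 * (1 + w * d i ^ 2) / w)
        = Φ i * a i ^ 2 / w + Φ i * (α ^ 2 * d i ^ 2) := by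
      intro i
      have : a i ^ 2 * d i ^ 2 = α ^ 2 * d i ^ 2 := by
        have := had i
        calc a i ^ 2 * d i ^ 2 = (a i * d i) ^ 2 := by ring
          _ = _ := by rw [this]; ring
      rw [← this]
      field_simp
    have e2 : S / 2 * α ^ 2 / w ≤ ∑ i, Φ i * a i ^ 2 / w := by
      refine le_trans ?_ (Finset.single_le_sum (f := fun i => Φ i * a i ^ 2 / w)
        (fun i _ => by have := hΦ0 i; positivity) (Finset.mem_univ i₀))
      have := hS4 i₀ (had' i₀ hi₀)
      simp only [had' i₀ hi₀]
      gcongr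
    have e3 : S / 2 * (α ^ 2 * (p / w)) ≤ ∑ i, Φ i * (α ^ 2 * d i ^ 2) := by
      rw [← hd, Finset.mul_sum, Finset.mul_sum]
      refine Finset.sum_le_sum fun i _ => ?_
      by_cases hi : d i = 0
      · simp [hi]
      · have := hS4 i (had' i hi)
        gcongr
    simp only [e1, Finset.sum_add_distrib]
    refine le_trans (le_of_eq ?_) (add_le_add e2 e3)
    rw [hw] at hw0 ⊢
    field_simp
  have hρsum : ∑ i, Φ i * ρ i ≤ B₁ * p * (((n : ℝ) - 1) * S) := by
    rw [← hΦsum, Finset.mul_sum]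
    refine Finset.sum_le_sum fun i _ => ?_
    rw [mul_comm (B₁ * p)]
    exact mul_le_mul_of_nonneg_left (hρ i) (hΦ0 i)
  -- The third derivatives are eliminated here. The term 2α²w d_i² that this introduces cancels
  -- −2α²d_i² of the second order condition once divided by w.
  have hTsum : ∑ i, Φ i * T i = c' * (((n : ℝ) - 1) * S)
      + 2 * α ^ 2 * w * ∑ i, Φ i * d i ^ 2 - ψ' * σl ^ 2 := by
    rw [← hS2, ← hΦsum, Finset.mul_sum, Finset.mul_sum, ← Finset.sum_add_distrib,
      ← Finset.sum_sub_distrib]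
    refine Finset.sum_congr rfl fun i _ => ?_
    rw [hb']; ring
  have hmain : ∑ i, Φ i * ((T i + a i ^ 2 * (1 + w * d i ^ 2) - ρ i) / w - 2 * α ^ 2 * d i ^ 2
      - α * a i) ≤ 0 :=
    Finset.sum_nonpos fun i _ => mul_nonpos_of_nonneg_of_nonpos (hΦ0 i) (hQ i)
  have hsplit : ∑ i, Φ i * ((T i + a i ^ 2 * (1 + w * d i ^ 2) - ρ i) / w - 2 * α ^ 2 * d i ^ 2
      - α * a i) = (∑ i, Φ i * T i) / w + ∑ i, Φ i * (a i ^ 2 * (1 + w * d i ^ 2) / w)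
        - (∑ i, Φ i * ρ i) / w - 2 * α ^ 2 * ∑ i, Φ i * d i ^ 2 - α * ∑ i, Φ i * a i := by
    simp only [Finset.mul_sum, Finset.sum_div, ← Finset.sum_add_distrib, ← Finset.sum_sub_distrib]
    exact Finset.sum_congr rfl fun i _ => by ring
  rw [hsplit, hTsum, hS3] at hmain
  set D := ∑ i, Φ i * d i ^ 2
  set A := ∑ i, Φ i * (a i ^ 2 * (1 + w * d i ^ 2) / w)
  set R := ∑ i, Φ i * ρ i
  have hn : (0 : ℝ) ≤ (n : ℝ) - 1 := by
    have : (1 : ℝ) ≤ n := by exact_mod_cast (by omega : 1 ≤ n)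
    linarith
  have hnS : 0 ≤ ((n : ℝ) - 1) * S := mul_nonneg hn hS0
  have hpw : p / w ≤ 1 := by rw [div_le_one hw0]; linarith
  have hR : R / w ≤ B₁ * (((n : ℝ) - 1) * S) := by
    calc R / w ≤ B₁ * p * (((n : ℝ) - 1) * S) / w := by gcongr
      _ = (p / w) * (B₁ * (((n : ℝ) - 1) * S)) := by ring
      _ ≤ 1 * (B₁ * (((n : ℝ) - 1) * S)) := by gcongr
      _ = _ := one_mul _
  have hc : -(B₂ * (((n : ℝ) - 1) * S)) ≤ c' * (((n : ℝ) - 1) * S) / w := by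
    have h1 : (p / w) * (B₂ * (((n : ℝ) - 1) * S)) ≤ 1 * (B₂ * (((n : ℝ) - 1) * S)) := by gcongr
    have h2 : -(B₂ * p) * (((n : ℝ) - 1) * S) / w ≤ c' * (((n : ℝ) - 1) * S) / w := by gcongr
    have h3 : -(B₂ * p) * (((n : ℝ) - 1) * S) / w = -((p / w) * (B₂ * (((n : ℝ) - 1) * S))) := by
      ring
    linarith
  -- In ψ'/w the summand with αp is compensated by α times the Euler term, up to a positive
  -- remainder over w. What is left is O(v); division by w = v² and s = λv lower the power of s by
  -- one.
  have hlast : -(s ^ (k - l - 1) * (lam * K * (lam + α))) * σl ^ 2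
      ≤ α * (((k : ℝ) - l) * (s ^ (k - l) * f) * σl ^ 2) - ψ' * σl ^ 2 / w := by
    have hf0 : 0 < f := by linarith
    have h1 : s ^ (k - l) * (((k : ℝ) - l) * lam₁ * p * f + f') / w
        ≤ s ^ (k - l) * (K * v * (lam + α)) / w := by gcongr
    have h2 : s ^ (k - l) * (K * v * (lam + α)) / w
        = s ^ (k - l - 1) * (lam * K * (lam + α)) := by
      rw [show k - l = (k - l - 1) + 1 by omega, pow_succ, ← hvw, hs]
      simp only [Nat.add_sub_cancel]
      field_simp
    have h3 : α * (((k : ℝ) - l) * (s ^ (k - l) * f)) - ψ' / w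
        = α * (((k : ℝ) - l) * (s ^ (k - l) * f)) / w
          - s ^ (k - l) * (((k : ℝ) - l) * lam₁ * p * f + f') / w := by
      rw [hψ', hw]
      rw [hw] at hw0
      field_simp
      ring
    have h4 : 0 ≤ α * (((k : ℝ) - l) * (s ^ (k - l) * f)) / w := by positivity
    have h5 : -(s ^ (k - l - 1) * (lam * K * (lam + α)))
        ≤ α * (((k : ℝ) - l) * (s ^ (k - l) * f)) - ψ' / w := by linarith
    have h6 := mul_le_mul_of_nonneg_right h5 (sq_nonneg σl)
    refine h6.trans_eq ?_
    ring
  have hdist : (c' * (((n : ℝ) - 1) * S) + 2 * α ^ 2 * w * D - ψ' * σl ^ 2) / w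
      = c' * (((n : ℝ) - 1) * S) / w + 2 * α ^ 2 * D - ψ' * σl ^ 2 / w := by
    field_simp
  rw [hdist] at hmain
  -- S dominates σ_{k−1}σ_l / k, and σ_{k−1} dominates s^{k−l−1} σ_l by the equation. This absorbs
  -- the error from the right-hand side and also makes S positive, so that S can be cancelled.
  have hlow : s ^ (k - l - 1) * σl ^ 2 ≤ k * K₁ / m * S := by
    obtain ⟨k, rfl⟩ : ∃ k', k = k' + 1 := ⟨k - 1, by omega⟩
    have h1 := le_sum_quotGrad hG (by omega : l ≤ k) (by omega)
    have h2 := esymm_pred_lower_bound hG (by omega : l ≤ k) hs0 hmf hfK hK₁ heq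
    rw [show k + 1 - l - 1 = k - l by omega]
    change _ ≤ ((k : ℝ) + 1) * S at h1
    change s ^ (k - l) * m * σl ≤ _ at h2
    have h3 := mul_le_mul_of_nonneg_right h2 hσl.le
    have h4 : s ^ (k - l) * σl ^ 2 * m ≤ K₁ * (((k : ℝ) + 1) * S) := by
      calc s ^ (k - l) * σl ^ 2 * m = s ^ (k - l) * m * σl * σl := by ring
        _ ≤ K₁ * (vals μ).esymm k * σl := h3
        _ = K₁ * ((vals μ).esymm k * σl) := by ring
        _ ≤ K₁ * (((k : ℝ) + 1) * S) := by gcongr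
    push_cast
    rw [div_mul_eq_mul_div, le_div_iff₀ hm]
    linarith
  have hSpos : 0 < S := by
    by_contra! hc
    have h1 : 0 < s ^ (k - l - 1) * σl ^ 2 := by positivity
    have h2 : S = 0 := le_antisymm hc hS0
    rw [h2, mul_zero] at hlow
    linarith
  refine le_of_mul_le_mul_right ?_ hSpos
  have h7 : s ^ (k - l - 1) * (lam * K * (lam + α)) * σl ^ 2
      ≤ k * K₁ / m * S * (lam * K * (lam + α)) := by
    have : 0 ≤ lam * K * (lam + α) := by positivity
    have := mul_le_mul_of_nonneg_right hlow this
    linarith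
  linarith

end KeyInequality

/-! ### The inequality for a function φ in one chart -/

section LocalEstimate

set_option maxSynthPendingDepth 3

open Filter Topology ContinuousLinearMap
open scoped Matrix

variable {F : Type*} [NormedAddCommGroup F] [NormedSpace ℝ F] {n : ℕ}

/-- The bilinear form `g + dφ ⊗ dφ`. -/
def gradForm (g : F → F →L[ℝ] F →L[ℝ] ℝ) (φ : F → ℝ) (y : F) : F →L[ℝ] F →L[ℝ] ℝ :=
  g y + (fderiv ℝ φ y).smulRight (fderiv ℝ φ y)

theorem gradForm_apply (g : F → F →L[ℝ] F →L[ℝ] ℝ) (φ : F → ℝ) (y X Y : F) :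
    gradForm g φ y X Y = g y X Y + fderiv ℝ φ y X * fderiv ℝ φ y Y := rfl

/-- The matrix of a bilinear form in a family of vectors. -/
def gramMat (b : F →L[ℝ] F →L[ℝ] ℝ) (e : Fin n → F) : Matrix (Fin n) (Fin n) ℝ :=
  Matrix.of fun i j => b (e i) (e j)

theorem gramMat_apply (b : F →L[ℝ] F →L[ℝ] ℝ) (e : Fin n → F) (i j : Fin n) :
    gramMat b e i j = b (e i) (e j) := rfl

theorem gramMat_sum (b : F →L[ℝ] F →L[ℝ] ℝ) (e : Fin n → F) (Q : Matrix (Fin n) (Fin n) ℝ) :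
    gramMat b (fun j => ∑ i, Q i j • e i) = Qᵀ * gramMat b e * Q := by
  ext i j
  simp only [gramMat_apply, map_sum, map_smul, sum_apply, smul_apply, smul_eq_mul, Matrix.mul_apply,
    Matrix.transpose_apply, Finset.sum_mul, Finset.mul_sum]
  exact Finset.sum_congr rfl fun _ _ => Finset.sum_congr rfl fun _ _ => by ring

theorem gramMat_posDef {b : F →L[ℝ] F →L[ℝ] ℝ} (hs : ∀ X Y, b X Y = b Y X)
    (hp : ∀ X, X ≠ 0 → 0 < b X X) {e : Fin n → F} (he : LinearIndependent ℝ e) :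
    (gramMat b e).PosDef := by
  refine Matrix.PosDef.of_dotProduct_mulVec_pos ?_ fun x hx => ?_
  · ext i j
    simp [gramMat_apply, hs (e j)]
  · have h0 : ∑ i, x i • e i ≠ 0 := by
      intro h0
      exact hx (funext fun i => (Fintype.linearIndependent_iff.1 he x h0 i))
    refine (hp _ h0).trans_eq ?_
    simp only [map_sum, map_smul, sum_apply, smul_apply, smul_eq_mul, dotProduct, Matrix.mulVec,
      gramMat_apply, star_trivial, Finset.mul_sum]
    rw [Finset.sum_comm]
    exact Finset.sum_congr rfl fun _ _ => Finset.sum_congr rfl fun _ _ => by ring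

theorem eq_sum_of_gramMat_eq_one [FiniteDimensional ℝ F] (hn : Module.finrank ℝ F = n)
    {b : F →L[ℝ] F →L[ℝ] ℝ} (hs : ∀ X Y, b X Y = b Y X) (hp : ∀ X, X ≠ 0 → 0 < b X X)
    {e : Fin n → F} (he : gramMat b e = 1) (Y : F) : Y = ∑ i, b (e i) Y • e i := by
  have hb : ∀ i j, b (e i) (e j) = if i = j then 1 else 0 := fun i j => by
    rw [← gramMat_apply, he, Matrix.one_apply]
  have hli : LinearIndependent ℝ e := by
    rw [Fintype.linearIndependent_iff]
    intro x hx i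
    have := congrArg (b (e i)) hx
    simpa [map_sum, hb] using this
  have hspan := hli.span_eq_top_of_card_eq_finrank' (by rw [hn, Fintype.card_fin])
  by_contra hne
  set Z := Y - ∑ i, b (e i) Y • e i
  have hZ : ∀ i, b Z (e i) = 0 := fun i => by
    rw [hs]
    simp [Z, map_sum, hb]
  have hZ0 : b Z = 0 := by
    ext W
    have hW : W ∈ Submodule.span ℝ (Set.range e) := hspan ▸ Submodule.mem_top
    induction hW using Submodule.span_induction with
    | mem w hw => obtain ⟨i, rfl⟩ := hw; exact hZ i
    | zero => simp
    | add u w _ _ hu hw => rw [map_add, hu, hw]; simp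
    | smul a w _ hw => rw [map_smul, hw]; simp
  have := hp Z (sub_ne_zero.2 hne)
  rw [hZ0] at this
  simp at this

theorem etaMat_conj {P S Q : Matrix (Fin n) (Fin n) ℝ} (hQ : IsUnit Q.det) (c : ℝ) :
    etaMat (Qᵀ * P * Q) (Qᵀ * S * Q) c = Q⁻¹ * etaMat P S c * Q := by
  have h1 : Q⁻¹ * Q = 1 := Matrix.nonsing_inv_mul Q hQ
  have h2 : Qᵀ⁻¹ * Qᵀ = 1 := Matrix.nonsing_inv_mul Qᵀ (by rwa [Matrix.det_transpose])
  have h3 : shapeMat (Qᵀ * P * Q) (Qᵀ * S * Q) c = Q⁻¹ * shapeMat P S c * Q := by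
    rw [shapeMat, shapeMat, Matrix.mul_inv_rev, Matrix.mul_inv_rev, Matrix.mul_sub, Matrix.sub_mul]
    congr 1
    · rw [Matrix.mul_smul, Matrix.mul_one, Matrix.smul_mul, h1]
    · calc Q⁻¹ * (P⁻¹ * Qᵀ⁻¹) * (Qᵀ * S * Q) = Q⁻¹ * P⁻¹ * (Qᵀ⁻¹ * Qᵀ) * S * Q := by
            simp only [Matrix.mul_assoc]
        _ = _ := by rw [h2]; simp only [Matrix.mul_assoc, Matrix.mul_one]
  rw [etaMat, etaMat, h3, Matrix.trace_mul_comm, ← Matrix.mul_assoc, Matrix.mul_nonsing_inv Q hQ,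
    Matrix.one_mul, Matrix.mul_sub, Matrix.sub_mul, Matrix.mul_smul, Matrix.mul_one,
    Matrix.smul_mul, h1]

variable {g : F → F →L[ℝ] F →L[ℝ] ℝ} {φ : F → ℝ} {x : F}

theorem RiemAt.gradForm_symm (h : RiemAt g x) (X Y : F) :
    gradForm g φ x X Y = gradForm g φ x Y X := by
  rw [gradForm_apply, gradForm_apply, h.symm]; ring

theorem RiemAt.gradForm_pos (h : RiemAt g x) (X : F) (hX : X ≠ 0) : 0 < gradForm g φ x X X := by
  rw [gradForm_apply]
  have := h.pos X hX
  have := mul_self_nonneg (fderiv ℝ φ x X)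
  linarith

theorem hasFDerivAt_gradForm (hg : DifferentiableAt ℝ g x) (hφ : ContDiffAt ℝ 2 φ x) (X Y : F) :
    ∃ L : F →L[ℝ] ℝ, HasFDerivAt (fun y => gradForm g φ y X Y) L x ∧
      ∀ Z, L Z = fderiv ℝ g x Z X Y + fderiv ℝ (fderiv ℝ φ) x Z X * fderiv ℝ φ x Y
        + fderiv ℝ φ x X * fderiv ℝ (fderiv ℝ φ) x Z Y := by
  have hd : DifferentiableAt ℝ (fderiv ℝ φ) x :=
    (hφ.fderiv_right (m := 1) (by norm_num)).differentiableAt one_ne_zero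
  have h1 := hasFDerivAt_apply₂ hg X Y
  have h2 : ∀ V : F, HasFDerivAt (fun y => fderiv ℝ φ y V) ((fderiv ℝ (fderiv ℝ φ) x).flip V) x := by
    intro V
    have := hd.hasFDerivAt.clm_apply (hasFDerivAt_const V x)
    refine this.congr_fderiv ?_
    ext Z; simp
  refine ⟨_, h1.add ((h2 X).mul (h2 Y)), fun Z => ?_⟩
  simp
  ring

/-- The matrix `tr b - b`, `b = c - (g + dφ ⊗ dφ)⁻¹ ∇²φ`, in a family of vectors. -/
def localEta (g : F → F →L[ℝ] F →L[ℝ] ℝ) (φ c : F → ℝ) (e : Fin n → F) (y : F) :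
    Matrix (Fin n) (Fin n) ℝ :=
  etaMat (gramMat (gradForm g φ y) e) (gramMat (hess g φ y) e) (c y)

/-- A change of frame by a constant matrix is a conjugation. The frame that diagonalises at the
maximum point can thus be kept, with constant coefficients, while the equation is differentiated. -/
theorem sigmaEig_localEta_sum (g : F → F →L[ℝ] F →L[ℝ] ℝ) (φ c : F → ℝ) (e : Fin n → F) (y : F)
    {Q : Matrix (Fin n) (Fin n) ℝ} (hQ : IsUnit Q.det) (j : ℕ) :
    sigmaEig j (localEta g φ c (fun j => ∑ i, Q i j • e i) y)
      = sigmaEig j (localEta g φ c e y) := by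
  rw [localEta, gramMat_sum, gramMat_sum, etaMat_conj hQ, sigmaEig_conj (Matrix.mul_nonsing_inv Q hQ),
    localEta]

/-- At a critical maximum of `(1/2) log (1 + |∇φ|²) - α φ`, the constant `α` is bounded if `∇φ`
does not vanish. -/
theorem bound_of_isLocalMax [FiniteDimensional ℝ F] (hn : Module.finrank ℝ F = n) {k l : ℕ}
    (hlk : l + 2 ≤ k) (hkn : k ≤ n) {e₀ : Fin n → F} (he₀ : LinearIndependent ℝ e₀)
    {c s fh : F → ℝ} {α lam c' v f' ψ' B₁ B₂ K K₁ m : ℝ}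
    (h : ∀ᶠ z in 𝓝 x, RiemAt g z) (hφ : ContDiffAt ℝ 3 φ x)
    (hmax : IsLocalMax (fun y => (1 / 2) * Real.log (1 + gradSq g φ y) - α * φ y) x)
    (hp : 0 < gradSq g φ x) (hv : 0 < v) (hvw : v ^ 2 = 1 + gradSq g φ x) (hlam : 0 < lam)
    (hs : s x = lam * v) (hα : 0 < α) (hαl : c x ≤ α) (hB₁ : 0 ≤ B₁) (hB₂ : 0 ≤ B₂)
    (hK : 0 ≤ K) (hm : 0 < m) (hmf : m ≤ fh x) (hfK : fh x ≤ K₁) (hK₁ : 1 ≤ K₁)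
    (hconv : ∀ j, 1 ≤ j → j ≤ k → 0 < sigmaEig j (localEta g φ c e₀ x))
    (heq : ∀ᶠ y in 𝓝 x, sigmaEig k (localEta g φ c e₀ y)
      = s y ^ (k - l) * fh y * sigmaEig l (localEta g φ c e₀ y))
    (hc' : HasDerivAt (fun t : ℝ => c (x + t • grad g φ x)) c' 0)
    (hψ' : HasDerivAt (fun t : ℝ => s (x + t • grad g φ x) ^ (k - l) * fh (x + t • grad g φ x)) ψ' 0)
    (hψ : ψ' = ((k : ℝ) - l) * (s x ^ (k - l) * fh x) * (c x + α) * gradSq g φ x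
      + s x ^ (k - l) * f')
    (hf' : ((k : ℝ) - l) * c x * gradSq g φ x * fh x + f' ≤ K * v * (lam + α))
    (hcB : -(B₂ * gradSq g φ x) ≤ c')
    (hR : ∀ X Y, g x (riemCurv g x X Y X) Y ≤ B₁ * g x X X * g x Y Y) :
    α ^ 2 / 2 ≤ ((n : ℝ) - 1) * (α * c x + B₁ + B₂) + k * K₁ / m * (lam * K * (lam + α)) := by
  have h0 := h.self_of_nhds
  have hφ2 : ContDiffAt ℝ 2 φ x := hφ.of_le (by norm_num)
  obtain ⟨hcrit, hsec⟩ := conditions_of_isLocalMax h hφ hmax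
  set N := grad g φ x with hN
  set p := gradSq g φ x with hpdef
  have hw0 : 0 < 1 + p := by linarith
  have hpos := gramMat_posDef (fun X Y => h0.gradForm_symm (φ := φ) X Y) h0.gradForm_pos he₀
  have hsym : (gramMat (hess g φ x) e₀)ᵀ = gramMat (hess g φ x) e₀ := by
    ext i j
    exact hess_symm h hφ2 _ _
  obtain ⟨Q, a, hQ1, hQ2⟩ := exists_simultaneous_diagonal hpos hsym
  have hQdet : IsUnit Q.det := (Matrix.isUnit_iff_isUnit_det Q).1 (IsUnit.of_mul_eq_one_right _ hQ1)
  set e : Fin n → F := fun j => ∑ i, Q i j • e₀ i with he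
  have hg1 : gramMat (gradForm g φ x) e = 1 := by rw [he, gramMat_sum, hQ1]
  have hh1 : gramMat (hess g φ x) e = Matrix.diagonal a := by rw [he, gramMat_sum, hQ2]
  have hexp : ∀ Y, Y = ∑ i, gradForm g φ x (e i) Y • e i := fun Y =>
    eq_sum_of_gramMat_eq_one hn h0.gradForm_symm h0.gradForm_pos hg1 Y
  have hHe : ∀ i Y, hess g φ x (e i) Y = a i * gradForm g φ x (e i) Y := by
    intro i Y
    conv_lhs => rw [hexp Y]
    rw [map_sum, Finset.sum_eq_single i]
    · have := congrFun (congrFun hh1 i) i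
      rw [gramMat_apply, Matrix.diagonal_apply_eq] at this
      rw [map_smul, this, smul_eq_mul, mul_comm]
    · intro j _ hj
      have := congrFun (congrFun hh1 i) j
      rw [gramMat_apply, Matrix.diagonal_apply_ne _ hj.symm] at this
      rw [map_smul, this, smul_zero]
    · simp
  set d : Fin n → ℝ := fun i => fderiv ℝ φ x (e i) with hd
  have hii : ∀ i, gradForm g φ x (e i) (e i) = 1 := fun i => by
    rw [← gramMat_apply, hg1, Matrix.one_apply_eq]
  have hgN : ∀ X, gradForm g φ x X N = (1 + p) * fderiv ℝ φ x X := by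
    intro X
    rw [gradForm_apply, h0.symm, hN, h0.apply_grad, hpdef, gradSq]
    ring
  have hHN : ∀ i, hess g φ x (e i) N = α * (1 + p) * d i := fun i => hcrit (e i)
  have had : ∀ i, a i * d i = α * d i := by
    intro i
    have h1 := hHN i
    rw [hHe, hgN] at h1
    have h2 : (1 + p) * (a i * d i) = (1 + p) * (α * d i) := by
      calc _ = a i * ((1 + p) * d i) := by ring
        _ = _ := by rw [h1]; ring
    exact mul_left_cancel₀ hw0.ne' h2
  -- The squared length of dφ for the metric P, found by applying dφ to the expansion ∇φ = (1 + p) ∑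
  -- d_i e_i.
  have hdsum : ∑ i, d i ^ 2 = p / (1 + p) := by
    have h1 := congrArg (fderiv ℝ φ x) (hexp N)
    rw [map_sum] at h1
    simp only [map_smul, hgN, smul_eq_mul] at h1
    rw [eq_div_iff hw0.ne']
    change p = _ at h1
    rw [h1, Finset.sum_mul]
    refine Finset.sum_congr rfl fun i _ => ?_
    rw [← h1]
    change d i ^ 2 * (1 + p) = (1 + p) * d i * d i
    ring
  set μ : Fin n → ℝ := fun i => ∑ q, (c x - a q) - (c x - a i) with hμ
  have hsig : ∀ j, sigmaEig j (localEta g φ c e₀ x) = (vals μ).esymm j := by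
    intro j
    rw [← sigmaEig_localEta_sum g φ c e₀ x hQdet, ← he, localEta, hg1, hh1,
      etaMat_one_diagonal (fun i => rfl), sigmaEig_diagonal]
  have hline : HasDerivAt (fun t : ℝ => x + t • N) N 0 := by
    simpa using ((hasDerivAt_id (0 : ℝ)).smul_const N).const_add x
  have hx0 : x + (0 : ℝ) • N = x := by simp
  have hcont : Tendsto (fun t : ℝ => x + t • N) (𝓝 0) (𝓝 x) := by
    simpa using hline.continuousAt.tendsto
  choose L hL hLapp using fun i j => hasFDerivAt_gradForm (φ := φ) h0.differentiableAt hφ2 (e i) (e j)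
  have hhd : DifferentiableAt ℝ (hess g φ) x :=
    (h0.contDiffAt_hess hφ).differentiableAt one_ne_zero
  set P' : Matrix (Fin n) (Fin n) ℝ := Matrix.of fun i j => L i j N with hP'
  set S' : Matrix (Fin n) (Fin n) ℝ := Matrix.of fun i j => fderiv ℝ (hess g φ) x N (e i) (e j)
    with hS'
  set b' : Fin n → ℝ := fun i => c' - S' i i + P' i i * a i with hb'
  have hderiv : ∀ j, j ≤ n → HasDerivAt
      (fun t : ℝ => sigmaEig j (localEta g φ c e₀ (x + t • N)))
      (∑ i, (∑ q, b' q - b' i) * esymmDeriv (valsErase μ i) j) 0 := by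
    intro j hj
    have := hasDerivAt_sigmaEig_etaMat (x := 0) (P' := P') (S' := S') (c' := c')
      (P := fun t : ℝ => gramMat (gradForm g φ (x + t • N)) e)
      (S := fun t : ℝ => gramMat (hess g φ (x + t • N)) e)
      (c := fun t : ℝ => c (x + t • N)) (a := a) (b' := b') (μ := μ) (j := j)
      (by simp only [hx0]; exact hg1) (by simp only [hx0]; exact hh1) ?_ ?_ ?_ ?_ hc'
      (fun i => rfl) (fun i => by simp only [hx0, hμ]) hj
    · refine this.congr_of_eventuallyEq (Eventually.of_forall fun t => ?_)
      exact (sigmaEig_localEta_sum g φ c e₀ _ hQdet j).symm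
    · filter_upwards [hcont.eventually h] with t ht
      rw [he, gramMat_sum]
      have := gramMat_posDef (fun X Y => ht.gradForm_symm (φ := φ) X Y) ht.gradForm_pos he₀
      have := this.conjTranspose_mul_mul_same (B := Q) (Matrix.mulVec_injective_of_isUnit
        ((Matrix.isUnit_iff_isUnit_det Q).2 hQdet))
      simpa using this
    · filter_upwards [hcont.eventually h.eventually_nhds, hcont.eventually (hφ2.eventually (by simp))]
        with t ht1 ht2
      ext i j
      exact hess_symm ht1 ht2 _ _
    · intro i j
      have h1 := hL i j
      rw [← hx0] at h1
      exact h1.comp_hasDerivAt (0 : ℝ) hline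
    · intro i j
      have h1 := hasFDerivAt_apply₂ hhd (e i) (e j)
      rw [← hx0] at h1
      have h2 := h1.comp_hasDerivAt (0 : ℝ) hline
      rw [hx0] at h2
      exact h2
  have heq0 := heq.self_of_nhds
  rw [hsig, hsig] at heq0
  refine key_inequality (a := a) (d := d) (μ := μ) (b' := b') (p := p) (w := 1 + p) (s := s x)
    (T := fun i => fderiv ℝ (hess g φ) x N (e i) (e i)
      - 2 * (a i * gradForm g φ x (e i) (gammaCLM g x (e i) N)))
    (ρ := fun i => fderiv ℝ φ x (riemCurv g x (e i) N (e i)))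
    hlk hkn hp rfl hv hvw hlam hs hα hαl hB₁ hB₂ hK hm hmf hfK hK₁ (fun i => rfl) ?_ heq0 ?_ hψ hf'
    ?_ ?_ had hdsum ?_ hcB
  · intro j h1 h2
    rw [← hsig]
    exact hconv j h1 h2
  · have h1 := hψ'.mul (hderiv l (by omega))
    have h2 := (hderiv k hkn).congr_of_eventuallyEq
      (f₁ := fun t : ℝ => s (x + t • N) ^ (k - l) * fh (x + t • N)
        * sigmaEig l (localEta g φ c e₀ (x + t • N))) (by
      filter_upwards [hcont.eventually heq] with t ht using ht.symm)
    have h3 := h2.unique h1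
    rw [h3]
    simp only [hx0, hsig]
  · intro i
    have h1 := hsec (e i)
    -- ∇²φ(e_i, ·) = a_i P(e_i, ·) is evaluated at ∇_{e_i}∇φ: the g-part of P gives a_i, the part dφ
    -- ⊗ dφ gives α(1 + p) d_i².
    have h2 : hess g φ x (e i) (fderiv ℝ (grad g φ) x (e i) + gammaCLM g x (e i) N)
        = a i ^ 2 * (1 + (1 + p) * d i ^ 2) := by
      have h3 := fun Z => apply_fderiv_grad h hφ (e i) Z
      have h4 := h3 (e i)
      have h5 := h3 N
      rw [h0.symm, hN, h0.apply_grad, ← hN, hHN] at h5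
      rw [hHe, hii, mul_one] at h4
      rw [hHe, gradForm_apply, h0.symm, h4, h5]
      have := had i
      calc a i * (a i + d i * (α * (1 + p) * d i)) = a i ^ 2 + (1 + p) * (a i * d i) * (α * d i) := by
            ring
        _ = _ := by rw [← this]; ring
    rw [h2, hHe i (e i), hHe i (gammaCLM g x (e i) N), hii, mul_one] at h1
    refine le_trans (le_of_eq ?_) h1
    ring
  · intro i
    -- The Christoffel terms from P' turn the partial derivative of the Hessian into (∇_N ∇²φ)(e_i,
    -- e_i), which is T_i. The remaining part of P' contributes 2α(1 + p) a_i d_i² = 2α²(1 + p)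
    -- d_i².
    simp only [hb', hP', hS', Matrix.of_apply, hLapp]
    have h1 : fderiv ℝ g x N (e i) (e i) = 2 * g x (gammaCLM g x N (e i)) (e i) := by
      rw [RiemAt.fderiv_eq h, h0.symm (e i)]; ring
    have h2 : fderiv ℝ (fderiv ℝ φ) x N (e i)
        = α * (1 + p) * d i + fderiv ℝ φ x (gammaCLM g x N (e i)) := by
      have h3 := hess_apply g φ x N (e i)
      rw [hess_symm h hφ2, hHN] at h3
      linarith
    rw [h1, h2, RiemAt.gamma_symm h (e i) N, gradForm_apply, h0.symm (e i)]
    have := had i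
    change _ = c' + 2 * α ^ 2 * (1 + p) * d i ^ 2 - (fderiv ℝ (hess g φ) x N (e i) (e i)
      - 2 * (a i * (g x (gammaCLM g x N (e i)) (e i) + d i * fderiv ℝ φ x (gammaCLM g x N (e i)))))
    have e1 : 2 * α ^ 2 * (1 + p) * d i ^ 2 = 2 * α * (1 + p) * d i * (a i * d i) := by
      rw [this]; ring
    rw [e1]
    change c' - _ + (_ + _ * d i + d i * _) * a i = _
    ring
  · intro i
    have h1 := hR (e i) N
    rw [h0.symm, hN, h0.apply_grad, ← hN] at h1
    have h2 : g x N N = p := by rw [hN, hpdef, h0.gradSq_eq]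
    rw [h2] at h1
    have h3 : g x (e i) (e i) ≤ 1 := by
      rw [← hii i, gradForm_apply]
      have := mul_self_nonneg (fderiv ℝ φ x (e i))
      linarith
    have : B₁ * g x (e i) (e i) * p ≤ B₁ * 1 * p := by gcongr
    linarith

end LocalEstimate

/-! ### Preferred charts, their frames and transition maps -/

section ChartFacts

set_option maxSynthPendingDepth 3

open Filter Topology ContinuousLinearMap

variable {F H N : Type*} [NormedAddCommGroup F] [NormedSpace ℝ F] [TopologicalSpace H]
  [TopologicalSpace N] [ChartedSpace H N] {J : ModelWithCorners ℝ F H} [J.Boundaryless]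
  [IsManifold J ∞ N]

theorem contMDiffAt_extChartAt_symm' {p : N} {y : F} (hy : y ∈ (extChartAt J p).target) :
    ContMDiffAt 𝓘(ℝ, F) J ∞ (extChartAt J p).symm y :=
  (contMDiffOn_extChartAt_symm p).contMDiffAt
    ((isOpen_extChartAt_target p).mem_nhds hy)

theorem mdifferentiableAt_extChartAt_symm' {p : N} {y : F} (hy : y ∈ (extChartAt J p).target) :
    MDifferentiableAt 𝓘(ℝ, F) J (extChartAt J p).symm y :=
  (contMDiffAt_extChartAt_symm' hy).mdifferentiableAt (by simp)

theorem chartFrame_self (p : N) : chartFrame J p (extChartAt J p p) = ContinuousLinearMap.id ℝ F := by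
  have : IsManifold J 1 N := IsManifold.of_le (n := ∞) (by simp)
  have := mfderivWithin_range_extChartAt_symm (I := J) (x := p)
  rw [J.range_eq_univ, mfderivWithin_univ] at this
  exact this

theorem chartMetric_self (G : N → F →L[ℝ] F →L[ℝ] ℝ) (p : N) :
    chartMetric J G p (extChartAt J p p) = G p := by
  rw [chartMetric, chartFrame_self, extChartAt_to_inv]
  rfl

theorem contDiffAt_transition {p q : N} {y : F} (hy : y ∈ (extChartAt J p).target)
    (hq : (extChartAt J p).symm y ∈ (extChartAt J q).source) :
    ContDiffAt ℝ ∞ (extChartAt J q ∘ (extChartAt J p).symm) y := by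
  have := contDiffWithinAt_ext_coord_change (I := J) (n := ∞) q p (y := y) ⟨hy, hq⟩
  rwa [J.range_eq_univ, contDiffWithinAt_univ] at this

theorem chartFrame_transition {p q : N} {y : F} (hy : y ∈ (extChartAt J p).target)
    (hq : (extChartAt J p).symm y ∈ (extChartAt J q).source) :
    chartFrame J p y = (chartFrame J q (extChartAt J q ((extChartAt J p).symm y))).comp
      (fderiv ℝ (extChartAt J q ∘ (extChartAt J p).symm) y) := by
  have h1 := contDiffAt_transition hy hq
  have h2 : (extChartAt J p).symm =ᶠ[𝓝 y]
      (extChartAt J q).symm ∘ (extChartAt J q ∘ (extChartAt J p).symm) := by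
    have := (mdifferentiableAt_extChartAt_symm' hy).continuousAt.preimage_mem_nhds
      ((isOpen_extChartAt_source (I := J) q).mem_nhds hq)
    filter_upwards [this] with z hz
    exact ((extChartAt J q).left_inv hz).symm
  rw [chartFrame, h2.mfderiv_eq, mfderiv_comp y (I' := 𝓘(ℝ, F))
    (mdifferentiableAt_extChartAt_symm' ((extChartAt J q).map_source hq))
    (h1.differentiableAt (by simp)).mdifferentiableAt, mfderiv_eq_fderiv]
  rfl

theorem chartMetric_transition (G : N → F →L[ℝ] F →L[ℝ] ℝ) {p q : N} {y : F}
    (hy : y ∈ (extChartAt J p).target)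
    (hq : (extChartAt J p).symm y ∈ (extChartAt J q).source) (X Y : F) :
    chartMetric J G p y X Y
      = chartMetric J G q ((extChartAt J q ∘ (extChartAt J p).symm) y)
        (fderiv ℝ (extChartAt J q ∘ (extChartAt J p).symm) y X)
        (fderiv ℝ (extChartAt J q ∘ (extChartAt J p).symm) y Y) := by
  simp only [chartMetric, bilinearComp_apply, chartFrame_transition hy hq, Function.comp_apply,
    (extChartAt J q).left_inv hq, ContinuousLinearMap.comp_apply]

/-- A tangent vector is recorded in the preferred chart of its own base point. The frame of a fixed
chart at a nearby point is therefore the differential of a transition map into a chart that varies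
with that point. -/
theorem chartFrame_comp_fderiv {p : N} {y : F} (hy : y ∈ (extChartAt J p).target) :
    chartFrame J p y
      = fderiv ℝ (extChartAt J ((extChartAt J p).symm y) ∘ (extChartAt J p).symm) y := by
  rw [chartFrame_transition hy (mem_extChartAt_source _), chartFrame_self]
  rfl

theorem transition_comp_injective {p q : N} {y : F} (hy : y ∈ (extChartAt J p).target)
    (hq : (extChartAt J p).symm y ∈ (extChartAt J q).source) :
    (fderiv ℝ (extChartAt J p ∘ (extChartAt J q).symm) (extChartAt J q ((extChartAt J p).symm y))).comp
      (fderiv ℝ (extChartAt J q ∘ (extChartAt J p).symm) y) = ContinuousLinearMap.id ℝ F := by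
  have h1 := contDiffAt_transition hy hq
  have hp : (extChartAt J q).symm (extChartAt J q ((extChartAt J p).symm y))
      ∈ (extChartAt J p).source := by
    rw [(extChartAt J q).left_inv hq]; exact (extChartAt J p).map_target hy
  have h2 := contDiffAt_transition ((extChartAt J q).map_source hq) hp
  rw [← fderiv_id (x := y)]
  have h3 : (extChartAt J p ∘ (extChartAt J q).symm) ∘ (extChartAt J q ∘ (extChartAt J p).symm)
      =ᶠ[𝓝 y] _root_.id := by
    have := (mdifferentiableAt_extChartAt_symm' hy).continuousAt.preimage_mem_nhds
      ((isOpen_extChartAt_source (I := J) q).mem_nhds hq)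
    filter_upwards [this, (isOpen_extChartAt_target p).mem_nhds hy] with z hz hz'
    simp only [Function.comp_apply, (extChartAt J q).left_inv hz, (extChartAt J p).right_inv hz',
      _root_.id]
  rw [← h3.fderiv_eq]
  exact (fderiv_comp y (h2.differentiableAt (by simp)) (h1.differentiableAt (by simp))).symm

theorem chartFrame_injective {p : N} {y : F} (hy : y ∈ (extChartAt J p).target) :
    Function.Injective (chartFrame J p y) := by
  rw [chartFrame_comp_fderiv hy]
  have h := transition_comp_injective hy (mem_extChartAt_source (I := J) ((extChartAt J p).symm y))
  intro X Y hXY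
  have := congrArg (fun L : F →L[ℝ] F => L (X - Y)) h
  simp only [ContinuousLinearMap.comp_apply, map_sub, hXY, sub_self, ContinuousLinearMap.id_apply] at this
  exact sub_eq_zero.1 this.symm

/-- Coordinates on the tangent bundle are smooth. -/
theorem contMDiffAt_chartFrame {p : N} {z : F × F} (hz : z.1 ∈ (extChartAt J p).target) :
    ContMDiffAt 𝓘(ℝ, F × F) J.tangent ∞ (fun z : F × F =>
      (⟨(extChartAt J p).symm z.1, chartFrame J p z.1 z.2⟩ : TangentBundle J N)) z := by
  have hopen := isOpen_extChartAt_target (I := J) p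
  have : IsManifold J 1 N := IsManifold.of_le (n := ∞) (by simp)
  have h1 : ContMDiffOn 𝓘(ℝ, F).tangent J.tangent ∞
      (tangentMapWithin 𝓘(ℝ, F) J (extChartAt J p).symm (extChartAt J p).target) _ :=
    (contMDiffOn_extChartAt_symm (n := ∞) p).contMDiffOn_tangentMapWithin (by simp)
      hopen.uniqueMDiffOn
  have h2 : ContMDiffAt 𝓘(ℝ, F × F) 𝓘(ℝ, F).tangent ∞
      (fun z : F × F => (⟨z.1, z.2⟩ : TangentBundle 𝓘(ℝ, F) F)) z := by
    rw [Bundle.contMDiffAt_totalSpace]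
    refine ⟨contDiffAt_fst.contMDiffAt, ?_⟩
    simp only [trivializationAt_model_space_apply]
    exact contDiffAt_snd.contMDiffAt
  have h3 : ContMDiffAt 𝓘(ℝ, F).tangent J.tangent ∞
      (tangentMapWithin 𝓘(ℝ, F) J (extChartAt J p).symm (extChartAt J p).target)
      (⟨z.1, z.2⟩ : TangentBundle 𝓘(ℝ, F) F) :=
    h1.contMDiffAt ((hopen.preimage (FiberBundle.continuous_proj F _)).mem_nhds hz)
  refine (h3.comp z h2).congr_of_eventuallyEq ?_
  filter_upwards [continuousAt_fst.preimage_mem_nhds (hopen.mem_nhds hz)] with w hw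
  simp only [Function.comp_apply, tangentMapWithin, chartFrame]
  rw [mfderivWithin_of_isOpen hopen hw]
  rfl

end ChartFacts

/-! ### Metrics on M and on the warped product in charts -/

section WarpedCharts

set_option maxSynthPendingDepth 3

open Filter Topology ContinuousLinearMap

variable {n : ℕ} {M : Type*} [TopologicalSpace M] [ChartedSpace (Eucl n) M]
  [IsManifold 𝓘(ℝ, Eucl n) ∞ M]

section Metric

variable (g : Bundle.ContMDiffRiemannianMetric 𝓘(ℝ, Eucl n) ∞ (Eucl n)
      (fun u : M => TangentSpace 𝓘(ℝ, Eucl n) u))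

theorem metricForm_symm (u : M) (X Y : Eucl n) : metricForm g u X Y = metricForm g u Y X :=
  g.symm u X Y

theorem metricForm_pos (u : M) (X : Eucl n) (hX : X ≠ 0) : 0 < metricForm g u X X :=
  g.pos u X hX

/-- The components are the smooth bundle metric evaluated on two coordinate fields, which are smooth
sections along the inverse chart. -/
theorem contDiffAt_metricForm_frame {p : M} {y : Eucl n}
    (hy : y ∈ (extChartAt 𝓘(ℝ, Eucl n) p).target) (X Y : Eucl n) :
    ContDiffAt ℝ ∞ (fun y => chartMetric 𝓘(ℝ, Eucl n) (metricForm g) p y X Y) y := by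
  have hv : ∀ X : Eucl n, ContMDiffAt 𝓘(ℝ, Eucl n) 𝓘(ℝ, Eucl n).tangent ∞ (fun y =>
      (⟨(extChartAt 𝓘(ℝ, Eucl n) p).symm y, chartFrame 𝓘(ℝ, Eucl n) p y X⟩ :
        TangentBundle 𝓘(ℝ, Eucl n) M)) y := by
    intro X
    have h1 := contMDiffAt_chartFrame (J := 𝓘(ℝ, Eucl n)) (p := p) (z := (y, X)) hy
    have h2 : ContMDiffAt 𝓘(ℝ, Eucl n) 𝓘(ℝ, Eucl n × Eucl n) ∞ (fun y : Eucl n => (y, X)) y :=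
      (contDiffAt_id.prodMk contDiffAt_const).contMDiffAt
    exact h1.comp y h2
  have hb := contMDiffAt_extChartAt_symm' hy
  have h3 : ContMDiffAt 𝓘(ℝ, Eucl n) (𝓘(ℝ, Eucl n).prod 𝓘(ℝ, ℝ)) ∞
      (fun y => Bundle.TotalSpace.mk' ℝ (E := Bundle.Trivial M ℝ)
        ((extChartAt 𝓘(ℝ, Eucl n) p).symm y)
        (g.inner ((extChartAt 𝓘(ℝ, Eucl n) p).symm y)
          (chartFrame 𝓘(ℝ, Eucl n) p y X) (chartFrame 𝓘(ℝ, Eucl n) p y Y))) y := by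
    apply ContMDiffAt.clm_bundle_apply₂ (F₁ := Eucl n) (F₂ := Eucl n)
      (E₁ := fun u : M => TangentSpace 𝓘(ℝ, Eucl n) u)
      (E₂ := fun u : M => TangentSpace 𝓘(ℝ, Eucl n) u)
    · exact g.contMDiff.contMDiffAt.comp y hb
    · exact hv X
    · exact hv Y
  rw [Bundle.contMDiffAt_totalSpace] at h3
  exact h3.2.contDiffAt

theorem riemAt_chartMetric {p : M} {y : Eucl n} (hy : y ∈ (extChartAt 𝓘(ℝ, Eucl n) p).target) :
    RiemAt (chartMetric 𝓘(ℝ, Eucl n) (metricForm g) p) y := by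
  refine ⟨?_, fun X Y => ?_, fun X hX => ?_⟩
  · have h1 : ContDiffOn ℝ 2 (chartMetric 𝓘(ℝ, Eucl n) (metricForm g) p)
        (extChartAt 𝓘(ℝ, Eucl n) p).target := by
      rw [contDiffOn_clm_apply]
      intro X
      rw [contDiffOn_clm_apply]
      intro Y z hz
      exact ((contDiffAt_metricForm_frame g hz X Y).of_le
        (by norm_cast)).contDiffWithinAt
    exact h1.contDiffAt ((isOpen_extChartAt_target p).mem_nhds hy)
  · rw [chartMetric, bilinearComp_apply, bilinearComp_apply]
    exact metricForm_symm g _ _ _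
  · rw [chartMetric, bilinearComp_apply]
    refine metricForm_pos g _ _ fun h0 => hX ?_
    exact chartFrame_injective hy (Eq.trans h0 (map_zero _).symm)

theorem eventually_riemAt_chartMetric {p : M} {y : Eucl n}
    (hy : y ∈ (extChartAt 𝓘(ℝ, Eucl n) p).target) :
    ∀ᶠ z in 𝓝 y, RiemAt (chartMetric 𝓘(ℝ, Eucl n) (metricForm g) p) z := by
  filter_upwards [(isOpen_extChartAt_target (I := 𝓘(ℝ, Eucl n)) p).mem_nhds hy] with z hz
    using riemAt_chartMetric g hz

end Metric

theorem extChartAt_prodModel (p : ℝ × M) :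
    extChartAt (prodModel n) p = (PartialEquiv.refl ℝ).prod (extChartAt 𝓘(ℝ, Eucl n) p.2) := by
  rw [extChartAt_prod, extChartAt_model_space_eq_id]

theorem extChartAt_prodModel_apply (p q : ℝ × M) :
    extChartAt (prodModel n) p q = (q.1, extChartAt 𝓘(ℝ, Eucl n) p.2 q.2) := by
  rw [extChartAt_prodModel]; rfl

theorem extChartAt_prodModel_symm_apply (p : ℝ × M) (z : Amb n) :
    (extChartAt (prodModel n) p).symm z = (z.1, (extChartAt 𝓘(ℝ, Eucl n) p.2).symm z.2) := by
  rw [extChartAt_prodModel]; rfl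

theorem mem_extChartAt_prodModel_target {p : ℝ × M} {z : Amb n} :
    z ∈ (extChartAt (prodModel n) p).target ↔ z.2 ∈ (extChartAt 𝓘(ℝ, Eucl n) p.2).target := by
  rw [extChartAt_prodModel]; simp

theorem chartFrame_prodModel {p : ℝ × M} {z : Amb n}
    (hz : z.2 ∈ (extChartAt 𝓘(ℝ, Eucl n) p.2).target) (X : Amb n) :
    chartFrame (prodModel n) p z X = (X.1, chartFrame 𝓘(ℝ, Eucl n) p.2 z.2 X.2) := by
  rw [chartFrame_comp_fderiv (mem_extChartAt_prodModel_target.2 hz), chartFrame_comp_fderiv hz]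
  have h1 : (extChartAt (prodModel n) ((extChartAt (prodModel n) p).symm z) ∘
      (extChartAt (prodModel n) p).symm : Amb n → Amb n) = Prod.map _root_.id
        (extChartAt 𝓘(ℝ, Eucl n) ((extChartAt 𝓘(ℝ, Eucl n) p.2).symm z.2) ∘
          (extChartAt 𝓘(ℝ, Eucl n) p.2).symm) := by
    ext1 w
    simp only [Function.comp_apply, extChartAt_prodModel_apply, extChartAt_prodModel_symm_apply,
      Prod.map_apply', _root_.id]
  have h2 := ((contDiffAt_transition hz (mem_extChartAt_source _)).differentiableAt
    (by simp)).hasFDerivAt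
  rw [h1, ((hasFDerivAt_id z.1).prodMap z h2).fderiv]
  rfl

variable {g : M → Eucl n →L[ℝ] Eucl n →L[ℝ] ℝ} {lam : ℝ → ℝ}

theorem warpedMetric_apply (g : M → Eucl n →L[ℝ] Eucl n →L[ℝ] ℝ) (lam : ℝ → ℝ) (p : ℝ × M)
    (X Y : Amb n) :
    warpedMetric g lam p X Y = X.1 * Y.1 + lam p.1 ^ 2 * g p.2 X.2 Y.2 := by
  simp [warpedMetric]

theorem chartMetric_warpedMetric (g : M → Eucl n →L[ℝ] Eucl n →L[ℝ] ℝ) (lam : ℝ → ℝ)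
    {p : ℝ × M} {z : Amb n} (hz : z.2 ∈ (extChartAt 𝓘(ℝ, Eucl n) p.2).target) :
    chartMetric (prodModel n) (warpedMetric g lam) p z
      = warp (chartMetric 𝓘(ℝ, Eucl n) g p.2) lam z := by
  refine ContinuousLinearMap.ext fun X => ContinuousLinearMap.ext fun Y => ?_
  rw [warp_apply, chartMetric, bilinearComp_apply, warpedMetric_apply, chartFrame_prodModel hz,
    chartFrame_prodModel hz, extChartAt_prodModel_symm_apply]
  rfl

theorem eventually_chartMetric_warpedMetric (g : M → Eucl n →L[ℝ] Eucl n →L[ℝ] ℝ) (lam : ℝ → ℝ)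
    {p : ℝ × M} {z : Amb n} (hz : z.2 ∈ (extChartAt 𝓘(ℝ, Eucl n) p.2).target) :
    chartMetric (prodModel n) (warpedMetric g lam) p
      =ᶠ[𝓝 z] warp (chartMetric 𝓘(ℝ, Eucl n) g p.2) lam := by
  filter_upwards [continuousAt_snd.preimage_mem_nhds
    ((isOpen_extChartAt_target (I := 𝓘(ℝ, Eucl n)) p.2).mem_nhds hz)] with w hw
    using chartMetric_warpedMetric g lam hw

end WarpedCharts

/-! ### Consequences of the ambient curvature bound -/

section CurvatureBounds

set_option maxSynthPendingDepth 3

open Filter Topology ContinuousLinearMap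

theorem gammaCLM_congr {F : Type*} [NormedAddCommGroup F] [NormedSpace ℝ F]
    {G G' : F → F →L[ℝ] F →L[ℝ] ℝ} {y : F} (h : G =ᶠ[𝓝 y] G') :
    gammaCLM G y = gammaCLM G' y := by
  rw [gammaCLM, gammaCLM, h.fderiv_eq, h.eq_of_nhds]

variable {n : ℕ} {M : Type*} [TopologicalSpace M] [ChartedSpace (Eucl n) M]
  [IsManifold 𝓘(ℝ, Eucl n) ∞ M]
  (g : Bundle.ContMDiffRiemannianMetric 𝓘(ℝ, Eucl n) ∞ (Eucl n)
      (fun u : M => TangentSpace 𝓘(ℝ, Eucl n) u)) {lam : ℝ → ℝ}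

theorem eventually_riemAt_warp_chartMetric {p : ℝ × M} {z : Amb n}
    (hz : z.2 ∈ (extChartAt 𝓘(ℝ, Eucl n) p.2).target) (hlam : ContDiffAt ℝ 2 lam z.1)
    (hpos : 0 < lam z.1) :
    ∀ᶠ w in 𝓝 z, RiemAt (warp (chartMetric 𝓘(ℝ, Eucl n) (metricForm g) p.2) lam) w :=
  (eventually_riemAt_warp (eventually_riemAt_chartMetric g hz) hlam hpos).mono
    fun _ hw => hw.1.self_of_nhds.warp hw.2.1 hw.2.2

theorem curvatureOp_warpedMetric {p : ℝ × M} (hlam : ContDiffAt ℝ 2 lam p.1)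
    (hpos : 0 < lam p.1) (X Y Z : Amb n) :
    curvatureOp (prodModel n) (warpedMetric (metricForm g) lam) p X Y Z
      = riemCurv (warp (chartMetric 𝓘(ℝ, Eucl n) (metricForm g) p.2) lam)
        (p.1, extChartAt 𝓘(ℝ, Eucl n) p.2 p.2) X Y Z := by
  set z : Amb n := (p.1, extChartAt 𝓘(ℝ, Eucl n) p.2 p.2) with hzdef
  have hz : z.2 ∈ (extChartAt 𝓘(ℝ, Eucl n) p.2).target := mem_extChartAt_target p.2
  have h1 := eventually_chartMetric_warpedMetric (metricForm g) lam hz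
  have h2 := (eventually_riemAt_warp_chartMetric g hz hlam hpos).self_of_nhds
  have h3 : gammaCLM (chartMetric (prodModel n) (warpedMetric (metricForm g) lam) p)
      =ᶠ[𝓝 z] gammaCLM (warp (chartMetric 𝓘(ℝ, Eucl n) (metricForm g) p.2) lam) :=
    h1.eventually_nhds.mono fun w hw => gammaCLM_congr hw
  have h4 : ∀ Y Z : Amb n, fderiv ℝ (fun q => christoffel (prodModel n)
      (warpedMetric (metricForm g) lam) p q Y Z) z
        = fderiv ℝ (fun q => gammaCLM (warp (chartMetric 𝓘(ℝ, Eucl n) (metricForm g) p.2) lam)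
          q Y Z) z := by
    intro Y Z
    refine EventuallyEq.fderiv_eq ?_
    filter_upwards [h3] with w hw
    rw [christoffel_eq_gammaCLM, hw]
  rw [curvatureOp, extChartAt_prodModel_apply]
  simp only [← hzdef, h4]
  rw [(fderiv_gamma_apply h2 Y Z).fderiv, (fderiv_gamma_apply h2 X Z).fderiv]
  simp only [christoffel_eq_gammaCLM, h3.eq_of_nhds]
  simp [riemCurv]

theorem len_sq {p : ℝ × M} (hpos : 0 < lam p.1) (X : Amb n) :
    len (warpedMetric (metricForm g) lam) p X ^ 2 = warpedMetric (metricForm g) lam p X X := by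
  rw [len, Real.sq_sqrt]
  rw [warpedMetric_apply]
  have : 0 ≤ metricForm g p.2 X.2 X.2 := by
    rcases eq_or_ne X.2 0 with h | h
    · rw [h]; simp
    · exact (metricForm_pos g _ _ h).le
  have := mul_self_nonneg X.1
  positivity

/-- Tested on R(X, ∂_r)∂_r = −(λ''/λ)X. This bounds the derivative of λ' along ∇φ, so that no C²
bound on λ enters the constant. -/
theorem CurvatureLE.abs_deriv_deriv_le {r₁ r₂ B s : ℝ} (h : CurvatureLE (metricForm g) lam r₁ r₂ B)
    (hs : s ∈ Set.Icc r₁ r₂) (hlam : ContDiffAt ℝ 2 lam s) (hpos : 0 < lam s) (u : M)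
    {X : Eucl n} (hX : X ≠ 0) : |deriv (deriv lam) s| ≤ B * lam s := by
  have h1 := h (s, u) hs (0, X) (1, 0) (1, 0) (0, X)
  have h2 := riemCurv_warp_radial (z := (s, extChartAt 𝓘(ℝ, Eucl n) u u))
    (eventually_riemAt_chartMetric g (mem_extChartAt_target u)) hlam hpos X
  have hl : len (warpedMetric (metricForm g) lam) (s, u) (1, 0) = 1 := by
    rw [len, warpedMetric_apply]; simp
  have hl' := len_sq g (p := (s, u)) hpos (0, X)
  rw [warpedMetric_apply] at hl'
  rw [curvatureOp_warpedMetric g hlam hpos, warpedMetric_apply, h2, hl] at h1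
  have hp := metricForm_pos g u X hX
  have e1 : B * len (warpedMetric (metricForm g) lam) (s, u) (0, X) * 1 * 1
      * len (warpedMetric (metricForm g) lam) (s, u) (0, X)
      = B * lam s * (lam s * metricForm g u X X) := by
    have : ∀ t : ℝ, B * t * 1 * 1 * t = B * t ^ 2 := fun t => by ring
    rw [this, hl']
    ring
  have e2 : |(riemCurv (warp (chartMetric 𝓘(ℝ, Eucl n) (metricForm g) (s, u).2) lam)
      ((s, u).1, extChartAt 𝓘(ℝ, Eucl n) (s, u).2 (s, u).2) (0, X) (1, 0) (1, 0)).1 * 0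
      + lam s ^ 2 * metricForm g u (-(deriv (deriv lam) s / lam s) • X) X|
      = |deriv (deriv lam) s| * (lam s * metricForm g u X X) := by
    rw [map_smul, smul_apply, smul_eq_mul, mul_zero, zero_add,
      ← abs_of_pos (mul_pos hpos hp), ← abs_mul, ← abs_neg]
    congr 1
    field_simp
  rw [e1] at h1
  have h3 := e2.symm.le.trans h1
  exact le_of_mul_le_mul_right h3 (mul_pos hpos hp)

/-- The horizontal ambient curvature differs from that of g' by λ'² times a Gram determinant, which
has a favourable sign by Cauchy–Schwarz and is dropped. Only this one-sided bound is needed. -/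
theorem CurvatureLE.sectional_le {r₁ r₂ B s : ℝ} (h : CurvatureLE (metricForm g) lam r₁ r₂ B)
    (hs : s ∈ Set.Icc r₁ r₂) (hlam : ContDiffAt ℝ 2 lam s) (hpos : 0 < lam s) (u : M)
    (X Y : Eucl n) :
    metricForm g u (riemCurv (chartMetric 𝓘(ℝ, Eucl n) (metricForm g) u)
      (extChartAt 𝓘(ℝ, Eucl n) u u) X Y X) Y
      ≤ B * lam s ^ 2 * metricForm g u X X * metricForm g u Y Y := by
  have h1 := h (s, u) hs (0, X) (0, Y) (0, X) (0, Y)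
  have h2 := riemCurv_warp_horizontal (z := (s, extChartAt 𝓘(ℝ, Eucl n) u u))
    (eventually_riemAt_chartMetric g (mem_extChartAt_target u)) hlam hpos X Y X
  have hX := len_sq g (p := (s, u)) hpos (0, X)
  have hY := len_sq g (p := (s, u)) hpos (0, Y)
  rw [warpedMetric_apply] at hX hY
  rw [curvatureOp_warpedMetric g hlam hpos, warpedMetric_apply, h2] at h1
  have e1 : ∀ a b : ℝ, B * a * b * a * b = B * a ^ 2 * b ^ 2 := fun a b => by ring
  rw [e1, hX, hY] at h1
  have hcs := (riemAt_chartMetric g (mem_extChartAt_target u)).cauchy_schwarz X Y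
  rw [chartMetric_self] at h1 hcs
  have h3 := (le_abs_self _).trans h1
  simp only [map_sub, map_smul, sub_apply, smul_apply, smul_eq_mul, mul_zero, zero_add,
    metricForm_symm g u Y X] at h3
  have hl2 : 0 < lam s ^ 2 := by positivity
  have h4 : 0 ≤ deriv lam s ^ 2 * (metricForm g u X X * metricForm g u Y Y
    - metricForm g u X Y ^ 2) := mul_nonneg (sq_nonneg _) (by linarith)
  refine le_of_mul_le_mul_left ?_ hl2
  have h5 := mul_nonneg hl2.le h4
  linarith

end CurvatureBounds

/-! ### Derivatives of a radial graph in a chart -/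

section GraphGeometry

set_option maxSynthPendingDepth 3

open Filter Topology ContinuousLinearMap
open scoped Matrix

section Radial

variable {F : Type*} [NormedAddCommGroup F] [NormedSpace ℝ F] {ρ : F → ℝ} {ψ lam : ℝ → ℝ} {y : F}

theorem fderiv_comp_radial (hρ : DifferentiableAt ℝ ρ y) (hψ : HasDerivAt ψ (lam (ρ y))⁻¹ (ρ y))
    (hpos : 0 < lam (ρ y)) : fderiv ℝ ρ y = lam (ρ y) • fderiv ℝ (fun z => ψ (ρ z)) y := by
  have h : HasFDerivAt (fun z => ψ (ρ z)) _ y := hψ.comp_hasFDerivAt y hρ.hasFDerivAt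
  rw [h.fderiv, smul_smul, mul_inv_cancel₀ hpos.ne', one_smul]

theorem fderiv_fderiv_comp_radial (hρ : ContDiffAt ℝ 2 ρ y)
    (hψ : ∀ᶠ s in 𝓝 (ρ y), HasDerivAt ψ (lam s)⁻¹ s) (hlam : DifferentiableAt ℝ lam (ρ y))
    (hpos : 0 < lam (ρ y)) (hψ2 : ContDiffAt ℝ 2 ψ (ρ y)) (X Y : F) :
    fderiv ℝ (fderiv ℝ ρ) y X Y = lam (ρ y) * fderiv ℝ (fderiv ℝ fun z => ψ (ρ z)) y X Y
      + lam (ρ y) * deriv lam (ρ y) * fderiv ℝ (fun z => ψ (ρ z)) y X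
        * fderiv ℝ (fun z => ψ (ρ z)) y Y := by
  have hρ1 : DifferentiableAt ℝ ρ y := hρ.differentiableAt two_ne_zero
  have hev : fderiv ℝ ρ =ᶠ[𝓝 y] fun z => lam (ρ z) • fderiv ℝ (fun z => ψ (ρ z)) z := by
    have hc := hρ.continuousAt
    filter_upwards [hρ.eventually (by simp), hc.eventually hψ,
      hc.eventually (hlam.continuousAt.eventually (lt_mem_nhds hpos))] with z h1 h2 h3
    exact fderiv_comp_radial (h1.differentiableAt two_ne_zero) h2 h3
  have hφ : ContDiffAt ℝ 2 (fun z => ψ (ρ z)) y := hψ2.comp y hρ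
  have hd : HasFDerivAt (fderiv ℝ fun z => ψ (ρ z)) _ y :=
    ((hφ.fderiv_right (m := 1) (by norm_num)).differentiableAt one_ne_zero).hasFDerivAt
  have hl : HasFDerivAt (fun z => lam (ρ z)) _ y :=
    hlam.hasDerivAt.comp_hasFDerivAt y hρ1.hasFDerivAt
  have hls : HasFDerivAt (fun z => lam (ρ z) • fderiv ℝ (fun z => ψ (ρ z)) z) _ y := hl.smul hd
  rw [hev.fderiv_eq, hls.fderiv]
  have h1 := congrArg (fun L => L X) (fderiv_comp_radial hρ1 hψ.self_of_nhds hpos)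
  simp only [smul_apply, smul_eq_mul] at h1
  simp only [add_apply, smul_apply, smulRight_apply, smul_eq_mul, h1]
  ring

end Radial

variable {n : ℕ} {M : Type*} [TopologicalSpace M] [ChartedSpace (Eucl n) M]
  [IsManifold 𝓘(ℝ, Eucl n) ∞ M]

/-- The coordinate expression of a function on `M` in the preferred chart at `p`. -/
def inChart (r : M → ℝ) (p : M) (y : Eucl n) : ℝ := r ((extChartAt 𝓘(ℝ, Eucl n) p).symm y)

theorem inChart_self (r : M → ℝ) (p : M) : inChart r p (extChartAt 𝓘(ℝ, Eucl n) p p) = r p := by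
  rw [inChart, extChartAt_to_inv]

theorem contDiffAt_inChart {r : M → ℝ} {m : ℕ∞} (hr : ContMDiff 𝓘(ℝ, Eucl n) 𝓘(ℝ, ℝ) m r) {p : M}
    {y : Eucl n} (hy : y ∈ (extChartAt 𝓘(ℝ, Eucl n) p).target) :
    ContDiffAt ℝ m (inChart r p) y := by
  have h1 : ContMDiffAt 𝓘(ℝ, Eucl n) 𝓘(ℝ, Eucl n) m (extChartAt 𝓘(ℝ, Eucl n) p).symm y :=
    (contMDiffAt_extChartAt_symm' hy).of_le (by exact_mod_cast le_top)
  exact (hr.contMDiffAt.comp y h1).contDiffAt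

theorem differential_eq_fderiv {r : M → ℝ} (hr : ContMDiff 𝓘(ℝ, Eucl n) 𝓘(ℝ, ℝ) 1 r) (u : M) :
    differential 𝓘(ℝ, ℝ) r u = fderiv ℝ (inChart r u) (extChartAt 𝓘(ℝ, Eucl n) u u) := by
  have h := hr.mdifferentiableAt (x := u) one_ne_zero
  refine h.mfderiv.trans ?_
  rw [writtenInExtChartAt, extChartAt_model_space_eq_id]
  simp only [modelWithCornersSelf_coe, Set.range_id, fderivWithin_univ]
  rfl

theorem writtenInExtChartAt_graph (r : M → ℝ) (u : M) :
    writtenInExtChartAt 𝓘(ℝ, Eucl n) (prodModel n) u (graph r)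
      =ᶠ[𝓝 (extChartAt 𝓘(ℝ, Eucl n) u u)] fun y => (inChart r u y, y) := by
  filter_upwards [(isOpen_extChartAt_target (I := 𝓘(ℝ, Eucl n)) u).mem_nhds
    (mem_extChartAt_target u)] with y hy
  simp only [writtenInExtChartAt, Function.comp_apply, extChartAt_prodModel_apply, graph, inChart,
    (extChartAt 𝓘(ℝ, Eucl n) u).right_inv hy]

theorem hasFDerivAt_graph {r : M → ℝ} {m : ℕ∞} (hr : ContMDiff 𝓘(ℝ, Eucl n) 𝓘(ℝ, ℝ) m r)
    (hm : m ≠ 0) {u : M} {y : Eucl n} (hy : y ∈ (extChartAt 𝓘(ℝ, Eucl n) u).target) :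
    HasFDerivAt (fun y => (inChart r u y, y))
      ((fderiv ℝ (inChart r u) y).prod (ContinuousLinearMap.id ℝ (Eucl n))) y :=
  (((contDiffAt_inChart hr hy).differentiableAt (by exact_mod_cast hm)).hasFDerivAt).prodMk
    (hasFDerivAt_id y)

theorem differential_graph {r : M → ℝ} (hr : ContMDiff 𝓘(ℝ, Eucl n) 𝓘(ℝ, ℝ) 1 r) (u : M)
    (a : Eucl n) : differential (prodModel n) (graph r) u a
      = (fderiv ℝ (inChart r u) (extChartAt 𝓘(ℝ, Eucl n) u u) a, a) := by
  have h : MDifferentiableAt 𝓘(ℝ, Eucl n) (prodModel n) (graph r) u :=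
    (hr.mdifferentiableAt one_ne_zero).prodMk mdifferentiableAt_id
  have h' : differential (prodModel n) (graph r) u = _ := h.mfderiv
  rw [h']
  simp only [modelWithCornersSelf_coe, Set.range_id, fderivWithin_univ]
  rw [(writtenInExtChartAt_graph r u).fderiv_eq,
    (hasFDerivAt_graph (m := 1) hr one_ne_zero (mem_extChartAt_target u)).fderiv]
  rfl

variable (g : Bundle.ContMDiffRiemannianMetric 𝓘(ℝ, Eucl n) ∞ (Eucl n)
      (fun u : M => TangentSpace 𝓘(ℝ, Eucl n) u)) {lam : ℝ → ℝ}

theorem covDeriv_graph {r : M → ℝ} (hr : ContMDiff 𝓘(ℝ, Eucl n) 𝓘(ℝ, ℝ) 2 r) {u : M}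
    (hlam : ContDiffAt ℝ 2 lam (r u)) (hpos : 0 < lam (r u)) (a b : Eucl n) :
    covDeriv (prodModel n) (warpedMetric (metricForm g) lam) (graph r) u a b
      = (fderiv ℝ (fderiv ℝ (inChart r u)) (extChartAt 𝓘(ℝ, Eucl n) u u) a b, 0)
        + gammaCLM (warp (chartMetric 𝓘(ℝ, Eucl n) (metricForm g) u) lam)
          (r u, extChartAt 𝓘(ℝ, Eucl n) u u)
          (fderiv ℝ (inChart r u) (extChartAt 𝓘(ℝ, Eucl n) u u) a, a)
          (fderiv ℝ (inChart r u) (extChartAt 𝓘(ℝ, Eucl n) u u) b, b) := by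
  set y := extChartAt 𝓘(ℝ, Eucl n) u u with hy
  have hyt : y ∈ (extChartAt 𝓘(ℝ, Eucl n) u).target := mem_extChartAt_target u
  have hw := writtenInExtChartAt_graph (n := n) r u
  rw [← hy] at hw
  have hD := fun {z : Eucl n} hz => hasFDerivAt_graph (m := 2) hr two_ne_zero (u := u) (y := z) hz
  set x : Eucl n → Amb n := fun y => (inChart r u y, y)
  have hx2 : ContDiffAt ℝ 2 x y := (contDiffAt_inChart (m := 2) hr hyt).prodMk contDiffAt_id
  have hD1 : fderiv ℝ x =ᶠ[𝓝 y]
      fun z => (fderiv ℝ (inChart r u) z).prod (ContinuousLinearMap.id ℝ (Eucl n)) := by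
    filter_upwards [(isOpen_extChartAt_target (I := 𝓘(ℝ, Eucl n)) u).mem_nhds
      (mem_extChartAt_target u)] with z hz
    exact (hD hz).fderiv
  have hd2 : DifferentiableAt ℝ (fderiv ℝ (inChart r u)) y :=
    ((contDiffAt_inChart (m := 2) hr hyt).fderiv_right (m := 1) (by norm_num)).differentiableAt
      one_ne_zero
  have hD2 : fderiv ℝ (fderiv ℝ x) y a b = (fderiv ℝ (fderiv ℝ (inChart r u)) y a b, 0) := by
    have h0 : DifferentiableAt ℝ (fderiv ℝ x) y :=
      (hx2.fderiv_right (m := 1) (by norm_num)).differentiableAt one_ne_zero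
    have h1 := (hd2.hasFDerivAt.clm_apply (hasFDerivAt_const b y)).prodMk (hasFDerivAt_const b y)
    have h2 := (h0.hasFDerivAt.clm_apply (hasFDerivAt_const b y)).congr_of_eventuallyEq
      (f₁ := fun z => (fderiv ℝ (inChart r u) z b, b)) (by
        filter_upwards [hD1] with z hz
        rw [hz]; rfl)
    have := congrArg (fun L => L a) (h2.unique h1)
    simpa using this
  have hxy : writtenInExtChartAt 𝓘(ℝ, Eucl n) (prodModel n) u (graph r) y = (r u, y) := by
    rw [hw.eq_of_nhds]
    exact Prod.ext (inChart_self r u) rfl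
  have hG := eventually_chartMetric_warpedMetric (metricForm g) lam (p := graph r u)
    (z := (r u, y)) hyt
  rw [covDeriv]
  simp only [← hy]
  rw [hw.fderiv.fderiv_eq, hw.fderiv.eq_of_nhds, hD2, hxy, hD1.eq_of_nhds]
  rw [christoffel_eq_gammaCLM, gammaCLM_congr hG]
  rfl

end GraphGeometry

/-! ### Fundamental forms of the graph in terms of φ = ψ ∘ r -/

section GraphCurvature

set_option maxSynthPendingDepth 3

open Filter Topology ContinuousLinearMap
open scoped Matrix

/-- `ψ` is a primitive of `1 / lam` on the open set `I`. -/
structure RadialPotential (I : Set ℝ) (lam ψ : ℝ → ℝ) : Prop where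
  isOpen : IsOpen I
  contDiffOn_lam : ContDiffOn ℝ 2 lam I
  pos : ∀ s ∈ I, 0 < lam s
  contDiffOn : ContDiffOn ℝ 3 ψ I
  hasDerivAt : ∀ s ∈ I, HasDerivAt ψ (lam s)⁻¹ s

namespace RadialPotential

variable {I : Set ℝ} {lam ψ : ℝ → ℝ} {s : ℝ}

theorem lam_at (h : RadialPotential I lam ψ) (hs : s ∈ I) : ContDiffAt ℝ 2 lam s :=
  h.contDiffOn_lam.contDiffAt (h.isOpen.mem_nhds hs)

theorem contDiffAt (h : RadialPotential I lam ψ) (hs : s ∈ I) : ContDiffAt ℝ 3 ψ s :=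
  h.contDiffOn.contDiffAt (h.isOpen.mem_nhds hs)

theorem eventually (h : RadialPotential I lam ψ) (hs : s ∈ I) :
    ∀ᶠ t in 𝓝 s, HasDerivAt ψ (lam t)⁻¹ t := by
  filter_upwards [h.isOpen.mem_nhds hs] with t ht using h.hasDerivAt t ht

end RadialPotential

variable {n : ℕ} {M : Type*} [TopologicalSpace M] [ChartedSpace (Eucl n) M]
  [IsManifold 𝓘(ℝ, Eucl n) ∞ M]
  (g : Bundle.ContMDiffRiemannianMetric 𝓘(ℝ, Eucl n) ∞ (Eucl n)
      (fun u : M => TangentSpace 𝓘(ℝ, Eucl n) u))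

/-- The metric of `M` in the preferred chart at `p`. -/
abbrev locMetric (p : M) : Eucl n → Eucl n →L[ℝ] Eucl n →L[ℝ] ℝ :=
  chartMetric 𝓘(ℝ, Eucl n) (metricForm g) p

theorem locMetric_self (u : M) :
    locMetric g u (extChartAt 𝓘(ℝ, Eucl n) u u) = metricForm g u :=
  chartMetric_self _ u

/-- The gradient of `φ : M → ℝ` at `u`. -/
def gradAt (φ : M → ℝ) (u : M) : Eucl n :=
  grad (locMetric g u) (inChart φ u) (extChartAt 𝓘(ℝ, Eucl n) u u)

/-- The squared length of the gradient of `φ : M → ℝ` at `u`. -/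
def gradSqAt (φ : M → ℝ) (u : M) : ℝ :=
  gradSq (locMetric g u) (inChart φ u) (extChartAt 𝓘(ℝ, Eucl n) u u)

/-- The outward unit normal of a radial graph. -/
def graphNormal (lam : ℝ → ℝ) (r φ : M → ℝ) (u : M) : Amb n :=
  (√(1 + gradSqAt g φ u))⁻¹ • (1, -((lam (r u))⁻¹ • gradAt g φ u))

theorem gradSqAt_eq (φ : M → ℝ) (u : M) :
    gradSqAt g φ u = metricForm g u (gradAt g φ u) (gradAt g φ u) := by
  rw [gradSqAt, (riemAt_chartMetric g (mem_extChartAt_target u)).gradSq_eq, chartMetric_self]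
  rfl

theorem gradSqAt_nonneg (φ : M → ℝ) (u : M) : 0 ≤ gradSqAt g φ u := by
  rw [gradSqAt, (riemAt_chartMetric g (mem_extChartAt_target u)).gradSq_eq]
  exact (riemAt_chartMetric g (mem_extChartAt_target u)).nonneg _

theorem metricForm_gradAt (φ : M → ℝ) (u : M) (X : Eucl n) :
    metricForm g u (gradAt g φ u) X
      = fderiv ℝ (inChart φ u) (extChartAt 𝓘(ℝ, Eucl n) u u) X := by
  have := (riemAt_chartMetric g (mem_extChartAt_target u)).apply_grad (φ := inChart φ u) X
  rwa [chartMetric_self] at this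

variable {I : Set ℝ} {lam ψ : ℝ → ℝ} {r : M → ℝ}

theorem fderiv_inChart_radial (hψ : RadialPotential I lam ψ)
    (hr : ContMDiff 𝓘(ℝ, Eucl n) 𝓘(ℝ, ℝ) 3 r) {u : M} (hu : r u ∈ I) (X : Eucl n) :
    fderiv ℝ (inChart r u) (extChartAt 𝓘(ℝ, Eucl n) u u) X = lam (r u)
      * fderiv ℝ (inChart (fun u => ψ (r u)) u) (extChartAt 𝓘(ℝ, Eucl n) u u) X := by
  have hs := inChart_self (n := n) r u
  have h1 := (contDiffAt_inChart (m := 3) hr (mem_extChartAt_target u)).differentiableAt three_ne_zero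
  have h2 : fderiv ℝ (inChart r u) (extChartAt 𝓘(ℝ, Eucl n) u u) = _ :=
    fderiv_comp_radial (lam := lam) (ψ := ψ) h1 (by rw [hs]; exact hψ.hasDerivAt _ hu)
      (by rw [hs]; exact hψ.pos _ hu)
  rw [h2, hs]
  rfl

theorem isOuterNormal_graphNormal (hψ : RadialPotential I lam ψ)
    (hr : ContMDiff 𝓘(ℝ, Eucl n) 𝓘(ℝ, ℝ) 3 r) {u : M} (hu : r u ∈ I) :
    IsOuterNormal (metricForm g) lam r u (graphNormal g lam r (fun u => ψ (r u)) u) := by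
  set φ : M → ℝ := fun u => ψ (r u) with hφ
  have hl := hψ.pos _ hu
  have hp := gradSqAt_nonneg g φ u
  set p := gradSqAt g φ u with hpdef
  have hv : 0 < √(1 + p) := Real.sqrt_pos.2 (by linarith)
  have hv2 : √(1 + p) ^ 2 = 1 + p := Real.sq_sqrt (by linarith)
  have hN : (graphNormal g lam r φ u) = ((√(1 + p))⁻¹, -((√(1 + p))⁻¹ • ((lam (r u))⁻¹ • gradAt g φ u))) := by
    rw [graphNormal, ← hpdef]; ext1 <;> simp
  refine ⟨⟨?_, fun a => ?_⟩, ?_⟩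
  · rw [warpedMetric_apply, hN]
    simp only [graph, map_neg, neg_apply, map_smul, smul_apply, smul_eq_mul]
    rw [← gradSqAt_eq, ← hpdef]
    field_simp
    rw [hv2]
  · rw [warpedMetric_apply, hN, differential_graph (hr.of_le (by norm_num))]
    simp only [graph, map_neg, neg_apply, map_smul, smul_apply, smul_eq_mul]
    rw [fderiv_inChart_radial hψ hr hu, metricForm_gradAt]
    field_simp
    ring
  · rw [warpedMetric_apply, hN]
    simpa [graph] using hv

theorem linearIndependent_stdVec : LinearIndependent ℝ (stdVec : Fin n → Eucl n) := by
  have := (EuclideanSpace.basisFun (Fin n) ℝ).orthonormal.linearIndependent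
  have e : (EuclideanSpace.basisFun (Fin n) ℝ : Fin n → Eucl n) = stdVec := by
    ext1 i; exact EuclideanSpace.basisFun_apply _ _ i
  rwa [e] at this

theorem eq_sum_stdVec (X : Eucl n) : X = ∑ i, X i • (stdVec i : Eucl n) := by
  have := (EuclideanSpace.basisFun (Fin n) ℝ).sum_repr X
  simpa [stdVec] using this.symm

/-- The matrix `g⁻¹ η` of a radial graph up to the factor `1 / (lam v)`, in the chart at `p`. -/
def graphEta (lam : ℝ → ℝ) (r φ : M → ℝ) (p : M) (y : Eucl n) : Matrix (Fin n) (Fin n) ℝ :=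
  localEta (locMetric g p) (inChart φ p) (fun z => deriv lam (inChart r p z)) stdVec y

theorem firstForm_graph (hψ : RadialPotential I lam ψ)
    (hr : ContMDiff 𝓘(ℝ, Eucl n) 𝓘(ℝ, ℝ) 3 r) {u : M} (hu : r u ∈ I) :
    firstForm (prodModel n) (warpedMetric (metricForm g) lam) (graph r) u
      = lam (r u) ^ 2 • gramMat (gradForm (locMetric g u) (inChart (fun u => ψ (r u)) u)
        (extChartAt 𝓘(ℝ, Eucl n) u u)) stdVec := by
  ext i j
  rw [firstForm, Matrix.of_apply, differential_graph (hr.of_le (by norm_num)),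
    differential_graph (hr.of_le (by norm_num)), warpedMetric_apply,
    fderiv_inChart_radial hψ hr hu, fderiv_inChart_radial hψ hr hu, Matrix.smul_apply,
    gramMat_apply, gradForm_apply, locMetric_self]
  simp only [graph, smul_eq_mul]
  ring

/-- With D²r = λD²φ + λλ' dφ ⊗ dφ, the mixed Christoffel symbols, paired with ν, contribute −2λλ' dφ
⊗ dφ over v. The sign of the gradient term is thereby reversed, and it joins λ'g' to form λ'P. -/
theorem secondForm_graph (hψ : RadialPotential I lam ψ)
    (hr : ContMDiff 𝓘(ℝ, Eucl n) 𝓘(ℝ, ℝ) 3 r) {u : M} (hu : r u ∈ I) :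
    secondForm (prodModel n) (warpedMetric (metricForm g) lam) (graph r) u
        (graphNormal g lam r (fun u => ψ (r u)) u)
      = (lam (r u) * (√(1 + gradSqAt g (fun u => ψ (r u)) u))⁻¹) •
        (deriv lam (r u) • gramMat (gradForm (locMetric g u) (inChart (fun u => ψ (r u)) u)
          (extChartAt 𝓘(ℝ, Eucl n) u u)) stdVec
          - gramMat (hess (locMetric g u) (inChart (fun u => ψ (r u)) u)
            (extChartAt 𝓘(ℝ, Eucl n) u u)) stdVec) := by
  ext i j
  have hl := hψ.pos _ hu
  have hlam := hψ.lam_at hu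
  have hs := inChart_self (n := n) r u
  set y := extChartAt 𝓘(ℝ, Eucl n) u u with hy
  have hev := eventually_riemAt_chartMetric g (mem_extChartAt_target u)
  have hD2 := fun X Y => fderiv_fderiv_comp_radial (ρ := inChart r u) (lam := lam) (ψ := ψ) (y := y)
    ((contDiffAt_inChart (m := 3) hr (mem_extChartAt_target u)).of_le (by norm_num))
    (by rw [hs]; exact hψ.eventually hu)
    (by rw [hs]; exact hlam.differentiableAt two_ne_zero) (by rw [hs]; exact hl)
    (by rw [hs]; exact (hψ.contDiffAt hu).of_le (by norm_num)) X Y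
  change ∀ X Y, _ = lam (inChart r u y) * fderiv ℝ (fderiv ℝ (inChart (fun u => ψ (r u)) u)) y X Y
    + lam (inChart r u y) * deriv lam (inChart r u y)
      * fderiv ℝ (inChart (fun u => ψ (r u)) u) y X
      * fderiv ℝ (inChart (fun u => ψ (r u)) u) y Y at hD2
  rw [hs] at hD2
  rw [secondForm, Matrix.of_apply, covDeriv_graph g (hr.of_le (by norm_num)) hlam hl,
    gamma_warp (z := (r u, extChartAt 𝓘(ℝ, Eucl n) u u)) hev hlam hl, warpedMetric_apply,
    fderiv_inChart_radial hψ hr hu, fderiv_inChart_radial hψ hr hu, ← hy, hD2]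
  simp only [Matrix.smul_apply, Matrix.sub_apply, gramMat_apply, gradForm_apply, hess_apply,
    graphNormal, graph, Prod.smul_mk, Prod.fst_add, Prod.snd_add, smul_neg, map_neg, map_smul,
    smul_eq_mul, zero_add, metricForm_symm g u _ (gradAt g (fun u => ψ (r u)) u)]
  simp only [map_add, map_smul, smul_eq_mul, metricForm_gradAt, ← hy]
  have hc : chartMetric 𝓘(ℝ, Eucl n) (metricForm g) u y = metricForm g u := chartMetric_self _ u
  simp only [locMetric, hc]
  field_simp
  ring

/-- `σ_j(μ(η))` of a radial graph. -/
theorem sigmaEta_graph (hψ : RadialPotential I lam ψ)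
    (hr : ContMDiff 𝓘(ℝ, Eucl n) 𝓘(ℝ, ℝ) 3 r) {u : M} (hu : r u ∈ I) (j : ℕ) :
    sigmaEta n (prodModel n) (warpedMetric (metricForm g) lam) (graph r) j u
        (graphNormal g lam r (fun u => ψ (r u)) u)
      = ((lam (r u) * √(1 + gradSqAt g (fun u => ψ (r u)) u))⁻¹) ^ j
        * sigmaEig j (graphEta g lam r (fun u => ψ (r u)) u (extChartAt 𝓘(ℝ, Eucl n) u u)) := by
  have hl := hψ.pos _ hu
  have h0 := riemAt_chartMetric g (mem_extChartAt_target u)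
  have hP := gramMat_posDef (fun X Y => h0.gradForm_symm (φ := inChart (fun u => ψ (r u)) u) X Y)
    h0.gradForm_pos (linearIndependent_stdVec (n := n))
  have hφ : ContDiffAt ℝ 2 (inChart (fun u => ψ (r u)) u) (extChartAt 𝓘(ℝ, Eucl n) u u) := by
    have h1 : ContDiffAt ℝ 3 ψ (inChart r u (extChartAt 𝓘(ℝ, Eucl n) u u)) := by
      rw [inChart_self]; exact hψ.contDiffAt hu
    exact (h1.comp _ (contDiffAt_inChart (m := 3) hr (mem_extChartAt_target u))).of_le (by norm_num)
  have hS : (gramMat (hess (locMetric g u) (inChart (fun u => ψ (r u)) u)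
      (extChartAt 𝓘(ℝ, Eucl n) u u)) (stdVec : Fin n → Eucl n))ᵀ
      = gramMat (hess (locMetric g u) (inChart (fun u => ψ (r u)) u)
        (extChartAt 𝓘(ℝ, Eucl n) u u)) stdVec := by
    ext i j
    exact hess_symm (eventually_riemAt_chartMetric g (mem_extChartAt_target u)) hφ _ _
  -- The scale factors are λ² for the first form and λ/v for the second, whence the factor 1/(λv) on
  -- the eigenvalues.
  have h1 := eta_conj (R := 1) (c := deriv lam (r u))
    (g := firstForm (prodModel n) (warpedMetric (metricForm g) lam) (graph r) u)
    (h := secondForm (prodModel n) (warpedMetric (metricForm g) lam) (graph r) u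
      (graphNormal g lam r (fun u => ψ (r u)) u)) hP (by simp)
    (pow_ne_zero 2 hl.ne')
    (by rw [Matrix.transpose_one, Matrix.one_mul, Matrix.mul_one]; exact firstForm_graph g hψ hr hu)
    (by rw [Matrix.transpose_one, Matrix.one_mul, Matrix.mul_one]; exact secondForm_graph g hψ hr hu)
  rw [inv_one, Matrix.one_mul, Matrix.mul_one] at h1
  rw [sigmaEta, etaMatrix, h1, sigmaEig_smul_etaMat hP hS]
  congr 2
  · field_simp
  · rw [graphEta, localEta, inChart_self]

section Transition

variable {φ : M → ℝ} {p : M} {y : Eucl n}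

/-- The transition map to the preferred chart at the point with coordinates `y`. -/
def toCentre (p : M) (y : Eucl n) : Eucl n → Eucl n :=
  extChartAt 𝓘(ℝ, Eucl n) ((extChartAt 𝓘(ℝ, Eucl n) p).symm y) ∘ (extChartAt 𝓘(ℝ, Eucl n) p).symm

theorem toCentre_self (p : M) (y : Eucl n) :
    toCentre p y y = extChartAt 𝓘(ℝ, Eucl n) ((extChartAt 𝓘(ℝ, Eucl n) p).symm y)
      ((extChartAt 𝓘(ℝ, Eucl n) p).symm y) := rfl

theorem contDiffAt_toCentre (hy : y ∈ (extChartAt 𝓘(ℝ, Eucl n) p).target) :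
    ContDiffAt ℝ ∞ (toCentre p y) y :=
  contDiffAt_transition hy (mem_extChartAt_source _)

theorem eventually_symm_mem_source (hy : y ∈ (extChartAt 𝓘(ℝ, Eucl n) p).target) :
    ∀ᶠ z in 𝓝 y, z ∈ (extChartAt 𝓘(ℝ, Eucl n) p).target ∧
      (extChartAt 𝓘(ℝ, Eucl n) p).symm z
        ∈ (extChartAt 𝓘(ℝ, Eucl n) ((extChartAt 𝓘(ℝ, Eucl n) p).symm y)).source := by
  have := (mdifferentiableAt_extChartAt_symm' hy).continuousAt.preimage_mem_nhds
    ((isOpen_extChartAt_source (I := 𝓘(ℝ, Eucl n)) _).mem_nhds (mem_extChartAt_source _))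
  filter_upwards [this, (isOpen_extChartAt_target (I := 𝓘(ℝ, Eucl n)) p).mem_nhds hy]
    with z h1 h2 using ⟨h2, h1⟩

theorem eventually_locMetric_pullback (hy : y ∈ (extChartAt 𝓘(ℝ, Eucl n) p).target) :
    ∀ᶠ z in 𝓝 y, ∀ X Y, locMetric g p z X Y
      = locMetric g ((extChartAt 𝓘(ℝ, Eucl n) p).symm y) (toCentre p y z)
        (fderiv ℝ (toCentre p y) z X) (fderiv ℝ (toCentre p y) z Y) := by
  filter_upwards [eventually_symm_mem_source hy] with z hz X Y
    using chartMetric_transition _ hz.1 hz.2 X Y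

theorem eventually_inChart_pullback (hy : y ∈ (extChartAt 𝓘(ℝ, Eucl n) p).target) :
    ∀ᶠ z in 𝓝 y, inChart φ p z
      = inChart φ ((extChartAt 𝓘(ℝ, Eucl n) p).symm y) (toCentre p y z) := by
  filter_upwards [eventually_symm_mem_source hy] with z hz
  rw [inChart, inChart, toCentre, Function.comp_apply, PartialEquiv.left_inv _ hz.2]

theorem surjective_fderiv_toCentre (hy : y ∈ (extChartAt 𝓘(ℝ, Eucl n) p).target) :
    Function.Surjective (fderiv ℝ (toCentre p y) y) := by
  have h := chartFrame_injective hy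
  rw [chartFrame_comp_fderiv hy] at h
  exact LinearMap.injective_iff_surjective.1 h

theorem fderiv_inChart_pullback (hφ : ContMDiff 𝓘(ℝ, Eucl n) 𝓘(ℝ, ℝ) 3 φ)
    (hy : y ∈ (extChartAt 𝓘(ℝ, Eucl n) p).target) (X : Eucl n) :
    fderiv ℝ (inChart φ p) y X = fderiv ℝ (inChart φ ((extChartAt 𝓘(ℝ, Eucl n) p).symm y))
      (toCentre p y y) (fderiv ℝ (toCentre p y) y X) := by
  have h1 : DifferentiableAt ℝ (inChart φ ((extChartAt 𝓘(ℝ, Eucl n) p).symm y)) (toCentre p y y) :=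
    (contDiffAt_inChart (m := 3) hφ (mem_extChartAt_target _)).differentiableAt three_ne_zero
  have h2 := (contDiffAt_toCentre hy).differentiableAt (by simp)
  have h3 := EventuallyEq.fderiv_eq (𝕜 := ℝ) (f₁ := inChart φ p)
    (f := inChart φ ((extChartAt 𝓘(ℝ, Eucl n) p).symm y) ∘ toCentre p y)
    (eventually_inChart_pullback hy)
  rw [h3, fderiv_comp y h1 h2]
  rfl

theorem fderiv_toCentre_grad (hφ : ContMDiff 𝓘(ℝ, Eucl n) 𝓘(ℝ, ℝ) 3 φ)
    (hy : y ∈ (extChartAt 𝓘(ℝ, Eucl n) p).target) :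
    fderiv ℝ (toCentre p y) y (grad (locMetric g p) (inChart φ p) y)
      = gradAt g φ ((extChartAt 𝓘(ℝ, Eucl n) p).symm y) := by
  set u := (extChartAt 𝓘(ℝ, Eucl n) p).symm y
  have h0 := riemAt_chartMetric g hy
  have h0' := riemAt_chartMetric g (mem_extChartAt_target u)
  refine h0'.ext_left fun Z => ?_
  obtain ⟨W, rfl⟩ := surjective_fderiv_toCentre hy Z
  have h1 := (eventually_locMetric_pullback g hy).self_of_nhds
    (grad (locMetric g p) (inChart φ p) y) W
  rw [h0.apply_grad, fderiv_inChart_pullback hφ hy] at h1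
  rw [gradAt, h0'.apply_grad]
  exact h1.symm

theorem gradSq_inChart (hφ : ContMDiff 𝓘(ℝ, Eucl n) 𝓘(ℝ, ℝ) 3 φ)
    (hy : y ∈ (extChartAt 𝓘(ℝ, Eucl n) p).target) :
    gradSq (locMetric g p) (inChart φ p) y = gradSqAt g φ ((extChartAt 𝓘(ℝ, Eucl n) p).symm y) := by
  rw [gradSq, fderiv_inChart_pullback hφ hy, fderiv_toCentre_grad g hφ hy]
  rfl

/-- P and ∇²φ are tensors, so the differential of the transition map changes their matrices by a
congruence. The hypotheses are stated at each point in its own chart; this carries the equation to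
one fixed chart, where it can be differentiated. -/
theorem sigmaEig_graphEta (hφ : ContMDiff 𝓘(ℝ, Eucl n) 𝓘(ℝ, ℝ) 3 φ)
    (hy : y ∈ (extChartAt 𝓘(ℝ, Eucl n) p).target) (j : ℕ) :
    sigmaEig j (graphEta g lam r φ p y)
      = sigmaEig j (graphEta g lam r φ ((extChartAt 𝓘(ℝ, Eucl n) p).symm y) (toCentre p y y)) := by
  set u := (extChartAt 𝓘(ℝ, Eucl n) p).symm y with hu
  set A := fderiv ℝ (toCentre p y) y with hA
  set Q : Matrix (Fin n) (Fin n) ℝ := Matrix.of fun i j => A (stdVec j) i with hQ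
  have hcol : (fun j => ∑ i, Q i j • (stdVec i : Eucl n)) = fun j => A (stdVec j) := by
    ext1 j
    exact (eq_sum_stdVec (A (stdVec j))).symm
  have hQdet : IsUnit Q.det := by
    rw [← Matrix.isUnit_iff_isUnit_det, ← Matrix.mulVec_injective_iff_isUnit]
    have hinj : Function.Injective A :=
      LinearMap.injective_iff_surjective.2 (surjective_fderiv_toCentre hy)
    intro x x' hxx
    have e : ∀ x : Fin n → ℝ, A (∑ j, x j • stdVec j) = ∑ i, (Q.mulVec x) i • stdVec i := by
      intro x
      simp only [map_sum, map_smul, Matrix.mulVec, dotProduct, Finset.sum_smul]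
      rw [Finset.sum_comm]
      refine Finset.sum_congr rfl fun j _ => ?_
      rw [← congrFun hcol j, Finset.smul_sum]
      exact Finset.sum_congr rfl fun i _ => by rw [smul_smul, mul_comm]
    have h1 : ∑ j, x j • (stdVec j : Eucl n) = ∑ j, x' j • stdVec j :=
      hinj (by rw [e, e]; simp only [hxx])
    have h2 : ∑ j, (x j - x' j) • (stdVec j : Eucl n) = 0 := by
      simp only [sub_smul, Finset.sum_sub_distrib, h1, sub_self]
    ext j
    exact sub_eq_zero.1 (Fintype.linearIndependent_iff.1 linearIndependent_stdVec _ h2 j)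
  have h1 : gramMat (gradForm (locMetric g p) (inChart φ p) y) stdVec
      = gramMat (gradForm (locMetric g u) (inChart φ u) (toCentre p y y)) fun j => A (stdVec j) := by
    ext i j
    rw [gramMat_apply, gramMat_apply, gradForm_apply, gradForm_apply,
      fderiv_inChart_pullback hφ hy, fderiv_inChart_pullback hφ hy,
      (eventually_locMetric_pullback g hy).self_of_nhds]
  have h2 : gramMat (hess (locMetric g p) (inChart φ p) y) stdVec
      = gramMat (hess (locMetric g u) (inChart φ u) (toCentre p y y)) fun j => A (stdVec j) := by
    ext i j
    exact hess_pullback ((contDiffAt_toCentre hy).of_le (by norm_cast))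
      (eventually_riemAt_chartMetric g hy)
      (eventually_riemAt_chartMetric g (mem_extChartAt_target u))
      (eventually_locMetric_pullback g hy) (surjective_fderiv_toCentre hy)
      ((contDiffAt_inChart (m := 3) hφ (mem_extChartAt_target u)).of_le (by norm_num))
      (eventually_inChart_pullback hy) _ _
  have h3 : inChart r p y = inChart r u (toCentre p y y) :=
    (eventually_inChart_pullback hy).self_of_nhds
  have h4 := sigmaEig_localEta_sum (locMetric g u) (inChart φ u)
    (fun z => deriv lam (inChart r u z)) stdVec (toCentre p y y) hQdet j
  rw [hcol] at h4
  rw [graphEta, graphEta, ← h4, localEta, localEta, h1, h2, h3]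

end Transition

end GraphCurvature

/-! ### Differentiating functions of a point and a unit normal -/

section TangentFunctions

set_option maxSynthPendingDepth 3

open Filter Topology ContinuousLinearMap

section General

variable {F H N : Type*} [NormedAddCommGroup F] [NormedSpace ℝ F] [TopologicalSpace H]
  [TopologicalSpace N] [ChartedSpace H N] {J : ModelWithCorners ℝ F H} [J.Boundaryless]
  [IsManifold J ∞ N] {f : TangentBundle J N → ℝ} {p : N} {ξ : F}

theorem differentiableAt_chartFun (hf : ContMDiffAt J.tangent 𝓘(ℝ, ℝ) 1 f ⟨p, ξ⟩) :
    DifferentiableAt ℝ (chartFun f p) (extChartAt J p p, ξ) := by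
  have h1 := contMDiffAt_chartFrame (J := J) (p := p) (z := (extChartAt J p p, ξ))
    (mem_extChartAt_target p)
  have e : (⟨(extChartAt J p).symm (extChartAt J p p), chartFrame J p (extChartAt J p p) ξ⟩ :
      TangentBundle J N) = ⟨p, ξ⟩ := by
    rw [chartFrame_self, extChartAt_to_inv]
    rfl
  have h2 := ContMDiffAt.comp (extChartAt J p p, ξ) (by simp only [e]; exact hf)
    (h1.of_le (by norm_cast) : ContMDiffAt _ _ 1 _ _)
  exact h2.contDiffAt.differentiableAt one_ne_zero

theorem horDeriv_eq (G : N → F →L[ℝ] F →L[ℝ] ℝ) (f : TangentBundle J N → ℝ) (p : N) (ξ X : F) :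
    horDeriv G f p ξ X = fderiv ℝ (chartFun f p) (extChartAt J p p, ξ)
      (X, -gammaCLM (chartMetric J G p) (extChartAt J p p) X ξ) := rfl

theorem horDeriv_sub_smul (G : N → F →L[ℝ] F →L[ℝ] ℝ) (f : TangentBundle J N → ℝ) (p : N)
    (ξ X Y : F) (a b : ℝ) : horDeriv G f p ξ (a • X - b • Y)
      = a * horDeriv G f p ξ X - b * horDeriv G f p ξ Y := by
  simp only [horDeriv_eq, ← smul_eq_mul, ← map_smul, ← map_sub]
  congr 1
  ext1
  · simp
  · simp only [map_sub, map_smul, sub_apply, smul_apply, Prod.smul_mk, Prod.mk_sub_mk, smul_neg]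
    abel

theorem vertDeriv_eq (hf : DifferentiableAt ℝ (chartFun f p) (extChartAt J p p, ξ)) (Y : F) :
    vertDeriv f p ξ Y = fderiv ℝ (chartFun f p) (extChartAt J p p, ξ) (0, Y) := by
  have e : (fun ζ : F => f ⟨p, ζ⟩) = fun ζ => chartFun f p (extChartAt J p p, ζ) := by
    ext1 ζ
    rw [chartFun, chartFrame_self, extChartAt_to_inv]
    rfl
  have h : HasFDerivAt (fun ζ => chartFun f p (extChartAt J p p, ζ)) _ ξ :=
    hf.hasFDerivAt.comp ξ ((hasFDerivAt_const (extChartAt J p p) ξ).prodMk (hasFDerivAt_id ξ))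
  rw [vertDeriv, e, h.fderiv]
  rfl

/-- A fibre velocity Z over X consists of the parallel part −Γ(X, ξ), which belongs to the
horizontal derivative, and the covariant derivative Z + Γ(X, ξ), which is vertical. -/
theorem fderiv_chartFun (G : N → F →L[ℝ] F →L[ℝ] ℝ)
    (hf : DifferentiableAt ℝ (chartFun f p) (extChartAt J p p, ξ)) (X Z : F) :
    fderiv ℝ (chartFun f p) (extChartAt J p p, ξ) (X, Z) = horDeriv G f p ξ X
      + vertDeriv f p ξ (Z + gammaCLM (chartMetric J G p) (extChartAt J p p) X ξ) := by
  rw [vertDeriv_eq hf, horDeriv_eq, ← map_add]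
  congr 1
  ext1 <;> simp

end General

variable {n : ℕ} {M : Type*} [TopologicalSpace M] [ChartedSpace (Eucl n) M]
  [IsManifold 𝓘(ℝ, Eucl n) ∞ M]
  (g : Bundle.ContMDiffRiemannianMetric 𝓘(ℝ, Eucl n) ∞ (Eucl n)
      (fun u : M => TangentSpace 𝓘(ℝ, Eucl n) u)) {I : Set ℝ} {lam ψ : ℝ → ℝ} {r : M → ℝ}

/-- The outward unit normal of a radial graph in the chart at `p`. -/
def chartNormal (lam : ℝ → ℝ) (r φ : M → ℝ) (p : M) (y : Eucl n) : Amb n :=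
  (√(1 + gradSq (locMetric g p) (inChart φ p) y))⁻¹ •
    (1, -((lam (inChart r p y))⁻¹ • grad (locMetric g p) (inChart φ p) y))

theorem chartFun_chartNormal {φ : M → ℝ} (hφ : ContMDiff 𝓘(ℝ, Eucl n) 𝓘(ℝ, ℝ) 3 φ)
    (f : TangentBundle (prodModel n) (ℝ × M) → ℝ) (s : ℝ) {p : M} {y : Eucl n}
    (hy : y ∈ (extChartAt 𝓘(ℝ, Eucl n) p).target) :
    chartFun f (s, p) ((inChart r p y, y), chartNormal g lam r φ p y)
      = f ⟨graph r ((extChartAt 𝓘(ℝ, Eucl n) p).symm y),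
        graphNormal g lam r φ ((extChartAt 𝓘(ℝ, Eucl n) p).symm y)⟩ := by
  have h1 : chartFrame (prodModel n) ((s, p) : ℝ × M) (inChart r p y, y)
      (chartNormal g lam r φ p y)
      = graphNormal g lam r φ ((extChartAt 𝓘(ℝ, Eucl n) p).symm y) := by
    rw [chartFrame_prodModel (p := (s, p)) hy, chartNormal, graphNormal, gradSq_inChart g hφ hy]
    have h2 := fderiv_toCentre_grad g hφ hy
    simp only [chartFrame_comp_fderiv hy, Prod.smul_mk, map_smul, map_neg]
    erw [h2]
    rfl
  rw [chartFun, h1, extChartAt_prodModel_symm_apply]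
  rfl

/-- At a critical point, the covariant derivative of the normal along the gradient is tangential. -/
theorem fderiv_normal_of_critical {F : Type*} [NormedAddCommGroup F] [NormedSpace ℝ F]
    [FiniteDimensional ℝ F] {g : F → F →L[ℝ] F →L[ℝ] ℝ} {φ ρ : F → ℝ} {x : F} {α p v : ℝ}
    (h : ∀ᶠ z in 𝓝 x, RiemAt g z) (hφ : ContDiffAt ℝ 3 φ x) (hlam : ContDiffAt ℝ 2 lam (ρ x))
    (hpos : 0 < lam (ρ x)) (hρ : DifferentiableAt ℝ ρ x) (hp : gradSq g φ x = p)
    (hv : √(1 + p) = v) (hρN : fderiv ℝ ρ x (grad g φ x) = lam (ρ x) * p)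
    (hcrit : ∀ X, hess g φ x X (grad g φ x) = α * (1 + p) * fderiv ℝ φ x X) :
    ∃ L : F →L[ℝ] ℝ × F, HasFDerivAt (fun y => (√(1 + gradSq g φ y))⁻¹ •
        (((1 : ℝ), -((lam (ρ y))⁻¹ • grad g φ y)) : ℝ × F)) L x ∧
      L (grad g φ x) + gammaCLM (warp g lam) (ρ x, x) (lam (ρ x) * p, grad g φ x)
          ((√(1 + p))⁻¹ • ((1 : ℝ), -((lam (ρ x))⁻¹ • grad g φ x)))
        = ((deriv lam (ρ x) - α) / (lam (ρ x) * v)) • (lam (ρ x) * p, grad g φ x) := by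
  have h0 := h.self_of_nhds
  have hgN : g x (grad g φ x) (grad g φ x) = p := by rw [← h0.gradSq_eq, hp]
  have hp0 : 0 ≤ p := hgN ▸ h0.nonneg _
  have hv0 : 0 < v := hv ▸ Real.sqrt_pos.2 (by linarith)
  have hv2 : v ^ 2 = 1 + p := by rw [← hv, Real.sq_sqrt (by linarith)]
  have hφ2 : ContDiffAt ℝ 2 φ x := hφ.of_le (by norm_num)
  have d1 : HasFDerivAt (fun y => 1 + gradSq g φ y) (fderiv ℝ (gradSq g φ) x) x :=
    ((h0.contDiffAt_gradSq hφ).differentiableAt (by norm_num)).hasFDerivAt.const_add 1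
  have d2 : HasFDerivAt (fun y => (√(1 + gradSq g φ y))⁻¹) _ x :=
    (hasDerivAt_inv (by rw [hp, hv]; exact hv0.ne')).comp_hasFDerivAt x
      (d1.sqrt (by rw [hp]; linarith))
  have d3 : HasFDerivAt (fun y => (lam (ρ y))⁻¹) _ x :=
    (hasDerivAt_inv hpos.ne').comp_hasFDerivAt x
      ((hlam.differentiableAt two_ne_zero).hasDerivAt.comp_hasFDerivAt x hρ.hasFDerivAt)
  have d4 : HasFDerivAt (grad g φ) _ x :=
    ((h0.contDiffAt_grad hφ).differentiableAt (by norm_num)).hasFDerivAt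
  have d5 := d2.smul ((hasFDerivAt_const (1 : ℝ) x).prodMk (d3.smul d4).neg)
  refine ⟨_, d5, ?_⟩
  -- Criticality says ∇_N N = α(1 + p)N for N = ∇φ. This makes the lift of N a principal direction
  -- of the graph, with curvature (λ' − α)/(λv).
  have e1 : fderiv ℝ (grad g φ) x (grad g φ x) + gammaCLM g x (grad g φ x) (grad g φ x)
      = (α * (1 + p)) • grad g φ x := by
    refine h0.ext_left fun Z => ?_
    rw [apply_fderiv_grad h hφ, hess_symm h hφ2, hcrit, map_smul, smul_apply, h0.apply_grad,
      smul_eq_mul]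
  have e2 : fderiv ℝ (gradSq g φ) x (grad g φ x) = 2 * (α * (1 + p) * p) := by
    rw [fderiv_gradSq h hφ, hcrit, ← hp]
    rfl
  have e3 : fderiv ℝ (grad g φ) x (grad g φ x)
      = (α * (1 + p)) • grad g φ x - gammaCLM g x (grad g φ x) (grad g φ x) := by
    rw [← e1]; abel
  rw [gamma_warp (z := (ρ x, x)) h hlam hpos]
  have hl := hpos.ne'
  have hvn := hv0.ne'
  simp only [add_apply, smul_apply, smulRight_apply, prod_apply, neg_apply, zero_apply, hp, hv,
    hρN, e2, e3, smul_eq_mul, Pi.smul_apply', Pi.neg_apply, Prod.smul_mk, Prod.mk_add_mk, map_neg, map_smul, hgN]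
  refine Prod.ext ?_ ?_
  · field_simp
    rw [hv2]
    ring
  · simp only
    match_scalars
    · field_simp
      rw [hv2]
      ring
    · field_simp
      ring

end TangentFunctions

/-! ### The derivative of f along the gradient and the monotonicity hypothesis -/

section RightHandSide

set_option maxSynthPendingDepth 3

open Filter Topology ContinuousLinearMap

variable {n : ℕ} {M : Type*} [TopologicalSpace M] [ChartedSpace (Eucl n) M]
  [IsManifold 𝓘(ℝ, Eucl n) ∞ M]
  (g : Bundle.ContMDiffRiemannianMetric 𝓘(ℝ, Eucl n) ∞ (Eucl n)
      (fun u : M => TangentSpace 𝓘(ℝ, Eucl n) u)) {I : Set ℝ} {lam ψ : ℝ → ℝ} {r : M → ℝ}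
  {f : TangentBundle (prodModel n) (ℝ × M) → ℝ}

theorem RadialPotential.contMDiff (hψ : RadialPotential I lam ψ)
    (hr : ContMDiff 𝓘(ℝ, Eucl n) 𝓘(ℝ, ℝ) 3 r) (hI : ∀ u, r u ∈ I) :
    ContMDiff 𝓘(ℝ, Eucl n) 𝓘(ℝ, ℝ) 3 fun u => ψ (r u) := fun u =>
  (hψ.contDiffAt (hI u)).contMDiffAt.comp u hr.contMDiffAt

/-- The tangent vector `lam p ∂_r + ∇φ` of the graph. -/
def gradLift (lam : ℝ → ℝ) (r φ : M → ℝ) (u : M) : Amb n :=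
  (lam (r u) * gradSqAt g φ u, gradAt g φ u)

/-- The coefficient quadratic in v stands only at ∂_r, where monotonicity applies; the coefficient
of ν is linear in v and can be estimated by the C¹ norm. -/
theorem gradLift_eq (lam : ℝ → ℝ) (r φ : M → ℝ) {u : M} (hpos : 0 < lam (r u)) :
    gradLift g lam r φ u = (lam (r u) * (1 + gradSqAt g φ u)) • ((1 : ℝ), (0 : Eucl n))
      - (lam (r u) * √(1 + gradSqAt g φ u)) • graphNormal g lam r φ u := by
  have hp := gradSqAt_nonneg g φ u
  have hv : √(1 + gradSqAt g φ u) ≠ 0 := (Real.sqrt_pos.2 (by linarith)).ne'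
  rw [gradLift, graphNormal, smul_smul, mul_assoc, mul_inv_cancel₀ hv, mul_one]
  have hl := hpos.ne'
  ext1
  · simp; ring
  · simp [smul_smul, hl]

theorem len_gradLift (lam : ℝ → ℝ) (r φ : M → ℝ) {u : M} (hpos : 0 < lam (r u)) :
    len (warpedMetric (metricForm g) lam) (graph r u) (gradLift g lam r φ u)
      = lam (r u) * √(gradSqAt g φ u) * √(1 + gradSqAt g φ u) := by
  have hp := gradSqAt_nonneg g φ u
  rw [len, warpedMetric_apply, mul_assoc, ← Real.sqrt_mul hp]
  simp only [graph, gradLift, ← gradSqAt_eq]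
  rw [← Real.sqrt_sq hpos.le, ← Real.sqrt_mul (sq_nonneg _), Real.sqrt_sq hpos.le]
  congr 1
  ring

/-- The derivative of `f` along the gradient direction of the graph at a critical point. -/
theorem hasDerivAt_along_grad (hψ : RadialPotential I lam ψ)
    (hr : ContMDiff 𝓘(ℝ, Eucl n) 𝓘(ℝ, ℝ) 3 r) (hI : ∀ u, r u ∈ I)
    (hf : IsC1OnUnit (metricForm g) lam I f) {u : M} {α : ℝ}
    (hcrit : ∀ X, hess (locMetric g u) (inChart (fun u => ψ (r u)) u) (extChartAt 𝓘(ℝ, Eucl n) u u)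
      X (gradAt g (fun u => ψ (r u)) u) = α * (1 + gradSqAt g (fun u => ψ (r u)) u)
        * fderiv ℝ (inChart (fun u => ψ (r u)) u) (extChartAt 𝓘(ℝ, Eucl n) u u) X) :
    HasDerivAt (fun t : ℝ => f ⟨graph r ((extChartAt 𝓘(ℝ, Eucl n) u).symm
        (extChartAt 𝓘(ℝ, Eucl n) u u + t • gradAt g (fun u => ψ (r u)) u)),
        graphNormal g lam r (fun u => ψ (r u)) ((extChartAt 𝓘(ℝ, Eucl n) u).symm
        (extChartAt 𝓘(ℝ, Eucl n) u u + t • gradAt g (fun u => ψ (r u)) u))⟩)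
      (horDeriv (warpedMetric (metricForm g) lam) f (graph r u)
          (graphNormal g lam r (fun u => ψ (r u)) u) (gradLift g lam r (fun u => ψ (r u)) u)
        + vertDeriv f (graph r u) (graphNormal g lam r (fun u => ψ (r u)) u)
          (((deriv lam (r u) - α) / (lam (r u) * √(1 + gradSqAt g (fun u => ψ (r u)) u)))
            • gradLift g lam r (fun u => ψ (r u)) u)) 0 := by
  set φ : M → ℝ := fun u => ψ (r u) with hφdef
  have hφ : ContMDiff 𝓘(ℝ, Eucl n) 𝓘(ℝ, ℝ) 3 φ := hψ.contMDiff hr hI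
  set x := extChartAt 𝓘(ℝ, Eucl n) u u with hx
  have hxt : x ∈ (extChartAt 𝓘(ℝ, Eucl n) u).target := mem_extChartAt_target u
  set N := gradAt g φ u with hN
  have hl := hψ.pos _ (hI u)
  have hs : inChart r u x = r u := inChart_self r u
  have hρ : DifferentiableAt ℝ (inChart r u) x :=
    (contDiffAt_inChart (m := 3) hr hxt).differentiableAt three_ne_zero
  have hρN : fderiv ℝ (inChart r u) x N = lam (inChart r u x) * gradSqAt g φ u := by
    rw [hx, fderiv_inChart_radial hψ hr (hI u), inChart_self]
    rfl
  obtain ⟨L, hL, hLN⟩ := fderiv_normal_of_critical (lam := lam) (ρ := inChart r u) (α := α)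
    (p := gradSqAt g φ u) (v := √(1 + gradSqAt g φ u))
    (eventually_riemAt_chartMetric g hxt) (contDiffAt_inChart (m := 3) hφ hxt)
    (by rw [hs]; exact hψ.lam_at (hI u)) (by rw [hs]; exact hl) hρ rfl rfl hρN hcrit
  have hνx : chartNormal g lam r φ u x = graphNormal g lam r φ u := by
    rw [chartNormal, hs]; rfl
  have hL : HasFDerivAt (chartNormal g lam r φ u) L x := hL
  have hnormal := isOuterNormal_graphNormal g hψ hr (hI u)
  have hcf : DifferentiableAt ℝ (chartFun f (graph r u))
      (extChartAt (prodModel n) (graph r u) (graph r u), graphNormal g lam r φ u) :=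
    differentiableAt_chartFun (hf _ _ (hI u) hnormal.1.1)
  have hz : extChartAt (prodModel n) (graph r u) (graph r u) = (inChart r u x, x) := by
    rw [extChartAt_prodModel_apply, hs]; rfl
  have hline : HasDerivAt (fun t : ℝ => x + t • N) N 0 := by
    simpa using ((hasDerivAt_id (0 : ℝ)).smul_const N).const_add x
  have hx0 : x + (0 : ℝ) • N = x := by simp
  have hcont : Tendsto (fun t : ℝ => x + t • N) (𝓝 0) (𝓝 x) := by
    simpa using hline.continuousAt.tendsto
  have hcurve : HasFDerivAt (fun y => ((inChart r u y, y), chartNormal g lam r φ u y)) _ x :=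
    (hρ.hasFDerivAt.prodMk (hasFDerivAt_id x)).prodMk hL
  have hcf' : HasFDerivAt (chartFun f (graph r u)) (fderiv ℝ (chartFun f (graph r u))
      (extChartAt (prodModel n) (graph r u) (graph r u), graphNormal g lam r φ u))
      ((inChart r u x, x), chartNormal g lam r φ u x) := by
    rw [hνx, ← hz]
    exact hcf.hasFDerivAt
  have hd := (hcf'.comp x hcurve).comp_hasDerivAt_of_eq (0 : ℝ) hline hx0.symm
  have hd' := hd.congr_of_eventuallyEq (f₁ := fun t : ℝ => f
      ⟨graph r ((extChartAt 𝓘(ℝ, Eucl n) u).symm (x + t • N)),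
        graphNormal g lam r φ ((extChartAt 𝓘(ℝ, Eucl n) u).symm (x + t • N))⟩) (by
    filter_upwards [hcont.eventually ((isOpen_extChartAt_target (I := 𝓘(ℝ, Eucl n)) u).mem_nhds hxt)]
      with t ht
    exact (chartFun_chartNormal g hφ f (r u) ht).symm)
  refine hd'.congr_deriv ?_
  have h1 := fderiv_chartFun (warpedMetric (metricForm g) lam) hcf
    (gradLift g lam r φ u) (L N)
  have hG := eventually_chartMetric_warpedMetric (metricForm g) lam (p := graph r u)
    (z := (inChart r u x, x)) hxt
  rw [hz, gammaCLM_congr hG] at h1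
  have h2 : (fderiv ℝ (inChart r u) x N, N) = gradLift g lam r φ u := by
    rw [hρN, hs]; rfl
  simp only [comp_apply, prod_apply] at h1 ⊢
  rw [show (ContinuousLinearMap.id ℝ (Eucl n)) N = N from rfl, h2, hz, h1]
  congr 2
  have h3 := hLN
  rw [hs] at h3 ⊢
  exact h3

/-- The derivative of a product `lam ^ (d + 1) * F`. -/
theorem deriv_pow_mul {F : ℝ → ℝ} {s F' lam₁ : ℝ} {d : ℕ} (hd : d ≠ 0)
    (hlam : HasDerivAt lam lam₁ s) (hF : HasDerivAt F F' s) :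
    deriv (fun ρ => lam ρ ^ d * F ρ) s = lam s ^ (d - 1) * (d * lam₁ * F s + lam s * F') := by
  obtain ⟨d, rfl⟩ : ∃ d', d = d' + 1 := ⟨d - 1, by omega⟩
  have h : HasDerivAt (fun ρ => lam ρ ^ (d + 1) * F ρ) _ s := (hlam.pow (d + 1)).mul hF
  rw [h.deriv]
  simp only [Nat.add_sub_cancel, Pi.pow_apply]
  push_cast
  ring

/-- Along ρ ↦ (ρ, u) the vector v⁻¹∂_r + λ(ρ)⁻¹w is parallel, so the derivative in the hypothesis is
horizontal. The positive factor λ^{k−l−1} is divided out. -/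
theorem RadialMonotone.horDeriv_le {k l : ℕ} {r₁ r₂ : ℝ} (hlk : l < k)
    (hmono : RadialMonotone (metricForm g) k l lam r₁ r₂ f) (hψ : RadialPotential I lam ψ)
    (hr : ContMDiff 𝓘(ℝ, Eucl n) 𝓘(ℝ, ℝ) 3 r) (hI : ∀ u, r u ∈ I)
    (hf : IsC1OnUnit (metricForm g) lam I f) {u : M} (hu : r u ∈ Set.Ioo r₁ r₂) :
    ((k : ℝ) - l) * deriv lam (r u) * f ⟨graph r u, graphNormal g lam r (fun u => ψ (r u)) u⟩
      + lam (r u) * horDeriv (warpedMetric (metricForm g) lam) f (graph r u)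
        (graphNormal g lam r (fun u => ψ (r u)) u) (1, 0) ≤ 0 := by
  set φ : M → ℝ := fun u => ψ (r u) with hφdef
  set x := extChartAt 𝓘(ℝ, Eucl n) u u with hx
  have hxt : x ∈ (extChartAt 𝓘(ℝ, Eucl n) u).target := mem_extChartAt_target u
  have hl := hψ.pos _ (hI u)
  have hlam := ((hψ.lam_at (hI u)).differentiableAt two_ne_zero).hasDerivAt
  have hp := gradSqAt_nonneg g φ u
  have hv : 0 < √(1 + gradSqAt g φ u) := Real.sqrt_pos.2 (by linarith)
  have hv2 : √(1 + gradSqAt g φ u) ^ 2 = 1 + gradSqAt g φ u := Real.sq_sqrt (by linarith)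
  set v := √(1 + gradSqAt g φ u) with hvdef
  set w : Eucl n := -(v⁻¹ • gradAt g φ u) with hw
  have hν : graphNormal g lam r φ u = (v⁻¹, (lam (r u))⁻¹ • w) := by
    rw [graphNormal, hw, ← hvdef]
    ext1
    · simp
    · simp only [Prod.smul_mk, smul_neg, smul_smul, mul_comm]
  have hunit : v⁻¹ ^ 2 + metricForm g u w w = 1 := by
    simp only [hw, map_neg, neg_apply, map_smul, smul_apply, smul_eq_mul, ← gradSqAt_eq]
    field_simp
    exact hv2.symm
  have h1 := hmono (r u) hu u v⁻¹ w hunit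
  have hnormal := isOuterNormal_graphNormal g hψ hr (hI u)
  have hcf : DifferentiableAt ℝ (chartFun f (graph r u))
      (extChartAt (prodModel n) (graph r u) (graph r u), graphNormal g lam r φ u) :=
    differentiableAt_chartFun (hf _ _ (hI u) hnormal.1.1)
  have hz : extChartAt (prodModel n) (graph r u) (graph r u) = (r u, x) := by
    rw [extChartAt_prodModel_apply]; rfl
  have hfun : (fun ρ => f ⟨(ρ, u), ((v⁻¹, (lam ρ)⁻¹ • w) : Amb n)⟩)
      = fun ρ => chartFun f (graph r u) ((ρ, x), (v⁻¹, (lam ρ)⁻¹ • w)) := by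
    ext1 ρ
    rw [chartFun, chartFrame_prodModel (p := graph r u) hxt, extChartAt_prodModel_symm_apply]
    change _ = f ⟨(ρ, (extChartAt 𝓘(ℝ, Eucl n) u).symm x),
      (v⁻¹, chartFrame 𝓘(ℝ, Eucl n) u x ((lam ρ)⁻¹ • w))⟩
    rw [hx, chartFrame_self, extChartAt_to_inv]
    rfl
  have hinv : HasDerivAt (fun ρ => (lam ρ)⁻¹) (-deriv lam (r u) / lam (r u) ^ 2) (r u) :=
    hlam.inv hl.ne'
  have hcurve := ((hasDerivAt_id (r u)).prodMk (hasDerivAt_const (r u) x)).prodMk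
    ((hasDerivAt_const (r u) v⁻¹).prodMk (hinv.smul_const w))
  have hd := hcf.hasFDerivAt.comp_hasDerivAt_of_eq (r u) hcurve (by rw [hz, hν]; rfl)
  have hd' : HasDerivAt (fun ρ => f ⟨(ρ, u), ((v⁻¹, (lam ρ)⁻¹ • w) : Amb n)⟩)
      (horDeriv (warpedMetric (metricForm g) lam) f (graph r u) (graphNormal g lam r φ u) (1, 0))
      (r u) := by
    rw [hfun]
    refine hd.congr_deriv ?_
    have hG : chartMetric (prodModel n) (warpedMetric (metricForm g) lam) (graph r u)
        =ᶠ[𝓝 (r u, x)] warp (chartMetric 𝓘(ℝ, Eucl n) (metricForm g) u) lam :=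
      eventually_chartMetric_warpedMetric (metricForm g) lam (p := graph r u) hxt
    rw [horDeriv_eq, hz, gammaCLM_congr hG, gamma_warp (z := (r u, x))
      (eventually_riemAt_chartMetric g hxt) (hψ.lam_at (hI u)) hl, hν]
    congr 2
    have hln := hl.ne'
    ext1
    · simp
    · simp only [map_zero, zero_apply, zero_add, smul_zero, add_zero, smul_smul,
        Prod.neg_mk, ← neg_smul]
      congr 1
      field_simp
  rw [deriv_pow_mul (by omega) hlam hd', ← hν, Nat.cast_sub hlk.le] at h1
  exact nonpos_of_mul_nonpos_right h1 (by positivity)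

/-- The derivative of the prescribed function along the gradient at a critical point. -/
theorem along_grad_le {k l : ℕ} {r₁ r₂ K α : ℝ} (hlk : l < k)
    (hmono : RadialMonotone (metricForm g) k l lam r₁ r₂ f) (hψ : RadialPotential I lam ψ)
    (hr : ContMDiff 𝓘(ℝ, Eucl n) 𝓘(ℝ, ℝ) 3 r) (hI : ∀ u, r u ∈ I)
    (hf : IsC1OnUnit (metricForm g) lam I f) (hK : C1NormLE (metricForm g) lam r₁ r₂ K f)
    {u : M} (hu : r u ∈ Set.Ioo r₁ r₂) (hlam₁ : 0 ≤ deriv lam (r u)) (hα : deriv lam (r u) ≤ α)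
    (hf0 : 0 ≤ f ⟨graph r u, graphNormal g lam r (fun u => ψ (r u)) u⟩) :
    ((k : ℝ) - l) * deriv lam (r u) * gradSqAt g (fun u => ψ (r u)) u
        * f ⟨graph r u, graphNormal g lam r (fun u => ψ (r u)) u⟩
      + (horDeriv (warpedMetric (metricForm g) lam) f (graph r u)
          (graphNormal g lam r (fun u => ψ (r u)) u) (gradLift g lam r (fun u => ψ (r u)) u)
        + vertDeriv f (graph r u) (graphNormal g lam r (fun u => ψ (r u)) u)
          (((deriv lam (r u) - α) / (lam (r u) * √(1 + gradSqAt g (fun u => ψ (r u)) u)))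
            • gradLift g lam r (fun u => ψ (r u)) u))
      ≤ K * √(1 + gradSqAt g (fun u => ψ (r u)) u) * (lam (r u) + α) := by
  have h1 := hmono.horDeriv_le g hlk hψ hr hI hf hu
  set φ : M → ℝ := fun u => ψ (r u) with hφdef
  have hl := hψ.pos _ (hI u)
  have hnormal := isOuterNormal_graphNormal g hψ hr (hI u)
  obtain ⟨hK1, hK2, hK3⟩ := hK (graph r u) (graphNormal g lam r φ u) ⟨hu.1.le, hu.2.le⟩ hnormal.1.1
  have hK0 : 0 ≤ K := (abs_nonneg _).trans hK1
  have hp := gradSqAt_nonneg g φ u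
  set p := gradSqAt g φ u with hpdef
  set v := √(1 + p) with hvdef
  have hv : 0 < v := Real.sqrt_pos.2 (by linarith)
  have hv2 : v ^ 2 = 1 + p := Real.sq_sqrt (by linarith)
  have hpv : √p ≤ v := Real.sqrt_le_sqrt (by linarith)
  set fν := f ⟨graph r u, graphNormal g lam r φ u⟩
  set c := (deriv lam (r u) - α) / (lam (r u) * v) with hc
  have hc0 : |c| = (α - deriv lam (r u)) / (lam (r u) * v) := by
    rw [hc, abs_div, abs_of_pos (mul_pos hl hv), abs_of_nonpos (by linarith), neg_sub]
  -- The lift has length λ√p v, so its multiple by c has length (α − λ')√p, which is at most (α −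
  -- λ')v.
  have hvert : vertDeriv f (graph r u) (graphNormal g lam r φ u) (c • gradLift g lam r φ u)
      ≤ K * (α - deriv lam (r u)) * v := by
    have htan : warpedMetric (metricForm g) lam (graph r u) (graphNormal g lam r φ u)
        (c • gradLift g lam r φ u) = 0 := by
      have h2 := hnormal.1.2 (gradAt g φ u)
      rw [differential_graph (hr.of_le (by norm_num)), fderiv_inChart_radial hψ hr (hI u)] at h2
      rw [map_smul]
      exact (congrArg (c • ·) h2).trans (smul_zero c)
    refine (le_abs_self _).trans ((hK3 _ htan).trans ?_)
    have h3 : len (warpedMetric (metricForm g) lam) (graph r u) (c • gradLift g lam r φ u)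
        = |c| * (lam (r u) * √p * v) := by
      rw [hpdef, hvdef, ← len_gradLift g lam r φ hl, len, len, ← Real.sqrt_sq_eq_abs,
        ← Real.sqrt_mul (sq_nonneg _)]
      congr 1
      simp only [map_smul, smul_apply, smul_eq_mul]
      ring
    rw [h3, hc0]
    have h4 : (α - deriv lam (r u)) / (lam (r u) * v) * (lam (r u) * √p * v)
        = (α - deriv lam (r u)) * √p := by
      field_simp
    rw [h4, mul_assoc]
    have : 0 ≤ α - deriv lam (r u) := by linarith
    gcongr
  have hhor := hK2 (graphNormal g lam r φ u)
  have hlen : len (warpedMetric (metricForm g) lam) (graph r u) (graphNormal g lam r φ u) = 1 := by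
    rw [len, hnormal.1.1, Real.sqrt_one]
  rw [hlen, mul_one] at hhor
  rw [gradLift_eq g lam r φ hl, horDeriv_sub_smul, ← gradLift_eq g lam r φ hl]
  set hν := horDeriv (warpedMetric (metricForm g) lam) f (graph r u) (graphNormal g lam r φ u)
    (graphNormal g lam r φ u)
  set hr' := horDeriv (warpedMetric (metricForm g) lam) f (graph r u) (graphNormal g lam r φ u)
    (1, 0)
  have h5 : -(lam (r u) * v * hν) ≤ lam (r u) * v * K := by
    have := (neg_le_abs hν).trans hhor
    have := mul_le_mul_of_nonneg_left this (mul_pos hl hv).le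
    linarith
  -- Monotonicity comes with the factor 1 + p, whereas only p times (k − l)λ'f has to be absorbed;
  -- the surplus is nonnegative.
  have h6 : (1 + p) * (((k : ℝ) - l) * deriv lam (r u) * fν + lam (r u) * hr') ≤ 0 :=
    mul_nonpos_of_nonneg_of_nonpos (by linarith) h1
  have hkl : (0 : ℝ) ≤ (k : ℝ) - l := by
    have : (l : ℝ) ≤ k := by exact_mod_cast hlk.le
    linarith
  have h7 : 0 ≤ ((k : ℝ) - l) * deriv lam (r u) * fν := by positivity
  have h8 : 0 ≤ K * deriv lam (r u) * v := by positivity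
  linarith

end RightHandSide

/-! ### The radial potential and the transition between r and φ -/

section Preparation

set_option maxSynthPendingDepth 3

open Filter Topology ContinuousLinearMap

/-- A primitive of 1/λ. Although λ is only C², ψ is C³, so φ inherits the third derivatives that the
argument uses. -/
theorem exists_radialPotential {I : Set ℝ} {lam : ℝ → ℝ} {a : ℝ} (hI : IsOpen I)
    (hc : I.OrdConnected) (ha : a ∈ I) (hlam : ContDiffOn ℝ 2 lam I) (hpos : ∀ s ∈ I, 0 < lam s) :
    ∃ ψ, RadialPotential I lam ψ := by
  have hinv : ContDiffOn ℝ 2 (fun s => (lam s)⁻¹) I := hlam.inv fun s hs => (hpos s hs).ne'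
  have hd : ∀ s ∈ I, HasDerivAt (fun s => ∫ t in a..s, (lam t)⁻¹) (lam s)⁻¹ s := by
    intro s hs
    refine intervalIntegral.integral_hasDerivAt_right ?_ ?_
      (hinv.continuousOn.continuousAt (hI.mem_nhds hs))
    · exact (hinv.continuousOn.mono (hc.uIcc_subset ha hs)).intervalIntegrable
    · exact hinv.continuousOn.stronglyMeasurableAtFilter hI s hs
  refine ⟨fun s => ∫ t in a..s, (lam t)⁻¹, hI, hlam, hpos, ?_, hd⟩
  rw [show (3 : WithTop ℕ∞) = 2 + 1 by norm_num, contDiffOn_succ_iff_deriv_of_isOpen hI]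
  refine ⟨fun s hs => (hd s hs).differentiableAt.differentiableWithinAt, by simp, ?_⟩
  exact hinv.congr fun s hs => (hd s hs).deriv

theorem RadialPotential.abs_sub_le {I : Set ℝ} {lam ψ : ℝ → ℝ} {a b lam₀ s t : ℝ}
    (h : RadialPotential I lam ψ) (hab : Set.Icc a b ⊆ I) (hlam₀ : 0 < lam₀)
    (hlam : ∀ s ∈ Set.Icc a b, lam₀ ≤ lam s) (hs : s ∈ Set.Icc a b) (ht : t ∈ Set.Icc a b) :
    |ψ s - ψ t| ≤ (b - a) / lam₀ := by
  have h1 := Convex.norm_image_sub_le_of_norm_hasDerivWithin_le (f := ψ) (f' := fun s => (lam s)⁻¹)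
    (s := Set.Icc a b) (C := lam₀⁻¹) (x := t) (y := s)
    (fun s hs => (h.hasDerivAt s (hab hs)).hasDerivWithinAt) (fun s hs => by
      have := hlam s hs
      rw [Real.norm_eq_abs, abs_of_pos (inv_pos.2 (h.pos s (hab hs)))]
      gcongr) (convex_Icc a b) ht hs
  rw [Real.norm_eq_abs, Real.norm_eq_abs] at h1
  refine h1.trans ?_
  rw [div_eq_inv_mul]
  gcongr
  rw [abs_le]
  constructor <;> linarith [hs.1, hs.2, ht.1, ht.2]

theorem differentiableAt_baseRHS {n k l : ℕ} {I : Set ℝ} {lam φ : ℝ → ℝ} {s : ℝ} (hI : IsOpen I)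
    (hlam : ContDiffOn ℝ 2 lam I) (hpos : ∀ s ∈ I, 0 < lam s) (hφ : ContDiffOn ℝ 1 φ I)
    (hs : s ∈ I) : DifferentiableAt ℝ (baseRHS n k l lam φ) s := by
  have h1 := hlam.contDiffAt (hI.mem_nhds hs)
  have h2 : DifferentiableAt ℝ (deriv lam) s := (contDiffAt_deriv h1).differentiableAt one_ne_zero
  have h3 : DifferentiableAt ℝ φ s :=
    (hφ.contDiffAt (hI.mem_nhds hs)).differentiableAt one_ne_zero
  unfold baseRHS
  exact (h3.mul_const _).mul (((h2.div (h1.differentiableAt two_ne_zero) (hpos s hs).ne').const_mul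
    _).pow _)

variable {n : ℕ} {M : Type*} [TopologicalSpace M] [ChartedSpace (Eucl n) M]
  [IsManifold 𝓘(ℝ, Eucl n) ∞ M]
  (g : Bundle.ContMDiffRiemannianMetric 𝓘(ℝ, Eucl n) ∞ (Eucl n)
      (fun u : M => TangentSpace 𝓘(ℝ, Eucl n) u)) {I : Set ℝ} {lam ψ : ℝ → ℝ} {r φ : M → ℝ}

theorem continuous_gradSqAt (hφ : ContMDiff 𝓘(ℝ, Eucl n) 𝓘(ℝ, ℝ) 3 φ) :
    Continuous (gradSqAt g φ) := by
  rw [continuous_iff_continuousAt]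
  intro u
  have h1 : ContinuousAt (gradSq (locMetric g u) (inChart φ u)) (extChartAt 𝓘(ℝ, Eucl n) u u) :=
    ((riemAt_chartMetric g (mem_extChartAt_target u)).contDiffAt_gradSq
      (contDiffAt_inChart (m := 3) hφ (mem_extChartAt_target u))).continuousAt
  have h2 : ContinuousAt (fun w => gradSq (locMetric g u) (inChart φ u)
      (extChartAt 𝓘(ℝ, Eucl n) u w)) u :=
    ContinuousAt.comp (f := extChartAt 𝓘(ℝ, Eucl n) u) h1 (continuousAt_extChartAt u)
  refine h2.congr ?_
  filter_upwards [extChartAt_source_mem_nhds (I := 𝓘(ℝ, Eucl n)) u] with w hw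
  rw [gradSq_inChart g hφ ((extChartAt 𝓘(ℝ, Eucl n) u).map_source hw), PartialEquiv.left_inv _ hw]

theorem gradSqAt_eq_zero_of_isLocalExtr (hψ : RadialPotential I lam ψ)
    (hr : ContMDiff 𝓘(ℝ, Eucl n) 𝓘(ℝ, ℝ) 3 r) {u : M} (hu : r u ∈ I)
    (hext : (∀ w, r u ≤ r w) ∨ ∀ w, r w ≤ r u) : gradSqAt g (fun u => ψ (r u)) u = 0 := by
  have h1 : fderiv ℝ (inChart r u) (extChartAt 𝓘(ℝ, Eucl n) u u) = 0 := by
    rcases hext with h | h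
    · refine IsLocalMin.fderiv_eq_zero (Eventually.of_forall fun y => ?_)
      rw [inChart_self]; exact h _
    · refine IsLocalMax.fderiv_eq_zero (Eventually.of_forall fun y => ?_)
      rw [inChart_self]; exact h _
  have h2 := fderiv_inChart_radial hψ hr hu (gradAt g (fun u => ψ (r u)) u)
  rw [h1, zero_apply] at h2
  exact (mul_eq_zero.1 h2.symm).resolve_left (hψ.pos _ hu).ne'

/-- Since dr = λ dφ, this is the Cauchy–Schwarz inequality for ∇φ. -/
theorem abs_differential_le (hψ : RadialPotential I lam ψ)
    (hr : ContMDiff 𝓘(ℝ, Eucl n) 𝓘(ℝ, ℝ) 3 r) {u : M} (hu : r u ∈ I) (X : Eucl n) :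
    |differential 𝓘(ℝ, ℝ) r u X| ≤ lam (r u) * √(gradSqAt g (fun u => ψ (r u)) u)
      * len (metricForm g) u X := by
  have hl := hψ.pos _ hu
  have h1 : differential 𝓘(ℝ, ℝ) r u X = lam (r u) *
      fderiv ℝ (inChart (fun u => ψ (r u)) u) (extChartAt 𝓘(ℝ, Eucl n) u u) X := by
    rw [differential_eq_fderiv (hr.of_le (by norm_num)), fderiv_inChart_radial hψ hr hu]
  rw [h1, abs_mul, abs_of_pos hl, ← metricForm_gradAt g, mul_assoc, len,
    ← Real.sqrt_mul (gradSqAt_nonneg g _ u), gradSqAt_eq]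
  refine mul_le_mul_of_nonneg_left (Real.abs_le_sqrt ?_) hl.le
  have := (riemAt_chartMetric g (mem_extChartAt_target u)).cauchy_schwarz
    (gradAt g (fun u => ψ (r u)) u) X
  rwa [chartMetric_self] at this

end Preparation

/-! ### The equation in a chart and the bound on α at an interior maximum -/

section MaximumPoint

set_option maxSynthPendingDepth 3

open Filter Topology ContinuousLinearMap

variable {n : ℕ} {M : Type*} [TopologicalSpace M] [ChartedSpace (Eucl n) M]
  [IsManifold 𝓘(ℝ, Eucl n) ∞ M]
  (g : Bundle.ContMDiffRiemannianMetric 𝓘(ℝ, Eucl n) ∞ (Eucl n)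
      (fun u : M => TangentSpace 𝓘(ℝ, Eucl n) u)) {I : Set ℝ} {lam ψ φ₀ : ℝ → ℝ} {r : M → ℝ}
  {f : TangentBundle (prodModel n) (ℝ × M) → ℝ}

/-- The equation in the chart at `p`. -/
theorem sigmaEig_graphEta_eq {k l : ℕ} {t : ℝ} (hlk : l ≤ k) (hψ : RadialPotential I lam ψ)
    (hr : ContMDiff 𝓘(ℝ, Eucl n) 𝓘(ℝ, ℝ) 3 r) (hI : ∀ u, r u ∈ I)
    (hconv : IsEtaConvex (metricForm g) k lam r)
    (hsol : SolvesHomotopy (metricForm g) k l lam φ₀ t f r) {p : M} {y : Eucl n}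
    (hy : y ∈ (extChartAt 𝓘(ℝ, Eucl n) p).target) :
    (∀ j, 1 ≤ j → j ≤ k → 0 < sigmaEig j (graphEta g lam r (fun u => ψ (r u)) p y)) ∧
      sigmaEig k (graphEta g lam r (fun u => ψ (r u)) p y)
        = (lam (inChart r p y)
          * √(1 + gradSq (locMetric g p) (inChart (fun u => ψ (r u)) p) y)) ^ (k - l)
          * homotopyRHS k l lam φ₀ t f (graph r ((extChartAt 𝓘(ℝ, Eucl n) p).symm y))
            (graphNormal g lam r (fun u => ψ (r u)) ((extChartAt 𝓘(ℝ, Eucl n) p).symm y))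
          * sigmaEig l (graphEta g lam r (fun u => ψ (r u)) p y) := by
  have hφ := hψ.contMDiff hr hI
  set φ : M → ℝ := fun u => ψ (r u) with hφdef
  have htr := fun j => sigmaEig_graphEta g (lam := lam) (r := r) hφ hy j
  rw [gradSq_inChart g hφ hy, show inChart r p y = r ((extChartAt 𝓘(ℝ, Eucl n) p).symm y) from rfl]
  simp only [htr, toCentre_self]
  set u := (extChartAt 𝓘(ℝ, Eucl n) p).symm y
  have hσ := fun j => sigmaEta_graph g hψ hr (hI u) j
  have hnormal := isOuterNormal_graphNormal g hψ hr (hI u)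
  have hl := hψ.pos _ (hI u)
  have hv : 0 < √(1 + gradSqAt g φ u) :=
    Real.sqrt_pos.2 (by have := gradSqAt_nonneg g φ u; linarith)
  have hs : 0 < lam (r u) * √(1 + gradSqAt g φ u) := mul_pos hl hv
  have hpos : ∀ j, 1 ≤ j → j ≤ k →
      0 < sigmaEig j (graphEta g lam r φ u (extChartAt 𝓘(ℝ, Eucl n) u u)) := by
    intro j h1 h2
    have h3 := hconv u _ hnormal j h1 h2
    rw [hσ] at h3
    exact pos_of_mul_pos_right h3 (by positivity)
  refine ⟨hpos, ?_⟩
  have hlpos : 0 < sigmaEig l (graphEta g lam r φ u (extChartAt 𝓘(ℝ, Eucl n) u u)) := by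
    rcases Nat.eq_zero_or_pos l with rfl | h
    · simp [sigmaEig, esymm_zero']
    · exact hpos l h hlk
  have h4 := hsol u _ hnormal
  rw [hσ, hσ] at h4
  rw [← h4]
  set s := lam (r u) * √(1 + gradSqAt g φ u)
  obtain ⟨d, rfl⟩ : ∃ d, k = l + d := ⟨k - l, by omega⟩
  rw [Nat.add_sub_cancel_left, pow_add]
  -- The homogeneity factors s⁻ᵏ and s⁻ˡ of the two symmetric functions combine to s^{k−l} on the
  -- right-hand side.
  have halg : ∀ a b : ℝ, b ≠ 0 → a = s ^ d * (s⁻¹ ^ l * s⁻¹ ^ d * a / (s⁻¹ ^ l * b)) * b := by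
    intro a b hb
    have h5 : s ^ d * s⁻¹ ^ d = 1 := by rw [← mul_pow, mul_inv_cancel₀ hs.ne', one_pow]
    have h6 : s⁻¹ ^ l ≠ 0 := pow_ne_zero _ (inv_ne_zero hs.ne')
    rw [mul_assoc (s⁻¹ ^ l), mul_div_mul_left _ _ h6, mul_div_assoc', ← mul_assoc, h5, one_mul,
      div_mul_cancel₀ _ hb]
  exact halg _ _ hlpos.ne'

/-- At a maximum point of `(1/2) log (1 + |∇φ|²) - α φ` either the gradient vanishes or `α` is
bounded. -/
theorem bound_at_max (hn : 2 ≤ n) {k l : ℕ} {r₁ r₂ B m K t α L : ℝ} (hlk : l + 2 ≤ k) (hkn : k ≤ n)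
    (hψ : RadialPotential I lam ψ) (hrI : Set.Icc r₁ r₂ ⊆ I)
    (hlam₁ : ∀ s ∈ I, 0 < deriv lam s)
    (hL : ∀ s ∈ Set.Icc r₁ r₂, lam s ≤ L ∧ deriv lam s ≤ L)
    (hcurv : CurvatureLE (metricForm g) lam r₁ r₂ B)
    (hφ₀ : ContDiffOn ℝ 1 φ₀ I) (ht : t ∈ Set.Icc (0 : ℝ) 1)
    (hf : IsC1OnUnit (metricForm g) lam I f) (hK : C1NormLE (metricForm g) lam r₁ r₂ K f)
    (hmono : RadialMonotone (metricForm g) k l lam r₁ r₂ f)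
    (hbase : t < 1 → (∀ s ∈ Set.Icc r₁ r₂, m ≤ baseRHS n k l lam φ₀ s ∧ baseRHS n k l lam φ₀ s ≤ K ∧
          |deriv (baseRHS n k l lam φ₀) s| ≤ K) ∧
        (∀ s ∈ Set.Ioo r₁ r₂, deriv (fun ρ => lam ρ ^ (k - l) * baseRHS n k l lam φ₀ ρ) s ≤ 0))
    (hr : ContMDiff 𝓘(ℝ, Eucl n) 𝓘(ℝ, ℝ) 3 r) (hrr : ∀ u, r₁ ≤ r u ∧ r u ≤ r₂) (hm : 0 < m)
    (hfm : ∀ u ν, IsOuterNormal (metricForm g) lam r u ν → m ≤ f ⟨graph r u, ν⟩)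
    (hconv : IsEtaConvex (metricForm g) k lam r)
    (hsol : SolvesHomotopy (metricForm g) k l lam φ₀ t f r) {u : M} (hu : r u ∈ Set.Ioo r₁ r₂)
    (hαL : L ≤ α)
    (hmax : ∀ w, (1 / 2) * Real.log (1 + gradSqAt g (fun u => ψ (r u)) w) - α * ψ (r w)
      ≤ (1 / 2) * Real.log (1 + gradSqAt g (fun u => ψ (r u)) u) - α * ψ (r u))
    (hp : 0 < gradSqAt g (fun u => ψ (r u)) u) :
    α ^ 2 / 2 ≤ ((n : ℝ) - 1) * (α * L + |B| * L ^ 2 + |B| * L ^ 2)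
      + k * max 1 K / m * (L * K * (L + α)) := by
  have hI : ∀ u, r u ∈ I := fun u => hrI (hrr u)
  have hφ := hψ.contMDiff hr hI
  set φ : M → ℝ := fun u => ψ (r u) with hφdef
  set x := extChartAt 𝓘(ℝ, Eucl n) u u with hx
  have hxt : x ∈ (extChartAt 𝓘(ℝ, Eucl n) u).target := mem_extChartAt_target u
  have hopen := (isOpen_extChartAt_target (I := 𝓘(ℝ, Eucl n)) u).mem_nhds hxt
  set N := gradAt g φ u with hN
  set p := gradSqAt g φ u with hpdef
  have hs : inChart r u x = r u := inChart_self r u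
  have hl := hψ.pos _ (hI u)
  have hl₁ := hlam₁ _ (hI u)
  obtain ⟨hlL, hl₁L⟩ := hL _ (hrr u)
  have hL0 : 0 < L := hl.trans_le hlL
  have hα0 : 0 < α := hL0.trans_le hαL
  have hv0 : 0 < √(1 + p) := Real.sqrt_pos.2 (by linarith)
  have hv2 : √(1 + p) ^ 2 = 1 + p := Real.sq_sqrt (by linarith)
  set v := √(1 + p) with hv
  have hlam := hψ.lam_at (hI u)
  have hnormal := isOuterNormal_graphNormal g hψ hr (hI u)
  have hfν := hfm u _ hnormal
  obtain ⟨hK1, -, -⟩ := hK (graph r u) (graphNormal g lam r φ u) (hrr u) hnormal.1.1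
  have hK0 : 0 ≤ K := (abs_nonneg _).trans hK1
  have hev := eventually_riemAt_chartMetric g hxt
  have hφ3 : ContDiffAt ℝ 3 (inChart φ u) x := contDiffAt_inChart (m := 3) hφ hxt
  have hmaxloc : IsLocalMax (fun y => (1 / 2) * Real.log (1 + gradSq (locMetric g u) (inChart φ u) y)
      - α * inChart φ u y) x := by
    filter_upwards [hopen] with y hy
    rw [gradSq_inChart g hφ hy, gradSq_inChart g hφ hxt, hx, extChartAt_to_inv, inChart_self]
    exact hmax _
  have hcrit := (conditions_of_isLocalMax hev hφ3 hmaxloc).1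
  change ∀ X, hess (locMetric g u) (inChart φ u) x X N
    = α * (1 + p) * fderiv ℝ (inChart φ u) x X at hcrit
  have hρ : DifferentiableAt ℝ (inChart r u) x :=
    (contDiffAt_inChart (m := 3) hr hxt).differentiableAt three_ne_zero
  have hρN : fderiv ℝ (inChart r u) x N = lam (r u) * p := by
    rw [hx, fderiv_inChart_radial hψ hr (hI u)]
    rfl
  have hline : HasDerivAt (fun t : ℝ => x + t • N) N 0 := by
    simpa using ((hasDerivAt_id (0 : ℝ)).smul_const N).const_add x
  have hx0 : x + (0 : ℝ) • N = x := by simp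
  have hρline : HasDerivAt (fun t : ℝ => inChart r u (x + t • N)) (lam (r u) * p) 0 := by
    rw [← hρN]
    exact hρ.hasFDerivAt.comp_hasDerivAt_of_eq (0 : ℝ) hline hx0.symm
  have hρ0 : inChart r u (x + (0 : ℝ) • N) = r u := by rw [hx0, hs]
  have hc' : HasDerivAt (fun t : ℝ => deriv lam (inChart r u (x + t • N)))
      (deriv (deriv lam) (r u) * (lam (r u) * p)) 0 :=
    (((contDiffAt_deriv hlam).differentiableAt one_ne_zero).hasDerivAt).comp_of_eq (0 : ℝ) hρline hρ0.symm
  have hl' : HasDerivAt (fun t : ℝ => lam (inChart r u (x + t • N)))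
      (deriv lam (r u) * (lam (r u) * p)) 0 :=
    ((hlam.differentiableAt two_ne_zero).hasDerivAt).comp_of_eq (0 : ℝ) hρline hρ0.symm
  have h0 := hev.self_of_nhds
  -- Criticality gives p' = 2α(1 + p)p along the gradient, hence v' = p'/(2v) = αvp.
  have hv' : HasDerivAt (fun t : ℝ => √(1 + gradSq (locMetric g u) (inChart φ u) (x + t • N)))
      (α * v * p) 0 := by
    have h1 := ((h0.contDiffAt_gradSq hφ3).differentiableAt (by norm_num)).hasFDerivAt
    have h2 := (h1.comp_hasDerivAt_of_eq (0 : ℝ) hline hx0.symm).const_add 1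
    have h3 := h2.sqrt (by
      simp only [Function.comp_apply, hx0]
      change 1 + p ≠ 0
      linarith)
    refine h3.congr_deriv ?_
    have h4 : fderiv ℝ (gradSq (locMetric g u) (inChart φ u)) x N = 2 * (α * (1 + p) * p) := by
      have h5 := fderiv_gradSq hev hφ3 N
      refine h5.trans ?_
      rw [show grad (locMetric g u) (inChart φ u) x = N from rfl, hcrit]
      rfl
    rw [h4]
    simp only [Function.comp_apply, hx0]
    change 2 * (α * (1 + p) * p) / (2 * v) = _
    rw [← hv2]
    field_simp
  set F' := horDeriv (warpedMetric (metricForm g) lam) f (graph r u)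
          (graphNormal g lam r φ u) (gradLift g lam r φ u)
        + vertDeriv f (graph r u) (graphNormal g lam r φ u)
          (((deriv lam (r u) - α) / (lam (r u) * v)) • gradLift g lam r φ u) with hF'
  have hFd := hasDerivAt_along_grad g hψ hr hI hf hcrit
  have hbd := differentiableAt_baseRHS (k := k) (l := l) (n := n) hψ.isOpen hψ.contDiffOn_lam hψ.pos hφ₀ (hI u)
  have hbline : HasDerivAt (fun t : ℝ => baseRHS n k l lam φ₀ (inChart r u (x + t • N)))
      (deriv (baseRHS n k l lam φ₀) (r u) * (lam (r u) * p)) 0 :=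
    hbd.hasDerivAt.comp_of_eq (0 : ℝ) hρline hρ0.symm
  have hFt : HasDerivAt (fun τ : ℝ => homotopyRHS k l lam φ₀ t f
      (graph r ((extChartAt 𝓘(ℝ, Eucl n) u).symm (x + τ • N)))
      (graphNormal g lam r φ ((extChartAt 𝓘(ℝ, Eucl n) u).symm (x + τ • N))))
      (t * F' + (1 - t) * (deriv (baseRHS n k l lam φ₀) (r u) * (lam (r u) * p))) 0 :=
    (hFd.const_mul t).add (hbline.const_mul (1 - t))
  set b := baseRHS n k l lam φ₀ (r u) with hb
  set b' := deriv (baseRHS n k l lam φ₀) (r u) with hb'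
  set fν := f ⟨graph r u, graphNormal g lam r φ u⟩ with hfνdef
  have hFg := along_grad_le g (α := α) (by omega : l < k) hmono hψ hr hI hf hK hu hl₁.le
    (hl₁L.trans hαL) (hm.le.trans hfν)
  have hkl : (0 : ℝ) ≤ (k : ℝ) - l := by
    have : (l : ℝ) ≤ k := by exact_mod_cast (by omega : l ≤ k)
    linarith
  -- The factor 1 − t is kept so that t = 1, where nothing is assumed about f⁰, is covered by the
  -- same inequalities.
  have hbase' : (1 - t) * m ≤ (1 - t) * b ∧ (1 - t) * b ≤ (1 - t) * K ∧
      (1 - t) * (((k : ℝ) - l) * deriv lam (r u) * b + lam (r u) * b') ≤ 0 := by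
    rcases ht.2.lt_or_eq with h1 | h1
    · obtain ⟨h2, h3⟩ := hbase h1
      obtain ⟨h4, h5, -⟩ := h2 _ (hrr u)
      have h6 := h3 _ hu
      rw [deriv_pow_mul (by omega) (hlam.differentiableAt two_ne_zero).hasDerivAt hbd.hasDerivAt,
        Nat.cast_sub (by omega)] at h6
      have h7 := nonpos_of_mul_nonpos_right h6 (by positivity)
      have h8 : 0 ≤ 1 - t := by linarith
      exact ⟨mul_le_mul_of_nonneg_left h4 h8, mul_le_mul_of_nonneg_left h5 h8,
        mul_nonpos_of_nonneg_of_nonpos h8 h7⟩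
    · rw [h1]; simp
  obtain ⟨hb1, hb2, hb3⟩ := hbase'
  have heq := fun {y : Eucl n} hy => sigmaEig_graphEta_eq g (t := t) (by omega : l ≤ k) hψ hr hI
    hconv hsol (p := u) (y := y) hy
  have hfx : homotopyRHS k l lam φ₀ t f (graph r ((extChartAt 𝓘(ℝ, Eucl n) u).symm x))
      (graphNormal g lam r φ ((extChartAt 𝓘(ℝ, Eucl n) u).symm x)) = t * fν + (1 - t) * b := by
    rw [hx, extChartAt_to_inv]
    rfl
  have ht0 := ht.1
  -- The modulus |B| is used because the sign of B is not prescribed. Both curvature constants are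
  -- |B|L²: one bounds Bλ² from above, the other bounds |λ''|λ through |λ''| ≤ |B|λ. The bound on
  -- f^t is raised to max 1 K because its powers must dominate it.
  have key := bound_of_isLocalMax (n := n) (F := Eucl n) (g := locMetric g u) (φ := inChart φ u)
    (x := x) (e₀ := stdVec) (c := fun y => deriv lam (inChart r u y))
    (s := fun y => lam (inChart r u y) * √(1 + gradSq (locMetric g u) (inChart φ u) y))
    (fh := fun y => homotopyRHS k l lam φ₀ t f (graph r ((extChartAt 𝓘(ℝ, Eucl n) u).symm y))
      (graphNormal g lam r φ ((extChartAt 𝓘(ℝ, Eucl n) u).symm y)))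
    (α := α) (lam := lam (r u)) (c' := deriv (deriv lam) (r u) * (lam (r u) * p)) (v := v)
    (f' := t * F' + (1 - t) * (b' * (lam (r u) * p)))
    (ψ' := ((k : ℝ) - l) * ((lam (r u) * v) ^ (k - l) * (t * fν + (1 - t) * b))
      * (deriv lam (r u) + α) * p
      + (lam (r u) * v) ^ (k - l) * (t * F' + (1 - t) * (b' * (lam (r u) * p))))
    (B₁ := |B| * L ^ 2) (B₂ := |B| * L ^ 2) (K := K) (K₁ := max 1 K) (m := m)
    (by simp) hlk hkn linearIndependent_stdVec hev hφ3 hmaxloc hp hv0 hv2 hl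
    (by simp only [hs]; rfl) hα0 (by simp only [hs]; linarith) (by positivity) (by positivity)
    hK0 hm ?_ ?_ (le_max_left _ _) (fun j h1 h2 => (heq hxt).1 j h1 h2) ?_ hc' ?_ ?_ ?_ ?_ ?_
  · simp only [hs] at key
    refine key.trans ?_
    have hn1 : (0 : ℝ) ≤ (n : ℝ) - 1 := by
      have : (1 : ℝ) ≤ n := by exact_mod_cast (by omega : 1 ≤ n)
      linarith
    gcongr
  · simp only [hfx]
    have := mul_le_mul_of_nonneg_left hfν ht0
    linarith
  · simp only [hfx]
    have := mul_le_mul_of_nonneg_left ((le_abs_self _).trans hK1) ht0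
    have := le_max_right 1 K
    linarith
  · filter_upwards [hopen] with y hy using (heq hy).2
  -- Along the gradient λ grows at the logarithmic rate λ'p and v at the rate αp, so s = λv grows at
  -- the rate (λ' + α)p.
  · have h1 := (hl'.mul hv').pow (k - l)
    have h2 := h1.mul hFt
    refine h2.congr_deriv ?_
    simp only [Pi.mul_apply, Pi.pow_apply, hx0, hs, hfx]
    change ((k - l : ℕ) : ℝ) * (lam (r u) * v) ^ (k - l - 1)
      * (deriv lam (r u) * (lam (r u) * p) * v + lam (r u) * (α * v * p))
      * (t * fν + (1 - t) * b)
      + (lam (r u) * v) ^ (k - l) * (t * F' + (1 - t) * (b' * (lam (r u) * p))) = _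
    rw [← Nat.cast_sub (by omega)]
    obtain ⟨d, hd⟩ : ∃ d, k - l = d + 1 := ⟨k - l - 1, by omega⟩
    rw [hd, Nat.add_sub_cancel]
    ring
  · simp only [hfx, hs]
    rfl
  · simp only [hfx, hs]
    change ((k : ℝ) - l) * deriv lam (r u) * p * (t * fν + (1 - t) * b)
      + (t * F' + (1 - t) * (b' * (lam (r u) * p))) ≤ _
    have h1 : t * (((k : ℝ) - l) * deriv lam (r u) * p * fν + F')
        ≤ t * (K * v * (lam (r u) + α)) := mul_le_mul_of_nonneg_left hFg ht0
    have h2 := mul_nonpos_of_nonneg_of_nonpos hp.le hb3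
    have h3 : 0 ≤ (1 - t) * (K * v * (lam (r u) + α)) :=
      mul_nonneg (by linarith [ht.2]) (by positivity)
    linarith
  · change -(|B| * L ^ 2 * p) ≤ _
    have : Nonempty (Fin n) := ⟨⟨0, by omega⟩⟩
    obtain ⟨X, hX⟩ := exists_ne (0 : Eucl n)
    have h1 := hcurv.abs_deriv_deriv_le g (hrr u) hlam hl u hX
    have h2 : |deriv (deriv lam) (r u)| ≤ |B| * L :=
      h1.trans (mul_le_mul (le_abs_self B) hlL hl.le (abs_nonneg B))
    have h3 := (neg_le_of_abs_le h2)
    have h4 : lam (r u) * p ≤ L * p := by gcongr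
    have h5 : -(|B| * L) * (lam (r u) * p) ≤ deriv (deriv lam) (r u) * (lam (r u) * p) := by
      gcongr
    have h6 : |B| * L * (lam (r u) * p) ≤ |B| * L * (L * p) := by gcongr
    linarith
  · intro X Y
    have h1 := hcurv.sectional_le g (hrr u) hlam hl u X Y
    rw [hx, locMetric_self]
    refine h1.trans ?_
    have hnn : ∀ Z : Eucl n, 0 ≤ metricForm g u Z Z := fun Z => by
      have := (riemAt_chartMetric g hxt).nonneg Z
      rwa [hx, chartMetric_self] at this
    have h2 := hnn X
    have h3 := hnn Y
    have h4 : B * lam (r u) ^ 2 ≤ |B| * L ^ 2 :=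
      (mul_le_mul_of_nonneg_right (le_abs_self B) (sq_nonneg _)).trans (by gcongr)
    gcongr

end MaximumPoint

/-! ### Choice of α and the final estimate -/

/-- The multiple of the radial potential in the test function, as a function of the data. -/
def testCoeff (n k : ℕ) (L B m K : ℝ) : ℝ :=
  2 * (((n : ℝ) - 1) * L + k * max 1 K / m * (L * K)
    + (((n : ℝ) - 1) * (|B| * L ^ 2 + |B| * L ^ 2) + k * max 1 K / m * (L * K * L)) + 1) + L

/-- The left side is Aα + D with A, D ≥ 0, and α = 2(A + D + 1) + L makes α²/2 exceed it. The
summand L keeps α above λ', which makes the curvature in the gradient direction nonpositive. -/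
theorem testCoeff_spec {n k : ℕ} {L B m K : ℝ} (hn : 2 ≤ n) (hL : 0 < L) (hm : 0 < m)
    (hK : 0 ≤ K) :
    L ≤ testCoeff n k L B m K ∧
      ((n : ℝ) - 1) * (testCoeff n k L B m K * L + |B| * L ^ 2 + |B| * L ^ 2)
        + k * max 1 K / m * (L * K * (L + testCoeff n k L B m K))
        < testCoeff n k L B m K ^ 2 / 2 := by
  have hn1 : (0 : ℝ) ≤ (n : ℝ) - 1 := by
    have : (1 : ℝ) ≤ n := by exact_mod_cast (by omega : 1 ≤ n)
    linarith
  have hM : 0 ≤ k * max 1 K / m := by positivity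
  set Q := k * max 1 K / m with hQ
  set A := ((n : ℝ) - 1) * L + Q * (L * K) with hA
  set D := ((n : ℝ) - 1) * (|B| * L ^ 2 + |B| * L ^ 2) + Q * (L * K * L) with hD
  have hA0 : 0 ≤ A := by positivity
  have hD0 : 0 ≤ D := by positivity
  have hα : testCoeff n k L B m K = 2 * (A + D + 1) + L := rfl
  set α := testCoeff n k L B m K with hαdef
  refine ⟨by linarith, ?_⟩
  have h1 : ((n : ℝ) - 1) * (α * L + |B| * L ^ 2 + |B| * L ^ 2) + Q * (L * K * (L + α))
      = A * α + D := by rw [hA, hD]; ring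
  rw [h1]
  have h2 : 2 * (A + D + 1) ≤ α := by linarith
  have h3 : 1 ≤ α := by linarith
  have h4 : D * 1 ≤ D * α := mul_le_mul_of_nonneg_left h3 hD0
  have h5 : 2 * (A + D + 1) * α ≤ α * α := mul_le_mul_of_nonneg_right h2 (by linarith)
  nlinarith

variable {n : ℕ} {M : Type*} [TopologicalSpace M] [ChartedSpace (Eucl n) M]
  [IsManifold 𝓘(ℝ, Eucl n) ∞ M] [CompactSpace M] [T2Space M]
  (g : Bundle.ContMDiffRiemannianMetric 𝓘(ℝ, Eucl n) ∞ (Eucl n)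
    (fun u : M => TangentSpace 𝓘(ℝ, Eucl n) u))

/-- The gradient estimate with an explicit constant. -/
theorem gradient_estimate {k l : ℕ} {I : Set ℝ} {lam φ₀ : ℝ → ℝ}
    {f : TangentBundle (prodModel n) (ℝ × M) → ℝ} {r : M → ℝ} {r₁ r₂ lam₀ L B m K t : ℝ}
    (hlk : l + 2 ≤ k) (hkn : k ≤ n) (hlam₀ : 0 < lam₀) (hm : 0 < m)
    (hIo : IsOpen I) (hIc : I.OrdConnected) (hrI : Set.Icc r₁ r₂ ⊆ I)
    (hlam : ContDiffOn ℝ 2 lam I) (hlampos : ∀ s ∈ I, 0 < lam s)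
    (hlam₁ : ∀ s ∈ I, 0 < deriv lam s)
    (hL : ∀ s ∈ Set.Icc r₁ r₂, lam₀ ≤ lam s ∧ lam s ≤ L ∧ deriv lam s ≤ L)
    (hcurv : CurvatureLE (metricForm g) lam r₁ r₂ B)
    (hφ₀ : ContDiffOn ℝ 1 φ₀ I) (ht : t ∈ Set.Icc (0 : ℝ) 1)
    (hf : IsC1OnUnit (metricForm g) lam I f) (hK : C1NormLE (metricForm g) lam r₁ r₂ K f)
    (hmono : RadialMonotone (metricForm g) k l lam r₁ r₂ f)
    (hbase : t < 1 → (∀ s ∈ Set.Icc r₁ r₂, m ≤ baseRHS n k l lam φ₀ s ∧ baseRHS n k l lam φ₀ s ≤ K ∧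
          |deriv (baseRHS n k l lam φ₀) s| ≤ K) ∧
        (∀ s ∈ Set.Ioo r₁ r₂, deriv (fun ρ => lam ρ ^ (k - l) * baseRHS n k l lam φ₀ ρ) s ≤ 0))
    (hr : ContMDiff 𝓘(ℝ, Eucl n) 𝓘(ℝ, ℝ) 3 r) (hrr : ∀ u, r₁ ≤ r u ∧ r u ≤ r₂)
    (hfm : ∀ u ν, IsOuterNormal (metricForm g) lam r u ν → m ≤ f ⟨graph r u, ν⟩)
    (hconv : IsEtaConvex (metricForm g) k lam r)
    (hsol : SolvesHomotopy (metricForm g) k l lam φ₀ t f r) (u : M) (X : Eucl n) :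
    |differential 𝓘(ℝ, ℝ) r u X|
      ≤ L * Real.exp (testCoeff n k L B m K * ((r₂ - r₁) / lam₀)) * len (metricForm g) u X := by
  have hI : ∀ u, r u ∈ I := fun u => hrI (hrr u)
  obtain ⟨ψ, hψ⟩ := exists_radialPotential hIo hIc (hI u) hlam hlampos
  have hL0 : 0 < L := (hlampos _ (hI u)).trans_le (hL _ (hrr u)).2.1
  have hK0 : 0 ≤ K := (abs_nonneg _).trans
    (hK (graph r u) (graphNormal g lam r (fun u => ψ (r u)) u) (hrr u)
      (isOuterNormal_graphNormal g hψ hr (hI u)).1.1).1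
  obtain ⟨hαL, hα⟩ := testCoeff_spec (n := n) (k := k) (B := B) (by omega) hL0 hm hK0
  set α := testCoeff n k L B m K
  have hα0 : 0 < α := hL0.trans_le hαL
  have hφ := hψ.contMDiff hr hI
  set p := gradSqAt g (fun u => ψ (r u)) with hp
  have hp0 : ∀ w, 0 ≤ p w := fun w => gradSqAt_nonneg g _ w
  have hcont : Continuous fun w => (1 / 2) * Real.log (1 + p w) - α * ψ (r w) :=
    (continuous_const.mul ((continuous_const.add (continuous_gradSqAt g hφ)).log
      fun w => (add_pos_of_pos_of_nonneg one_pos (hp0 w)).ne')).sub (continuous_const.mul hφ.continuous)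
  obtain ⟨w, -, hw⟩ := isCompact_univ.exists_isMaxOn ⟨u, Set.mem_univ u⟩ hcont.continuousOn
  have hw : ∀ z, (1 / 2) * Real.log (1 + p z) - α * ψ (r z)
      ≤ (1 / 2) * Real.log (1 + p w) - α * ψ (r w) := fun z => hw (Set.mem_univ z)
  -- At r = r₁ or r = r₂ monotonicity is not available, but there r has a global extremum and the
  -- gradient vanishes. Elsewhere a nonzero gradient contradicts the choice of α.
  have hpw : p w = 0 := by
    rcases (hrr w).1.eq_or_lt with h1 | h1
    · exact gradSqAt_eq_zero_of_isLocalExtr g hψ hr (hI w) (Or.inl fun z => h1 ▸ (hrr z).1)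
    rcases (hrr w).2.eq_or_lt with h2 | h2
    · exact gradSqAt_eq_zero_of_isLocalExtr g hψ hr (hI w) (Or.inr fun z => h2 ▸ (hrr z).2)
    by_contra hne
    exact absurd (bound_at_max g (by omega) hlk hkn hψ hrI hlam₁ (fun s hs => (hL s hs).2) hcurv
      hφ₀ ht hf hK hmono hbase hr hrr hm hfm hconv hsol ⟨h1, h2⟩ hαL hw
      ((hp0 w).lt_of_ne' hne)) hα.not_ge
  have h1 := hw u
  rw [hpw, add_zero, Real.log_one, mul_zero, zero_sub] at h1
  have h2 := hψ.abs_sub_le hrI hlam₀ (fun s hs => (hL s hs).1) (hrr u) (hrr w)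
  have h3 : α * (ψ (r u) - ψ (r w)) ≤ α * ((r₂ - r₁) / lam₀) :=
    mul_le_mul_of_nonneg_left ((le_abs_self _).trans h2) hα0.le
  -- Comparison of the test function at u and at the maximum point bounds log v by α times the
  -- oscillation of ψ on [r₁, r₂].
  have h4 : √(p u) ≤ Real.exp (α * ((r₂ - r₁) / lam₀)) := by
    have h5 : √(p u) ≤ √(1 + p u) := Real.sqrt_le_sqrt (by linarith)
    have h6 : 0 < √(1 + p u) := Real.sqrt_pos.2 (by linarith [hp0 u])
    refine h5.trans ((Real.log_le_iff_le_exp h6).1 ?_)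
    rw [Real.log_sqrt (by linarith [hp0 u])]
    linarith
  refine (abs_differential_le g hψ hr (hI u) X).trans ?_
  have h7 := (hL _ (hrr u)).2.1
  have h8 : 0 ≤ len (metricForm g) u X := Real.sqrt_nonneg _
  gcongr

end HessianQuotient

end

open HessianQuotient in
theorem mainTheorem3 (n k l : ℕ) (hlk : l + 2 ≤ k) (hkn : k ≤ n)
    (r₁ r₂ lam₀ L B m K : ℝ) (hr₁ : 0 < r₁) (hlam₀ : 0 < lam₀) (hm : 0 < m) :
    ∃ C : ℝ, ∀ (M : Type*) [TopologicalSpace M] [ChartedSpace (Eucl n) M]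
      [IsManifold 𝓘(ℝ, Eucl n) ∞ M] [CompactSpace M] [T2Space M]
      (g : Bundle.ContMDiffRiemannianMetric 𝓘(ℝ, Eucl n) ∞ (Eucl n)
        (fun u : M => TangentSpace 𝓘(ℝ, Eucl n) u))
      (I : Set ℝ) (lam φ : ℝ → ℝ) (f : TangentBundle (prodModel n) (ℝ × M) → ℝ)
      (t : ℝ) (r : M → ℝ),
      -- the warped product `I × M`, its geometry on the annulus `r₁ ≤ r ≤ r₂`
      IsOpen I → I.OrdConnected → Set.Icc r₁ r₂ ⊆ I →
      ContDiffOn ℝ 2 lam I → (∀ s ∈ I, 0 < lam s) → (∀ s ∈ I, 0 < deriv lam s) →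
      (∀ s ∈ Set.Icc r₁ r₂, lam₀ ≤ lam s ∧ lam s ≤ L ∧ deriv lam s ≤ L) →
      CurvatureLE (metricForm g) lam r₁ r₂ B →
      -- the right-hand side of the equation
      ContDiffOn ℝ 1 φ I → (∀ s ∈ I, 0 < φ s) → t ∈ Set.Icc (0 : ℝ) 1 →
      IsC1OnUnit (metricForm g) lam I f → C1NormLE (metricForm g) lam r₁ r₂ K f →
      RadialMonotone (metricForm g) k l lam r₁ r₂ f →
      (t < 1 →
        (∀ s ∈ Set.Icc r₁ r₂, m ≤ baseRHS n k l lam φ s ∧ baseRHS n k l lam φ s ≤ K ∧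
          |deriv (baseRHS n k l lam φ) s| ≤ K) ∧
        (∀ s ∈ Set.Ioo r₁ r₂, deriv (fun ρ => lam ρ ^ (k - l) * baseRHS n k l lam φ ρ) s ≤ 0)) →
      -- the solution
      ContMDiff 𝓘(ℝ, Eucl n) 𝓘(ℝ, ℝ) 3 r → (∀ u, r₁ ≤ r u ∧ r u ≤ r₂) →
      (∀ u ν, IsOuterNormal (metricForm g) lam r u ν → m ≤ f ⟨graph r u, ν⟩) →
      IsEtaConvex (metricForm g) k lam r →
      SolvesHomotopy (metricForm g) k l lam φ t f r →
      ∀ (u : M) (v : Eucl n),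
        |differential 𝓘(ℝ, ℝ) r u v| ≤ C * len (metricForm g) u v := by
  -- L bounds λ in |Dr| = λ|∇φ|, and the exponential bounds |∇φ|. The constant is fixed before the
  -- manifold and the solution are introduced.
  refine ⟨L * Real.exp (testCoeff n k L B m K * ((r₂ - r₁) / lam₀)), ?_⟩
  intro M _ _ _ _ _ g I lam φ f t r hIo hIc hrI hlam hlampos hlam₁ hL hcurv hφ _ ht hf hK hmono
    hbase hr hrr hfm hconv hsol u v
  exact gradient_estimate g hlk hkn hlam₀ hm hIo hIc hrI hlam hlampos hlam₁ hL hcurv hφ ht hf hK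
    hmono hbase hr hrr hfm hconv hsol u v
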